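/- Let $G$ and $H$ be locally compact Hausdorff groups with left Haar measures, let $G\times H$ carry the product Haar measure, and let $\mathcal A=(A_t)_{t\in G}$ and $\mathcal B=(B_s)_{s\in H}$ be Fell bundles. Let $\alpha$ denote either the minimal or the maximal C*-norm on algebraic tensor products of C*-algebras. Let $\mathcal A\otimes_\alpha\mathcal B$ be the corresponding tensor product Fell bundle over $G\times H$: its fibre over $(t,s)$ is a completion of the (algebraic) tensor product $A_t\odot B_s$, the operations are determined by $(a\otimes b)(a'\otimes b')=aa'\otimes bb'$ and $(a\otimes b)^*=a^*\otimes b^*$, the map $(a,b)\mapsto a\otimes b$ is continuous, and the norm on $A_e\odot B_e$ is $\alpha$, so that its unit fibre is $A_e\otimes_\alpha B_e$. For a Fell bundle $\mathcal C=(C_u)_{u\in K}$ over a locally compact group $K$ and $t\in K$, let $C_c^t(\mathcal C)$ be the space of continuous compactly supported functions $\xi$ with $\xi(u)\in C_{ut}$ for all $u\in K$. Let $L^2_t(\mathcal C)$ be the right Hilbert $C_e$-module obtained by completing it with respect to $\langle\xi,\eta\rangle=\int_K\xi(u)^*\eta(u)\,du$. Write $L^2(\mathcal C)=L^2_e(\mathcal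 C)$, and let $I_t(\mathcal C)=\mathcal K(L^2_t(\mathcal C))$ be the C*-algebra of compact operators, i.e. the closed span of the operators $\theta_{x,y}:z\mapsto x\langle y,z\rangle$. Let $\rho^{\mathcal C}_t:C_c^e(\mathcal C)\to C_c^t(\mathcal C)$ be $\rho^{\mathcal C}_t(\xi)(u)=\Delta(t)^{1/2}\xi(ut)$, where $\Delta$ is the modular function, normalised by $\int f(ut)\,du=\Delta(t)^{-1}\int f(u)\,du$. Let $r\in G$ and $s\in H$. For $\xi\in C_c^r(\mathcal A)$ and $\eta\in C_c^s(\mathcal B)$ let $\xi\oslash\eta\in C_c^{(r,s)}(\mathcal A\otimes_\alpha\mathcal B)$ be given by $(\xi\oslash\eta)(g,h)=\xi(g)\otimes\eta(h)$. Let $L^2_r(\mathcal A)\otimes_\alpha L^2_s(\mathcal B)$ be the exterior tensor product, i.e. the Hilbert $(A_e\otimes_\alpha B_e)$-module obtained by completing the algebraic tensor product with respect to $\langle x\otimes y,x'\otimes y'\rangle=\langle x,x'\rangle\otimes\langle y,y'\rangle$. Then: 1. The map $\xi\odot\eta\mapsto\xi\oslash\eta$ ($\xi\in C_c^r(\mathcal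 A)$, $\eta\in C_c^s(\mathcal B)$) extends uniquely to an isomorphism of Hilbert $(A_e\otimes_\alpha B_e)$-modules $$j_2^{(r,s)}:L^2_r(\mathcal A)\otimes_\alpha L^2_s(\mathcal B)\to L^2_{(r,s)}(\mathcal A\otimes_\alpha\mathcal B).$$ 2. The maps $\rho^{\mathcal A}_r$, $\rho^{\mathcal B}_s$ and $\rho^{\mathcal A\otimes_\alpha\mathcal B}_{(r,s)}$ extend to isomorphisms of Hilbert modules $L^2(\mathcal A)\to L^2_r(\mathcal A)$, $L^2(\mathcal B)\to L^2_s(\mathcal B)$ and $L^2(\mathcal A\otimes_\alpha\mathcal B)\to L^2_{(r,s)}(\mathcal A\otimes_\alpha\mathcal B)$. The first two induce an isomorphism $\rho^{\mathcal A}_r\otimes\rho^{\mathcal B}_s:L^2(\mathcal A)\otimes_\alpha L^2(\mathcal B)\to L^2_r(\mathcal A)\otimes_\alpha L^2_s(\mathcal B)$, and, with $j_2=j_2^{(e,e)}$, $$j_2^{(r,s)}\circ(\rho^{\mathcal A}_r\otimes\rho^{\mathcal B}_s)=\rho^{\mathcal A\otimes_\alpha\mathcal B}_{(r,s)}\circ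 j_2 .$$ 3. The isomorphism $j_2^{(r,s)}$ induces a $*$-isomorphism $(j_2^{(r,s)})^l:I_r(\mathcal A)\otimes_\alpha I_s(\mathcal B)\to I_{(r,s)}(\mathcal A\otimes_\alpha\mathcal B)$, in the sense that $$(j_2^{(r,s)})^l(k\otimes l)\,j_2^{(r,s)}(x\otimes y)=j_2^{(r,s)}(kx\otimes ly)$$ for all $k\in I_r(\mathcal A)$, $l\in I_s(\mathcal B)$, $x\in L^2_r(\mathcal A)$, $y\in L^2_s(\mathcal B)$. It is the unique $*$-isomorphism such that $\theta_{\xi_1,\xi_2}\otimes\theta_{\eta_1,\eta_2}\mapsto\theta_{\xi_1\oslash\eta_1,\;\xi_2\oslash\eta_2}$ for all $\xi_1,\xi_2\in C_c^r(\mathcal A)$ and $\eta_1,\eta_2\in C_c^s(\mathcal B)$. -/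

import Mathlib

open scoped TensorProduct Topology
open UniformSpace (Completion)

noncomputable section

section Positivity

variable {A : Type*} [NonUnitalCStarAlgebra A]

/-- Positivity of an element of a C⋆-algebra. -/
def IsPos (a : A) : Prop := ∃ b : A, a = star b * b

theorem isPos_iff [PartialOrder A] [StarOrderedRing A] {a : A} : IsPos a ↔ 0 ≤ a :=
  CStarAlgebra.nonneg_iff_eq_star_mul_self.symm

theorem isClosed_isPos : IsClosed {a : A | IsPos a} := by
  let _ := CStarAlgebra.spectralOrder A
  have := CStarAlgebra.spectralOrderedRing A
  simpa only [isPos_iff] using CStarAlgebra.isClosed_nonneg (A := A)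

theorem IsPos.sum {ι : Type*} (s : Finset ι) {f : ι → A} (h : ∀ i ∈ s, IsPos (f i)) :
    IsPos (∑ i ∈ s, f i) := by
  let _ := CStarAlgebra.spectralOrder A
  have := CStarAlgebra.spectralOrderedRing A
  simp only [isPos_iff] at h ⊢
  exact Finset.sum_nonneg h

/-- The Cauchy–Schwarz step: if `a* p a - s (a* k) - s (k* a) + s² q ≥ 0` for all `a`, then
`‖k‖² ≤ ‖p‖ ‖q‖`. -/
theorem norm_sq_le_of_isPos {p q k : A} (hp : IsPos p)
    (h : ∀ (a : A) (s : ℝ), IsPos (star a * p * a - s • (star a * k) - s • (star k * a)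
      + (s ^ 2) • q)) : ‖k‖ ^ 2 ≤ ‖p‖ * ‖q‖ := by
  let _ := CStarAlgebra.spectralOrder A
  have := CStarAlgebra.spectralOrderedRing A
  have key : ∀ s : ℝ, ‖p‖ < s → ‖k‖ ^ 2 ≤ s * ‖q‖ := by
    intro s hs
    have hs0 : 0 < s := (norm_nonneg p).trans_lt hs
    have hpsa : IsSelfAdjoint p := by
      obtain ⟨b, rfl⟩ := hp
      exact IsSelfAdjoint.star_mul_self b
    have h1 := isPos_iff.1 (h k s)
    have h2 : star k * p * k ≤ s • (star k * k) :=
      (CStarAlgebra.star_left_conjugate_le_norm_smul (a := k) hpsa).trans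
        (smul_le_smul_of_nonneg_right hs.le (star_mul_self_nonneg k))
    have h3 : s • (star k * k) ≤ s • (s • q) := by
      rw [smul_smul, ← sq, ← sub_nonneg]
      have := add_le_add h1 (sub_nonneg.2 h2)
      rw [zero_add] at this
      refine this.trans_eq ?_
      abel
    have h4 : star k * k ≤ s • q := by
      have := smul_le_smul_of_nonneg_left h3 (inv_nonneg.2 hs0.le)
      simpa only [smul_smul, ← mul_assoc, inv_mul_cancel₀ hs0.ne', one_smul, one_mul] using this
    have h5 := CStarAlgebra.norm_le_norm_of_nonneg_of_le (star_mul_self_nonneg k) h4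
    rw [CStarRing.norm_star_mul_self, norm_smul, Real.norm_of_nonneg hs0.le, ← sq] at h5
    exact h5
  refine ge_of_tendsto (x := 𝓝[>] ‖p‖) (f := fun s : ℝ => s * ‖q‖) ?_
    (Filter.eventually_of_mem self_mem_nhdsWithin fun s hs => key s hs)
  exact ((continuous_id.mul continuous_const).tendsto _).mono_left nhdsWithin_le_nhds

end Positivity

/-- Right Hilbert modules over a C⋆-algebra `A`, with inner product linear in the second variable;
completeness is a separate assumption. -/
class HilbertModule (A : outParam Type*) (E : Type*) [NonUnitalCStarAlgebra A]
    [NormedAddCommGroup E] [NormedSpace ℂ E] where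
  /-- the right action `x ↦ x a` -/
  act : E → A → E
  /-- the `A`-valued inner product -/
  inner : E → E → A
  add_act : ∀ x y a, act (x + y) a = act x a + act y a
  act_add : ∀ x a b, act x (a + b) = act x a + act x b
  act_mul : ∀ x a b, act x (a * b) = act (act x a) b
  smul_act : ∀ (c : ℂ) x a, act (c • x) a = c • act x a
  act_smul : ∀ (c : ℂ) x a, act x (c • a) = c • act x a
  inner_add : ∀ x y z, inner x (y + z) = inner x y + inner x z
  inner_smul : ∀ (c : ℂ) x y, inner x (c • y) = c • inner x y
  inner_act : ∀ x y a, inner x (act y a) = inner x y * a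
  star_inner : ∀ x y, star (inner x y) = inner y x
  inner_self_pos : ∀ x, IsPos (inner x x)
  norm_sq : ∀ x, ‖x‖ ^ 2 = ‖inner x x‖

/-- An isomorphism of right Hilbert `A`-modules, i.e. a surjective `A`-linear map preserving the
inner product. -/
structure HilbertModule.Iso {A : Type*} (E F : Type*) [NonUnitalCStarAlgebra A]
    [NormedAddCommGroup E] [NormedSpace ℂ E] [NormedAddCommGroup F] [NormedSpace ℂ F]
    [HilbertModule A E] [HilbertModule A F] extends E ≃ₗ[ℂ] F where
  map_act : ∀ x (a : A), toFun (act x a) = act (toFun x) a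
  inner_map : ∀ x y, inner (toFun x) (toFun y) = (inner x y : A)

/-- A complex vector space with a positive semidefinite `A`-valued sesquilinear form such that, for
a dense set of `a ∈ A`, each `x` can be multiplied by `a` on the right.  (The product need not be
named: in the Hausdorff completion it is determined by `⟨y, x a⟩ = ⟨y, x⟩ a`.) -/
structure PreHilbert (A X : Type*) [NonUnitalCStarAlgebra A] [AddCommGroup X] [Module ℂ X] where
  inner : X → X → A
  inner_add : ∀ x y z, inner x (y + z) = inner x y + inner x z
  inner_smul : ∀ (c : ℂ) x y, inner x (c • y) = c • inner x y
  star_inner : ∀ x y, star (inner x y) = inner y x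
  inner_self_pos : ∀ x, IsPos (inner x x)
  dense_act : Dense {a : A | ∀ x, ∃ z, ∀ y, inner y z = inner y x * a}

namespace PreHilbert

variable {A X : Type*} [NonUnitalCStarAlgebra A] [AddCommGroup X] [Module ℂ X]
  (P : PreHilbert A X)

theorem add_inner (x y z : X) : P.inner (x + y) z = P.inner x z + P.inner y z := by
  rw [← P.star_inner, P.inner_add, star_add, P.star_inner, P.star_inner]

theorem smul_inner (c : ℂ) (x y : X) : P.inner (c • x) y = star c • P.inner x y := by
  rw [← P.star_inner, P.inner_smul, star_smul, P.star_inner]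

theorem inner_neg (x y : X) : P.inner x (-y) = -P.inner x y := by
  rw [← neg_one_smul ℂ y, P.inner_smul, neg_one_smul]

theorem norm_inner_sq_le (x y : X) :
    ‖P.inner x y‖ ^ 2 ≤ ‖P.inner x x‖ * ‖P.inner y y‖ := by
  refine norm_sq_le_of_isPos (P.inner_self_pos x) fun a s => ?_
  have hcl : IsClosed {a : A | IsPos (star a * P.inner x x * a - s • (star a * P.inner x y)
      - s • (star (P.inner x y) * a) + (s ^ 2) • P.inner y y)} :=
    isClosed_isPos.preimage (by fun_prop)
  refine hcl.closure_subset_iff.2 ?_ (P.dense_act a)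
  intro a ha
  obtain ⟨z, hz⟩ := ha x
  have h1 : ∀ w, P.inner z w = star a * P.inner x w := fun w => by
    rw [← P.star_inner, hz, star_mul, P.star_inner]
  have h2 := P.inner_self_pos (z + (-(s : ℂ)) • y)
  rw [Set.mem_ofPred_eq]
  have hs : star (s : ℂ) = s := Complex.conj_ofReal s
  have h3 : ∀ b : A, (s : ℂ) • b = s • b := fun b => Complex.coe_smul s b
  convert h2 using 1
  rw [P.inner_add, P.add_inner, P.add_inner, P.inner_smul, P.inner_smul, P.smul_inner,
    P.smul_inner]
  simp only [hz, h1, star_neg, hs, neg_smul, h3, P.star_inner, mul_assoc, smul_neg, smul_smul, neg_neg, sq]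
  abel

/-- The vector space of a pre-Hilbert module, with its seminorm `‖⟨x, x⟩‖^{1/2}`. -/
@[nolint unusedArguments]
def Carrier (_ : PreHilbert A X) : Type _ := X

instance : AddCommGroup P.Carrier := inferInstanceAs (AddCommGroup X)

instance : Module ℂ P.Carrier := inferInstanceAs (Module ℂ X)

instance : Norm P.Carrier := ⟨fun x => √‖P.inner x x‖⟩

theorem norm_def (x : P.Carrier) : ‖x‖ = √‖P.inner x x‖ := rfl

theorem norm_sq (x : P.Carrier) : ‖x‖ ^ 2 = ‖P.inner x x‖ := Real.sq_sqrt (norm_nonneg _)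

theorem norm_inner_le (x y : P.Carrier) : ‖P.inner x y‖ ≤ ‖x‖ * ‖y‖ := by
  rw [P.norm_def, P.norm_def, ← Real.sqrt_mul (norm_nonneg _)]
  exact Real.le_sqrt_of_sq_le (P.norm_inner_sq_le x y)

theorem seminormCore : SeminormedSpace.Core ℂ P.Carrier where
  norm_nonneg _ := Real.sqrt_nonneg _
  norm_smul c x := by
    have h : ∀ x : X, P.inner (c • x) (c • x) = (star c * c) • P.inner x x := fun x => by
      rw [P.inner_smul, P.smul_inner, smul_smul, mul_comm]
    refine (congrArg (fun a => √‖a‖) (h x)).trans ?_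
    rw [ norm_smul, CStarRing.norm_star_mul_self, Real.sqrt_mul (by positivity),
      Real.sqrt_mul_self (norm_nonneg _)]
    rfl
  norm_triangle x y := by
    have hx : 0 ≤ ‖x‖ := Real.sqrt_nonneg _
    have hy : 0 ≤ ‖y‖ := Real.sqrt_nonneg _
    refine abs_le_of_sq_le_sq' ?_ (by positivity) |>.2
    rw [P.norm_sq]
    have h : ∀ x y : X, P.inner (x + y) (x + y)
        = P.inner x x + P.inner x y + (P.inner y x + P.inner y y) := fun x y => by
      rw [P.add_inner, P.inner_add, P.inner_add]
    refine (congrArg norm (h x y)).trans_le ?_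
    calc _ ≤ ‖P.inner x x‖ + ‖P.inner x y‖ + (‖P.inner y x‖ + ‖P.inner y y‖) :=
          (norm_add_le _ _).trans (add_le_add (norm_add_le _ _) (norm_add_le _ _))
      _ ≤ ‖x‖ ^ 2 + ‖x‖ * ‖y‖ + (‖y‖ * ‖x‖ + ‖y‖ ^ 2) := by
          rw [P.norm_sq, P.norm_sq]
          gcongr <;> exact P.norm_inner_le _ _
      _ = (‖x‖ + ‖y‖) ^ 2 := by ring

instance : SeminormedAddCommGroup P.Carrier := SeminormedAddCommGroup.ofCore P.seminormCore

instance : NormedSpace ℂ P.Carrier where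
  norm_smul_le c x := (P.seminormCore.norm_smul c x).le

theorem continuous_inner : Continuous fun p : P.Carrier × P.Carrier => P.inner p.1 p.2 := by
  let f : P.Carrier →ₗ⋆[ℂ] P.Carrier →ₗ[ℂ] A :=
    LinearMap.mk₂'ₛₗ (starRingEnd ℂ) (RingHom.id ℂ) (fun x y : P.Carrier => P.inner x y)
      P.add_inner P.smul_inner P.inner_add P.inner_smul
  let g := LinearMap.mkContinuous₂ f 1 fun x y => by
    rw [one_mul]; exact P.norm_inner_le x y
  exact (g.continuous.comp continuous_fst).clm_apply continuous_snd

/-- The Hilbert module completion: the Hausdorff completion for `‖x‖ = ‖⟨x, x⟩‖^{1/2}`. -/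
def Compl : Type _ := Completion P.Carrier

instance : NormedAddCommGroup P.Compl := inferInstanceAs (NormedAddCommGroup (Completion P.Carrier))

instance : NormedSpace ℂ P.Compl := inferInstanceAs (NormedSpace ℂ (Completion P.Carrier))

instance : CompleteSpace P.Compl := inferInstanceAs (CompleteSpace (Completion P.Carrier))

/-- The canonical map into the completion. -/
def toCompl : X →ₗ[ℂ] P.Compl :=
  ((Completion.toComplₗᵢ : P.Carrier →ₗᵢ[ℂ] Completion P.Carrier).toLinearMap :
    P.Carrier →ₗ[ℂ] Completion P.Carrier)

theorem isDenseInducing_toCompl : IsDenseInducing (fun x : P.Carrier => P.toCompl x) :=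
  Completion.isDenseInducing_coe

theorem denseRange_toCompl : DenseRange P.toCompl := P.isDenseInducing_toCompl.dense

/-- The inner product of the completion: the extension by continuity. -/
def cinner : P.Compl → P.Compl → A :=
  Function.curry <| (P.isDenseInducing_toCompl.prodMap P.isDenseInducing_toCompl).extend
    (fun p : P.Carrier × P.Carrier => P.inner p.1 p.2)

theorem cinner_coe (x y : X) : P.cinner (P.toCompl x) (P.toCompl y) = P.inner x y :=
  (P.isDenseInducing_toCompl.prodMap P.isDenseInducing_toCompl).extend_eq P.continuous_inner (x, y)

theorem continuous_cinner : Continuous fun p : P.Compl × P.Compl => P.cinner p.1 p.2 := by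
  let inner' : P.Carrier →+ P.Carrier →+ A :=
    AddMonoidHom.mk' (fun x => AddMonoidHom.mk' (fun y => P.inner x y) (P.inner_add x))
      (fun x y => by ext z; exact P.add_inner x y z)
  exact IsDenseInducing.extend_Z_bilin
    (e := (Completion.toCompl : P.Carrier →+ Completion P.Carrier))
    (f := (Completion.toCompl : P.Carrier →+ Completion P.Carrier)) (φ := inner')
    Completion.isDenseInducing_coe Completion.isDenseInducing_coe P.continuous_inner

@[fun_prop]
theorem continuous_cinner' {Y : Type*} [TopologicalSpace Y] {f g : Y → P.Compl}
    (hf : Continuous f) (hg : Continuous g) : Continuous fun t => P.cinner (f t) (g t) :=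
  P.continuous_cinner.comp (hf.prodMk hg)

@[elab_as_elim]
theorem compl_induction {p : P.Compl → Prop} (x : P.Compl) (hc : IsClosed {x | p x})
    (h : ∀ x : X, p (P.toCompl x)) : p x :=
  Completion.induction_on (α := P.Carrier) x hc h

theorem cinner_add (x y z : P.Compl) : P.cinner x (y + z) = P.cinner x y + P.cinner x z := by
  refine P.compl_induction x (isClosed_eq (by fun_prop) (by fun_prop)) fun x => ?_
  refine P.compl_induction y (isClosed_eq (by fun_prop) (by fun_prop)) fun y => ?_
  refine P.compl_induction z (isClosed_eq (by fun_prop) (by fun_prop)) fun z => ?_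
  rw [← map_add, P.cinner_coe, P.cinner_coe, P.cinner_coe, P.inner_add]

theorem cinner_smul (c : ℂ) (x y : P.Compl) : P.cinner x (c • y) = c • P.cinner x y := by
  refine P.compl_induction x (isClosed_eq (P.continuous_cinner' continuous_id continuous_const)
    ((P.continuous_cinner' continuous_id continuous_const).const_smul c)) fun x => ?_
  refine P.compl_induction y (isClosed_eq
    (P.continuous_cinner' continuous_const (continuous_const_smul c))
    ((P.continuous_cinner' continuous_const continuous_id).const_smul c)) fun y => ?_
  rw [← map_smul, P.cinner_coe, P.cinner_coe, P.inner_smul]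

theorem star_cinner (x y : P.Compl) : star (P.cinner x y) = P.cinner y x := by
  refine P.compl_induction x (isClosed_eq (by fun_prop) (by fun_prop)) fun x => ?_
  refine P.compl_induction y (isClosed_eq (by fun_prop) (by fun_prop)) fun y => ?_
  rw [P.cinner_coe, P.cinner_coe, P.star_inner]

theorem cinner_self_pos (x : P.Compl) : IsPos (P.cinner x x) :=
  P.compl_induction x (isClosed_isPos.preimage (P.continuous_cinner' continuous_id continuous_id))
    fun x => by rw [P.cinner_coe]; exact P.inner_self_pos x

theorem norm_sq_cinner (x : P.Compl) : ‖x‖ ^ 2 = ‖P.cinner x x‖ := by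
  refine P.compl_induction x (isClosed_eq (by fun_prop) (by fun_prop)) fun x => ?_
  rw [P.cinner_coe]
  exact (congrArg (· ^ 2) (Completion.norm_coe (E := P.Carrier) x)).trans (P.norm_sq x)

theorem cinner_sub (x y z : P.Compl) : P.cinner x (y - z) = P.cinner x y - P.cinner x z := by
  rw [eq_sub_iff_add_eq, ← P.cinner_add, sub_add_cancel]

theorem ext_cinner {x y : P.Compl} (h : ∀ z, P.cinner z x = P.cinner z y) : x = y := by
  rw [← sub_eq_zero, ← norm_eq_zero, ← sq_eq_zero_iff, P.norm_sq_cinner, P.cinner_sub, h, sub_self,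
    norm_zero]

theorem norm_cinner_le (x y : P.Compl) : ‖P.cinner x y‖ ≤ ‖x‖ * ‖y‖ := by
  refine P.compl_induction x (isClosed_le (by fun_prop) (by fun_prop)) fun x => ?_
  refine P.compl_induction y (isClosed_le (by fun_prop) (by fun_prop)) fun y => ?_
  rw [P.cinner_coe]
  refine (P.norm_inner_le x y).trans_eq ?_
  exact congrArg₂ (· * ·) (Completion.norm_coe (E := P.Carrier) x).symm
    (Completion.norm_coe (E := P.Carrier) y).symm

theorem norm_le_of_cinner_le {x : P.Compl} {C : ℝ} (hC : 0 ≤ C)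
    (h : ∀ y, ‖P.cinner y x‖ ≤ ‖y‖ * C) : ‖x‖ ≤ C := by
  rcases (norm_nonneg x).eq_or_lt with h0 | h0
  · rwa [← h0]
  · have := h x
    rw [← P.norm_sq_cinner, sq] at this
    exact le_of_mul_le_mul_left this h0

theorem exists_act (x : P.Compl) (a : A) :
    ∃ z, ∀ y, P.cinner y z = P.cinner y x * a := by
  let S : Set (P.Compl × A) := {p | ∃ z, ∀ y, P.cinner y z = P.cinner y p.1 * p.2}
  have hdense : Dense S := by
    refine (P.denseRange_toCompl.prod P.dense_act : Dense
      (Set.range P.toCompl ×ˢ {a : A | ∀ x, ∃ z, ∀ y, P.inner y z = P.inner y x * a})).mono ?_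
    rintro ⟨_, a⟩ ⟨⟨x, rfl⟩, ha⟩
    obtain ⟨z, hz⟩ := ha x
    refine ⟨P.toCompl z, fun y => ?_⟩
    refine P.compl_induction y (isClosed_eq (by fun_prop) (by fun_prop)) fun y => ?_
    rw [P.cinner_coe, P.cinner_coe, hz]
  obtain ⟨u, huS, hu⟩ := mem_closure_iff_seq_limit.1 (hdense (x, a))
  choose z hz using huS
  have hux : Filter.Tendsto (fun n => (u n).1) Filter.atTop (𝓝 x) :=
    (continuous_fst.tendsto (x, a)).comp hu
  have hua : Filter.Tendsto (fun n => (u n).2) Filter.atTop (𝓝 a) :=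
    (continuous_snd.tendsto (x, a)).comp hu
  have hbound : ∀ n m, ‖z n - z m‖
      ≤ ‖(u n).1 - (u m).1‖ * ‖(u n).2‖ + ‖(u m).1‖ * ‖(u n).2 - (u m).2‖ := by
    intro n m
    refine P.norm_le_of_cinner_le (by positivity) fun y => ?_
    have e : P.cinner y (z n - z m) = P.cinner y ((u n).1 - (u m).1) * (u n).2
        + P.cinner y (u m).1 * ((u n).2 - (u m).2) := by
      rw [P.cinner_sub, P.cinner_sub, hz, hz, sub_mul, mul_sub]
      abel
    rw [e, mul_add, ← mul_assoc, ← mul_assoc]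
    refine (norm_add_le _ _).trans (add_le_add ?_ ?_) <;>
    · refine (norm_mul_le _ _).trans ?_
      gcongr
      exact P.norm_cinner_le _ _
  have hcauchy : CauchySeq z := by
    rw [cauchySeq_iff_tendsto_dist_atTop_0]
    have h1 : Filter.Tendsto (fun p : ℕ × ℕ => ‖(u p.1).1 - (u p.2).1‖ * ‖(u p.1).2‖
        + ‖(u p.2).1‖ * ‖(u p.1).2 - (u p.2).2‖) Filter.atTop (𝓝 0) := by
      rw [← Filter.prod_atTop_atTop_eq]
      have a1 := hux.comp (Filter.tendsto_fst (f := Filter.atTop) (g := (Filter.atTop : Filter ℕ)))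
      have a2 := hux.comp (Filter.tendsto_snd (f := (Filter.atTop : Filter ℕ)) (g := Filter.atTop))
      have b1 := hua.comp (Filter.tendsto_fst (f := Filter.atTop) (g := (Filter.atTop : Filter ℕ)))
      have b2 := hua.comp (Filter.tendsto_snd (f := (Filter.atTop : Filter ℕ)) (g := Filter.atTop))
      have := ((a1.sub a2).norm.mul b1.norm).add (a2.norm.mul (b1.sub b2).norm)
      simpa using this
    refine squeeze_zero (fun _ => dist_nonneg) (fun p => ?_) h1
    rw [dist_eq_norm]
    exact hbound p.1 p.2
  obtain ⟨w, hw⟩ := cauchySeq_tendsto_of_complete hcauchy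
  refine ⟨w, fun y => ?_⟩
  have l1 := ((P.continuous_cinner' (continuous_const (y := y)) continuous_id).tendsto w).comp hw
  have l2 := (((P.continuous_cinner' (continuous_const (y := y)) continuous_id).tendsto x).comp
    hux).mul hua
  exact tendsto_nhds_unique l1 (l2.congr fun n => (hz n y).symm)

/-- The right action on the completion. -/
def cact (x : P.Compl) (a : A) : P.Compl := (P.exists_act x a).choose

theorem cinner_cact (x y : P.Compl) (a : A) : P.cinner x (P.cact y a) = P.cinner x y * a :=
  (P.exists_act y a).choose_spec x

instance : HilbertModule A P.Compl where
  act := P.cact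
  inner := P.cinner
  add_act x y a := P.ext_cinner fun z => by simp only [P.cinner_add, P.cinner_cact, add_mul]
  act_add x a b := P.ext_cinner fun z => by simp only [P.cinner_add, P.cinner_cact, mul_add]
  act_mul x a b := P.ext_cinner fun z => by simp only [P.cinner_cact, mul_assoc]
  smul_act c x a := P.ext_cinner fun z => by
    simp only [P.cinner_cact, P.cinner_smul, smul_mul_assoc]
  act_smul c x a := P.ext_cinner fun z => by
    simp only [P.cinner_cact, P.cinner_smul, mul_smul_comm]
  inner_add := P.cinner_add
  inner_smul := P.cinner_smul
  inner_act := P.cinner_cact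
  star_inner := P.star_cinner
  inner_self_pos := P.cinner_self_pos
  norm_sq := P.norm_sq_cinner

end PreHilbert

section Gram

variable {A E : Type*} [NonUnitalCStarAlgebra A] [NormedAddCommGroup E] [NormedSpace ℂ E]
  [HilbertModule A E]

namespace HilbertModule

theorem add_inner (x y z : E) : inner (x + y) z = (inner x z + inner y z : A) := by
  rw [← star_inner, inner_add, star_add, star_inner, star_inner]

theorem smul_inner (c : ℂ) (x y : E) : inner (c • x) y = (star c • inner x y : A) := by
  rw [← star_inner, inner_smul, star_smul, star_inner]

theorem act_inner (x y : E) (a : A) : inner (act x a) y = star a * inner x y := by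
  rw [← star_inner, inner_act, star_mul, star_inner]

variable (A E) in
/-- The inner product as a sesquilinear map. -/
def innerₛₗ : E →ₗ⋆[ℂ] E →ₗ[ℂ] A :=
  LinearMap.mk₂'ₛₗ (starRingEnd ℂ) (RingHom.id ℂ) inner add_inner smul_inner inner_add inner_smul

/-- Right multiplication by `a` as a linear map. -/
def actₗ (a : A) : E →ₗ[ℂ] E where
  toFun x := act x a
  map_add' x y := add_act x y a
  map_smul' c x := smul_act c x a

theorem inner_sum {ι κ : Type*} [Fintype ι] [Fintype κ] (x : ι → E) (y : κ → E) :
    inner (∑ i, x i) (∑ j, y j) = (∑ i, ∑ j, inner (x i) (y j) : A) := by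
  change innerₛₗ A E (∑ i, x i) (∑ j, y j) = ∑ i, ∑ j, innerₛₗ A E (x i) (y j)
  rw [map_sum (innerₛₗ A E), LinearMap.sum_apply]
  exact Finset.sum_congr rfl fun i _ => map_sum _ _ _

theorem exists_negPart {R : Type*} [NonUnitalCStarAlgebra R] (m : R) (hm : IsSelfAdjoint m) :
    ∃ q s : R, star q = q ∧ q = star s * s ∧ m * q = -(q * q) ∧ (q = 0 → IsPos m) := by
  let _ := CStarAlgebra.spectralOrder R
  have := CStarAlgebra.spectralOrderedRing R
  have hq : 0 ≤ m⁻ := CFC.negPart_nonneg m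
  have h1 : m⁺ - m⁻ = m := CFC.posPart_sub_negPart m hm
  obtain ⟨s, hs⟩ := CStarAlgebra.nonneg_iff_eq_star_mul_self.1 hq
  refine ⟨m⁻, s, (IsSelfAdjoint.of_nonneg hq).star_eq, hs, ?_, fun h0 => ?_⟩
  · calc m * m⁻ = (m⁺ - m⁻) * m⁻ := by rw [h1]
      _ = -(m⁻ * m⁻) := by rw [sub_mul, CFC.posPart_mul_negPart, zero_sub]
  · rw [isPos_iff, ← h1, h0, sub_zero]
    exact CFC.posPart_nonneg m

/-- Gram matrices are positive. -/
theorem exists_gram {n : Type*} [Fintype n] (x : n → E) :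
    ∃ N : n → n → A, ∀ i j, inner (x i) (x j) = ∑ k, star (N k i) * N k j := by
  let _ := CStarAlgebra.spectralOrder A
  have := CStarAlgebra.spectralOrderedRing A
  let M : CStarMatrix n n A := CStarMatrix.ofMatrix fun i j => inner (x i) (x j)
  have hM : IsSelfAdjoint M := by
    ext i j
    exact star_inner (x j) (x i)
  obtain ⟨Q, S, hQs, hS, hMQ, hM0⟩ := exists_negPart M hM
  have hQe : ∀ i j, star (Q i j) = Q j i := fun i j =>
    congrFun (congrFun hQs j) i
  have hT : Q * (M * Q) = -(star (S * Q) * (S * Q)) := by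
    rw [hMQ, star_mul, hQs, mul_neg, mul_assoc, ← mul_assoc (star S), ← hS]
  have hSQ : S * Q = 0 := by
    ext l k
    have h1 : (0 : A) ≤ (Q * (M * Q)) k k := by
      have : (Q * (M * Q)) k k = inner (∑ i, act (x i) (Q i k)) (∑ i, act (x i) (Q i k)) := by
        rw [inner_sum]
        simp only [CStarMatrix.mul_apply, Finset.mul_sum, inner_act, act_inner, hQe, mul_assoc]
        rfl
      rw [this]
      exact isPos_iff.1 (inner_self_pos _)
    have h2 : (Q * (M * Q)) k k = -∑ l, star ((S * Q) l k) * (S * Q) l k := by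
      rw [hT]
      rfl
    rw [h2, neg_nonneg] at h1
    have h3 := (Finset.sum_eq_zero_iff_of_nonneg
      (fun l _ => star_mul_self_nonneg ((S * Q) l k))).1
      (le_antisymm h1 (Finset.sum_nonneg fun l _ => star_mul_self_nonneg ((S * Q) l k))) l
      (Finset.mem_univ l)
    exact (CStarRing.star_mul_self_eq_zero_iff _).1 h3
  have hQ0 : Q = 0 := by
    rw [← CStarRing.star_mul_self_eq_zero_iff, hQs]
    calc Q * Q = star S * (S * Q) := by rw [← mul_assoc, ← hS]
      _ = 0 := by rw [hSQ, mul_zero]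
  obtain ⟨N, hN⟩ := hM0 hQ0
  refine ⟨fun i j => N i j, fun i j => ?_⟩
  exact congrFun (congrFun hN i) j

end HilbertModule

end Gram

section ExteriorTensor

open HilbertModule

variable {A B D E F : Type*} [NonUnitalCStarAlgebra A] [NonUnitalCStarAlgebra B]
  [NonUnitalCStarAlgebra D] [NormedAddCommGroup E] [NormedSpace ℂ E] [NormedAddCommGroup F]
  [NormedSpace ℂ F] [HilbertModule A E] [HilbertModule B F]

/-- The `A ⊙ B`-valued inner product on `E ⊙ F` with
`⟨x ⊙ y, x' ⊙ y'⟩ = ⟨x, x'⟩ ⊙ ⟨y, y'⟩`. -/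
def tensorInner : E ⊗[ℂ] F →ₗ⋆[ℂ] E ⊗[ℂ] F →ₗ[ℂ] A ⊗[ℂ] B :=
  (TensorProduct.lift (TensorProduct.mapBilinear (.id ℂ) E F A B)) ∘ₛₗ
    TensorProduct.map (innerₛₗ A E) (innerₛₗ B F)

theorem tensorInner_tmul (x x' : E) (y y' : F) :
    tensorInner (x ⊗ₜ[ℂ] y) (x' ⊗ₜ[ℂ] y') = (inner x x' : A) ⊗ₜ[ℂ] (inner y y' : B) := rfl

theorem star_tensorInner (z w : E ⊗[ℂ] F) :
    star (tensorInner z w : A ⊗[ℂ] B) = tensorInner w z := by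
  induction z with
  | zero => simp
  | add z z' hz hz' => simp [hz, hz']
  | tmul x y =>
    induction w with
    | zero => simp
    | add w w' hw hw' => simp [hw, hw']
    | tmul x' y' => simp [tensorInner_tmul, star_inner]

theorem tensorInner_act (a : A) (b : B) (z w : E ⊗[ℂ] F) :
    tensorInner z (TensorProduct.map (actₗ a) (actₗ b) w) = tensorInner z w * (a ⊗ₜ[ℂ] b) := by
  induction z with
  | zero => simp
  | add z z' hz hz' => simp [hz, hz', add_mul]
  | tmul x y =>
    induction w with
    | zero => simp
    | add w w' hw hw' => simp [hw, hw', add_mul]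
    | tmul x' y' => simp [tensorInner_tmul, actₗ, inner_act]

theorem exists_tensorInner_mul (c : A ⊗[ℂ] B) (w : E ⊗[ℂ] F) :
    ∃ v : E ⊗[ℂ] F, ∀ z, tensorInner z v = tensorInner z w * c := by
  induction c with
  | zero => exact ⟨0, by simp⟩
  | tmul a b => exact ⟨_, fun z => tensorInner_act a b z w⟩
  | add c c' h h' =>
    obtain ⟨v, hv⟩ := h
    obtain ⟨v', hv'⟩ := h'
    exact ⟨v + v', fun z => by rw [map_add, hv, hv', mul_add]⟩

theorem tensorInner_self_pos (ι : A ⊗[ℂ] B →⋆ₙₐ[ℂ] D) (z : E ⊗[ℂ] F) :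
    IsPos (ι (tensorInner z z)) := by
  obtain ⟨n, _, x, y, rfl⟩ : ∃ (n : Type _) (_ : Fintype n) (x : n → E) (y : n → F),
      z = ∑ i, x i ⊗ₜ[ℂ] y i := by
    obtain ⟨S, hS⟩ := TensorProduct.exists_finset z
    exact ⟨S, inferInstance, fun i => i.1.1, fun i => i.1.2,
      hS.trans (Finset.sum_coe_sort S fun i => i.1 ⊗ₜ[ℂ] i.2).symm⟩
  obtain ⟨M, hM⟩ := exists_gram (A := A) x
  obtain ⟨N, hN⟩ := exists_gram (A := B) y
  have h : tensorInner (∑ i, x i ⊗ₜ[ℂ] y i) (∑ i, x i ⊗ₜ[ℂ] y i) =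
      ∑ k, ∑ l, star (∑ i, M k i ⊗ₜ[ℂ] N l i) * (∑ j, M k j ⊗ₜ[ℂ] N l j) := by
    have h1 : ∀ i j, tensorInner (x i ⊗ₜ[ℂ] y i) (x j ⊗ₜ[ℂ] y j) =
        ∑ k, ∑ l, star (M k i ⊗ₜ[ℂ] N l i) * (M k j ⊗ₜ[ℂ] N l j) := by
      intro i j
      rw [tensorInner_tmul, hM, hN, TensorProduct.sum_tmul]
      simp only [TensorProduct.tmul_sum, TensorProduct.star_tmul,
        Algebra.TensorProduct.tmul_mul_tmul]
    rw [map_sum tensorInner, LinearMap.sum_apply]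
    simp only [map_sum, h1, star_sum, Finset.sum_mul, Finset.mul_sum]
    rw [Finset.sum_comm_cycle]
    refine Finset.sum_congr rfl fun k _ => ?_
    rw [Finset.sum_comm_cycle]
    exact Finset.sum_congr rfl fun l _ => Finset.sum_comm
  rw [h, map_sum]
  refine IsPos.sum _ fun k _ => ?_
  rw [map_sum]
  refine IsPos.sum _ fun l _ => ?_
  rw [map_mul, map_star]
  exact ⟨_, rfl⟩

variable (E F) in
/-- The algebraic tensor product `E ⊙ F` with the inner product
`⟨x ⊙ y, x' ⊙ y'⟩ = ι(⟨x, x'⟩ ⊙ ⟨y, y'⟩)`, where `ι : A ⊙ B → D` is a `*`-homomorphism with dense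
range. -/
def preTensor (ι : A ⊗[ℂ] B →⋆ₙₐ[ℂ] D) (hι : DenseRange ι) : PreHilbert D (E ⊗[ℂ] F) where
  inner z w := ι (tensorInner z w)
  inner_add x y z := by rw [map_add, map_add]
  inner_smul c x y := by rw [map_smul, map_smul]
  star_inner x y := by rw [← map_star, star_tensorInner]
  inner_self_pos z := tensorInner_self_pos ι z
  dense_act := by
    refine hι.mono ?_
    rintro _ ⟨c, rfl⟩ z
    obtain ⟨v, hv⟩ := exists_tensorInner_mul c z
    exact ⟨v, fun y => by rw [hv, map_mul]⟩

end ExteriorTensor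

section Compact

namespace HilbertModule

variable {A : Type*} (E : Type*) [NonUnitalCStarAlgebra A] [NormedAddCommGroup E] [NormedSpace ℂ E]
  [HilbertModule A E]

variable {E} in
theorem norm_inner_le (x y : E) : ‖(inner x y : A)‖ ≤ ‖x‖ * ‖y‖ := by
  let P : PreHilbert A E :=
    { inner := inner
      inner_add := inner_add
      inner_smul := inner_smul
      star_inner := star_inner
      inner_self_pos := inner_self_pos
      dense_act := by
        convert dense_univ
        exact Set.eq_univ_of_forall fun a x => ⟨act x a, fun y => inner_act y x a⟩ }
  have h : ‖(inner x y : A)‖ ^ 2 ≤ ‖inner x x‖ * ‖inner y y‖ := P.norm_inner_sq_le x y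
  rw [← norm_sq, ← norm_sq, ← mul_pow] at h
  exact (abs_le_of_sq_le_sq' h (by positivity)).2

variable {E} in
theorem norm_act_le (x : E) (a : A) : ‖act x a‖ ≤ ‖x‖ * ‖a‖ := by
  refine (abs_le_of_sq_le_sq' ?_ (by positivity)).2
  rw [norm_sq, inner_act, act_inner, mul_pow, norm_sq]
  calc _ ≤ ‖star a‖ * ‖inner x x‖ * ‖a‖ :=
        (norm_mul_le _ _).trans (by gcongr; exact norm_mul_le _ _)
    _ = _ := by rw [norm_star]; ring

variable {E} in
theorem ext_inner {x y : E} (h : ∀ z, inner z x = (inner z y : A)) : x = y := by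
  rw [← sub_eq_zero, ← norm_eq_zero, ← sq_eq_zero_iff, norm_sq, sub_eq_add_neg,
    ← neg_one_smul ℂ y, inner_add, inner_smul, h]
  simp

/-- `S` is an adjoint of `T`. -/
def IsAdjoint (T S : E →L[ℂ] E) : Prop := ∀ x y, inner (T x) y = (inner x (S y) : A)

variable {E} in
theorem IsAdjoint.symm {T S : E →L[ℂ] E} (h : IsAdjoint E T S) : IsAdjoint E S T := fun x y => by
  rw [← star_inner, ← h, star_inner]

variable {E} in
theorem IsAdjoint.unique {T S S' : E →L[ℂ] E} (h : IsAdjoint E T S) (h' : IsAdjoint E T S') :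
    S = S' := by
  ext y
  exact ext_inner fun x => by rw [← h, ← h']

variable {E} in
theorem IsAdjoint.norm_le {T S : E →L[ℂ] E} (h : IsAdjoint E T S) : ‖S‖ ≤ ‖T‖ := by
  refine ContinuousLinearMap.opNorm_le_bound _ (norm_nonneg _) fun y => ?_
  rcases (norm_nonneg (S y)).eq_or_lt with h0 | h0
  · rw [← h0]; positivity
  · refine le_of_mul_le_mul_left ?_ h0
    calc ‖S y‖ * ‖S y‖ = ‖inner (T (S y)) y‖ := by rw [h, ← norm_sq, sq]
      _ ≤ ‖T (S y)‖ * ‖y‖ := norm_inner_le _ _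
      _ ≤ ‖T‖ * ‖S y‖ * ‖y‖ := by gcongr; exact T.le_opNorm _
      _ = ‖S y‖ * (‖T‖ * ‖y‖) := by ring

/-- The adjointable operators on a Hilbert module. -/
def adjointable : Subalgebra ℂ (E →L[ℂ] E) where
  carrier := {T | ∃ S, IsAdjoint E T S}
  mul_mem' := by
    rintro T T' ⟨S, h⟩ ⟨S', h'⟩
    exact ⟨S' * S, fun x y => by
      rw [mul_apply_eq_comp, h, h', mul_apply_eq_comp]⟩
  add_mem' := by
    rintro T T' ⟨S, h⟩ ⟨S', h'⟩
    exact ⟨S + S', fun x y => by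
      simp only [add_apply, add_inner, inner_add, h x y, h' x y]⟩
  algebraMap_mem' c := ⟨algebraMap ℂ _ (star c), fun x y => by
    simp only [Algebra.algebraMap_eq_smul_one, smul_apply,
      one_apply_eq_self, smul_inner, inner_smul]⟩

instance : Star (adjointable E) := ⟨fun T => ⟨T.2.choose, T.1, T.2.choose_spec.symm⟩⟩

variable {E}

theorem isAdjoint_star (T : adjointable E) :
    IsAdjoint E (T : E →L[ℂ] E) ((star T : adjointable E) : E →L[ℂ] E) := T.2.choose_spec

theorem star_eq_of_isAdjoint {T S : adjointable E} (h : IsAdjoint E T.1 S.1) : star T = S :=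
  Subtype.ext ((isAdjoint_star T).unique h)

instance : StarRing (adjointable E) where
  star_involutive T := star_eq_of_isAdjoint (isAdjoint_star T).symm
  star_mul T T' := star_eq_of_isAdjoint fun x y => by
    change inner (T.1 (T'.1 x)) y = inner x ((star T').1 ((star T).1 y))
    rw [isAdjoint_star T, isAdjoint_star T']
  star_add T T' := star_eq_of_isAdjoint fun x y => by
    change inner (T.1 x + T'.1 x) y = inner x ((star T).1 y + (star T').1 y)
    rw [add_inner, inner_add, isAdjoint_star T, isAdjoint_star T']

instance : StarModule ℂ (adjointable E) where
  star_smul c T := star_eq_of_isAdjoint fun x y => by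
    change inner (c • T.1 x) y = inner x (star c • (star T).1 y)
    rw [smul_inner, inner_smul, isAdjoint_star T]

instance : CStarRing (adjointable E) where
  norm_mul_self_le T := by
    change ‖T.1‖ * ‖T.1‖ ≤ ‖(star T * T).1‖
    have h : ‖T.1‖ ≤ √‖(star T * T).1‖ := by
      refine ContinuousLinearMap.opNorm_le_bound _ (Real.sqrt_nonneg _) fun x => ?_
      refine (abs_le_of_sq_le_sq' ?_ (by positivity)).2
      rw [norm_sq, isAdjoint_star T, mul_pow, Real.sq_sqrt (norm_nonneg _)]
      calc _ ≤ ‖x‖ * ‖(star T * T).1 x‖ := norm_inner_le _ _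
        _ ≤ ‖x‖ * (‖(star T * T).1‖ * ‖x‖) := by gcongr; exact (star T * T).1.le_opNorm x
        _ = _ := by ring
    calc _ ≤ √‖(star T * T).1‖ * √‖(star T * T).1‖ := by gcongr
      _ = _ := Real.mul_self_sqrt (norm_nonneg _)

variable (E) in
theorem isClosed_adjointable [CompleteSpace E] : IsClosed (adjointable E : Set (E →L[ℂ] E)) := by
  refine isClosed_of_closure_subset fun T hT => ?_
  obtain ⟨u, hu, hlim⟩ := mem_closure_iff_seq_limit.1 hT
  choose S hS using hu
  have hbound : ∀ n m, dist (S n) (S m) ≤ dist (u n) (u m) := fun n m => by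
    rw [dist_eq_norm, dist_eq_norm]
    refine IsAdjoint.norm_le fun x y => ?_
    change innerₛₗ A E (u n x - u m x) y = innerₛₗ A E x (S n y - S m y)
    rw [map_sub, map_sub, LinearMap.sub_apply]
    exact congrArg₂ (· - ·) (hS n x y) (hS m x y)
  have hc : CauchySeq S := by
    rw [cauchySeq_iff_tendsto_dist_atTop_0]
    exact squeeze_zero (fun _ => dist_nonneg) (fun p => hbound p.1 p.2)
      (cauchySeq_iff_tendsto_dist_atTop_0.1 hlim.cauchySeq)
  obtain ⟨R, hR⟩ := cauchySeq_tendsto_of_complete hc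
  refine ⟨R, fun x y => ?_⟩
  have c1 : Continuous fun z : E => (inner z y : A) := by
    refine ((LinearMap.flip (innerₛₗ A E)) y).mkContinuous ‖y‖ ?_ |>.continuous
    intro z
    rw [mul_comm]
    exact norm_inner_le z y
  have c2 : Continuous fun z : E => (inner x z : A) :=
    ((innerₛₗ A E x).mkContinuous ‖x‖ fun z => norm_inner_le x z).continuous
  have l1 := (c1.tendsto _).comp (((ContinuousLinearMap.apply ℂ E x).continuous.tendsto _).comp hlim)
  have l2 := (c2.tendsto _).comp (((ContinuousLinearMap.apply ℂ E y).continuous.tendsto _).comp hR)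
  exact tendsto_nhds_unique l1 (l2.congr fun n => (hS n x y).symm)

instance [CompleteSpace E] : CStarAlgebra (adjointable E) where
  toCompleteSpace := (isClosed_adjointable E).completeSpace_coe

/-- The rank one operator `θ_{x,y}(z) = x ⟨y, z⟩`. -/
def theta (x y : E) : adjointable E :=
  have h : ∀ x y z : E, ‖act x (inner y z)‖ ≤ ‖x‖ * ‖y‖ * ‖z‖ := fun x y z =>
    (norm_act_le _ _).trans (by rw [mul_assoc]; gcongr; exact norm_inner_le y z)
  let T (x y : E) : E →L[ℂ] E := LinearMap.mkContinuous
    { toFun := fun z => act x (inner y z)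
      map_add' := fun z w => by rw [inner_add, act_add]
      map_smul' := fun c z => by rw [inner_smul, act_smul, RingHom.id_apply] } (‖x‖ * ‖y‖) (h x y)
  ⟨T x y, T y x, fun z w => by
    change inner (act x (inner y z)) w = inner z (act y (inner x w))
    rw [act_inner, inner_act, star_inner]⟩

theorem theta_apply (x y z : E) : (theta x y : E →L[ℂ] E) z = act x (inner y z) := rfl

variable (E) in
/-- The closed linear span of the operators `θ_{x,y}` (their span is a `*`-subalgebra, so this is the
same as the closed `*`-subalgebra that they generate). -/
def compactSubalgebra [CompleteSpace E] : NonUnitalStarSubalgebra ℂ (adjointable E) :=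
  (NonUnitalStarAlgebra.adjoin ℂ {T : adjointable E | ∃ x y, T = theta x y}).topologicalClosure

variable (E) in
/-- The C⋆-algebra `𝒦(E)` of compact operators on `E`. -/
def Compacts [CompleteSpace E] : Type _ := ↥(compactSubalgebra E)

instance [CompleteSpace E] : NonUnitalCStarAlgebra (Compacts E) :=
  NonUnitalStarSubalgebra.nonUnitalCStarAlgebra (compactSubalgebra E)
    (h_closed := NonUnitalStarSubalgebra.isClosed_topologicalClosure _)

/-- `θ_{x,y}` as an element of `𝒦(E)`. -/
def thetaK [CompleteSpace E] (x y : E) : Compacts E :=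
  ⟨theta x y, NonUnitalStarSubalgebra.le_topologicalClosure _
    (NonUnitalStarAlgebra.subset_adjoin ℂ _ ⟨x, y, rfl⟩)⟩

/-- The value of a compact operator at a vector. -/
def Compacts.app [CompleteSpace E] (k : Compacts E) (x : E) : E := k.1.1 x

end HilbertModule

end Compact

section CStarNorms

/-- A C⋆-norm on the algebraic tensor product `A ⊙ B` of two C⋆-algebras. -/
structure IsCStarNorm {A B : Type*} [NonUnitalCStarAlgebra A] [NonUnitalCStarAlgebra B]
    (p : A ⊗[ℂ] B → ℝ) : Prop where
  add_le : ∀ x y, p (x + y) ≤ p x + p y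
  smul : ∀ (c : ℂ) x, p (c • x) = ‖c‖ * p x
  eq_zero : ∀ x, p x = 0 → x = 0
  mul_le : ∀ x y, p (x * y) ≤ p x * p y
  star_mul_self : ∀ x, p (star x * x) = p x ^ 2

/-- The two C⋆-norms under consideration. -/
inductive TensorKind
  | min
  | max

/-- `p` is the minimal, respectively the maximal, C⋆-norm on `A ⊙ B`. -/
def TensorKind.IsNorm {A B : Type*} [NonUnitalCStarAlgebra A] [NonUnitalCStarAlgebra B] :
    TensorKind → (A ⊗[ℂ] B → ℝ) → Prop
  | .min, p => IsLeast {q : A ⊗[ℂ] B → ℝ | IsCStarNorm q} p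
  | .max, p => IsGreatest {q : A ⊗[ℂ] B → ℝ | IsCStarNorm q} p

theorem TensorKind.IsNorm.isCStarNorm {A B : Type*} [NonUnitalCStarAlgebra A]
    [NonUnitalCStarAlgebra B] {α : TensorKind} {p : A ⊗[ℂ] B → ℝ} (h : α.IsNorm p) :
    IsCStarNorm p := by
  cases α <;> exact h.1

namespace IsCStarNorm

variable {A B : Type*} [NonUnitalCStarAlgebra A] [NonUnitalCStarAlgebra B] {p : A ⊗[ℂ] B → ℝ}

theorem nonneg (hp : IsCStarNorm p) (x : A ⊗[ℂ] B) : 0 ≤ p x := by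
  have h0 : p 0 = 0 := by simpa using hp.smul 0 0
  have h1 : p (-x) = p x := by simpa using hp.smul (-1) x
  have h2 := hp.add_le x (-x)
  rw [add_neg_cancel, h0, h1] at h2
  linarith

theorem le_star (hp : IsCStarNorm p) (x : A ⊗[ℂ] B) : p x ≤ p (star x) := by
  rcases (hp.nonneg x).eq_or_lt with h | h
  · rw [← h]; exact hp.nonneg _
  · have := hp.mul_le (star x) x
    rw [hp.star_mul_self, sq] at this
    exact le_of_mul_le_mul_right this h

theorem map_star (hp : IsCStarNorm p) (x : A ⊗[ℂ] B) : p (star x) = p x :=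
  le_antisymm (by simpa using hp.le_star (star x)) (hp.le_star x)

/-- `A ⊙ B` equipped with the C⋆-norm `p`. -/
@[nolint unusedArguments]
def Carrier (_ : IsCStarNorm p) : Type _ := A ⊗[ℂ] B

variable (hp : IsCStarNorm p)

instance : NonUnitalRing hp.Carrier := inferInstanceAs (NonUnitalRing (A ⊗[ℂ] B))

instance : Module ℂ hp.Carrier := inferInstanceAs (Module ℂ (A ⊗[ℂ] B))

instance : IsScalarTower ℂ hp.Carrier hp.Carrier :=
  inferInstanceAs (IsScalarTower ℂ (A ⊗[ℂ] B) (A ⊗[ℂ] B))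

instance : SMulCommClass ℂ hp.Carrier hp.Carrier :=
  inferInstanceAs (SMulCommClass ℂ (A ⊗[ℂ] B) (A ⊗[ℂ] B))

instance : StarRing hp.Carrier := inferInstanceAs (StarRing (A ⊗[ℂ] B))

instance : StarModule ℂ hp.Carrier := inferInstanceAs (StarModule ℂ (A ⊗[ℂ] B))

instance : Norm hp.Carrier := ⟨p⟩

theorem normCore : NormedSpace.Core ℂ hp.Carrier where
  norm_nonneg := hp.nonneg
  norm_smul := hp.smul
  norm_triangle := hp.add_le
  norm_eq_zero_iff x := ⟨hp.eq_zero x, fun h => by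
    subst h
    exact (by simpa using hp.smul 0 0 : p 0 = 0)⟩

instance : NormedAddCommGroup hp.Carrier := NormedAddCommGroup.ofCore hp.normCore

instance : NormedSpace ℂ hp.Carrier where
  norm_smul_le c x := (hp.smul c x).le

instance : NonUnitalNormedRing hp.Carrier where
  __ := (inferInstance : NormedAddCommGroup hp.Carrier)
  __ := (inferInstance : NonUnitalRing hp.Carrier)
  norm_mul_le := hp.mul_le

instance : CStarRing hp.Carrier where
  norm_mul_self_le x := by
    rw [← sq]
    exact (hp.star_mul_self x).ge

end IsCStarNorm

/-! The completion of a normed `*`-algebra satisfying the C⋆-identity is a C⋆-algebra. -/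

section Completion

variable {R : Type*} [NonUnitalNormedRing R]

variable (R) in
/-- The multiplication of the completion. -/
def complMul : Completion R → Completion R → Completion R :=
  Function.curry <|
    ((Completion.isDenseInducing_coe (α := R)).prodMap Completion.isDenseInducing_coe).extend
      (fun p : R × R => ((p.1 * p.2 : R) : Completion R))

theorem complMul_coe (a b : R) : complMul R a b = ((a * b : R) : Completion R) :=
  ((Completion.isDenseInducing_coe (α := R)).prodMap Completion.isDenseInducing_coe).extend_eq
    (f := fun p : R × R => ((p.1 * p.2 : R) : Completion R))
    ((Completion.continuous_coe R).comp continuous_mul) (a, b)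

theorem continuous_complMul :
    Continuous fun p : Completion R × Completion R => complMul R p.1 p.2 := by
  let m := (AddMonoidHom.mul : R →+ R →+ R).compr₂ Completion.toCompl
  have : Continuous fun p : R × R => m p.1 p.2 := (Completion.continuous_coe R).comp continuous_mul
  have di : IsDenseInducing (Completion.toCompl : R → Completion R) :=
    Completion.isDenseInducing_coe
  exact di.extend_Z_bilin di this

@[fun_prop]
theorem continuous_complMul' {Y : Type*} [TopologicalSpace Y] {f g : Y → Completion R}
    (hf : Continuous f) (hg : Continuous g) : Continuous fun t => complMul R (f t) (g t) :=
  continuous_complMul.comp (hf.prodMk hg)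

variable [StarRing R]

variable (R) in
/-- The involution of the completion. -/
def complStar : Completion R → Completion R := Completion.map star

@[fun_prop]
theorem continuous_complStar : Continuous (complStar R) := Completion.continuous_map

variable [CStarRing R]

theorem uniformContinuous_star : UniformContinuous (star : R → R) :=
  (starNormedAddGroupHom : NormedAddGroupHom R R).uniformContinuous

theorem complStar_coe (a : R) : complStar R a = ((star a : R) : Completion R) :=
  Completion.map_coe uniformContinuous_star a

variable [NormedSpace ℂ R] [IsScalarTower ℂ R R] [SMulCommClass ℂ R R] [StarModule ℂ R]

variable (R) in
/-- The C⋆-algebra structure of the completion. -/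
@[reducible]
def complCStarAlgebra : NonUnitalCStarAlgebra (Completion R) where
  __ := (inferInstance : NormedAddCommGroup (Completion R))
  __ := (inferInstance : NormedSpace ℂ (Completion R))
  __ := (inferInstance : CompleteSpace (Completion R))
  mul := complMul R
  star := complStar R
  left_distrib a b c := by
    change complMul R a (b + c) = complMul R a b + complMul R a c
    refine Completion.induction_on₃ a b c (isClosed_eq (by fun_prop) (by fun_prop)) fun a b c => ?_
    rw [← Completion.coe_add]
    simp only [complMul_coe]
    rw [← Completion.coe_add, mul_add]
  right_distrib a b c := by
    change complMul R (a + b) c = complMul R a c + complMul R b c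
    refine Completion.induction_on₃ a b c (isClosed_eq (by fun_prop) (by fun_prop)) fun a b c => ?_
    rw [← Completion.coe_add]
    simp only [complMul_coe]
    rw [← Completion.coe_add, add_mul]
  zero_mul a := by
    change complMul R 0 a = 0
    refine Completion.induction_on a (isClosed_eq (by fun_prop) (by fun_prop)) fun a => ?_
    rw [← Completion.coe_zero, complMul_coe, zero_mul]
  mul_zero a := by
    change complMul R a 0 = 0
    refine Completion.induction_on a (isClosed_eq (by fun_prop) (by fun_prop)) fun a => ?_
    rw [← Completion.coe_zero, complMul_coe, mul_zero]
  mul_assoc a b c := by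
    change complMul R (complMul R a b) c = complMul R a (complMul R b c)
    refine Completion.induction_on₃ a b c (isClosed_eq (by fun_prop) (by fun_prop)) fun a b c => ?_
    simp only [complMul_coe, mul_assoc]
  norm_mul_le a b := by
    change ‖complMul R a b‖ ≤ ‖a‖ * ‖b‖
    refine Completion.induction_on₂ a b (isClosed_le (by fun_prop) (by fun_prop)) fun a b => ?_
    simp only [complMul_coe, Completion.norm_coe]
    exact norm_mul_le a b
  star_involutive a := by
    refine Completion.induction_on a (isClosed_eq (by fun_prop) (by fun_prop)) fun a => ?_
    simp only [complStar_coe, star_star]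
  star_mul a b := by
    change complStar R (complMul R a b) = complMul R (complStar R b) (complStar R a)
    refine Completion.induction_on₂ a b (isClosed_eq (by fun_prop) (by fun_prop)) fun a b => ?_
    simp only [complStar_coe, complMul_coe, star_mul]
  star_add a b := by
    change complStar R (a + b) = complStar R a + complStar R b
    refine Completion.induction_on₂ a b (isClosed_eq (by fun_prop) (by fun_prop)) fun a b => ?_
    rw [← Completion.coe_add, complStar_coe, complStar_coe, complStar_coe, star_add,
      Completion.coe_add]
  norm_mul_self_le a := by
    change ‖a‖ * ‖a‖ ≤ ‖complMul R (complStar R a) a‖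
    refine Completion.induction_on a (isClosed_le (by fun_prop) (by fun_prop)) fun a => ?_
    simp only [complStar_coe, complMul_coe, Completion.norm_coe]
    exact CStarRing.norm_mul_self_le a
  smul_assoc c a b := by
    change complMul R (c • a) b = c • complMul R a b
    refine Completion.induction_on₂ a b (isClosed_eq
      (continuous_complMul' (continuous_fst.const_smul c) continuous_snd)
      (continuous_complMul.const_smul c)) fun a b => ?_
    rw [← Completion.coe_smul, complMul_coe, complMul_coe, smul_mul_assoc, Completion.coe_smul]
  smul_comm c a b := by
    change c • complMul R a b = complMul R a (c • b)
    refine Completion.induction_on₂ a b (isClosed_eq (continuous_complMul.const_smul c)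
      (continuous_complMul' continuous_fst (continuous_snd.const_smul c))) fun a b => ?_
    rw [← Completion.coe_smul c b, complMul_coe, complMul_coe, mul_smul_comm, Completion.coe_smul]
  star_smul c a := by
    change complStar R (c • a) = star c • complStar R a
    refine Completion.induction_on a (isClosed_eq
      (continuous_complStar.comp (continuous_const_smul c))
      (continuous_complStar.const_smul (star c))) fun a => ?_
    rw [← Completion.coe_smul, complStar_coe, complStar_coe, star_smul, Completion.coe_smul]

end Completion

namespace IsCStarNorm

variable {A B : Type*} [NonUnitalCStarAlgebra A] [NonUnitalCStarAlgebra B] {p : A ⊗[ℂ] B → ℝ}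
  (hp : IsCStarNorm p)

/-- The C⋆-tensor product `A ⊗_p B`: the completion of `A ⊙ B` for the C⋆-norm `p`. -/
def Compl : Type _ := Completion hp.Carrier

instance : NonUnitalCStarAlgebra hp.Compl := complCStarAlgebra hp.Carrier

/-- The canonical map `A ⊙ B → A ⊗_p B`. -/
def toCompl (x : A ⊗[ℂ] B) : hp.Compl :=
  Completion.coe' (α := hp.Carrier) x

end IsCStarNorm

end CStarNorms

section FellBundles

/-- The total space of a family of sets. -/
structure BundlePoint {G : Type*} (F : G → Type*) where
  base : G
  val : F base

/-- Transport between fibres over equal base points. -/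
def castFiber {G : Type*} {F : G → Type*} {s t : G} (h : s = t) (a : F s) : F t := h ▸ a

theorem castFiber_mk {G : Type*} {F : G → Type*} {s t : G} (h : s = t) (a : F s) :
    (⟨t, castFiber h a⟩ : BundlePoint F) = ⟨s, a⟩ := by subst h; rfl

/-- Fell bundles (C⋆-algebraic bundles) over a topological group `G`: a Banach bundle over `G` with
a continuous multiplication and involution satisfying the C⋆-axioms.

The product of `a ∈ A_r` and `b ∈ A_s` is an element of `A_{rs}`; it is written `mul h a b ∈ A_t`
for a proof `h : r * s = t`, and likewise for the involution, so that no transport between fibres is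
needed. -/
structure FellBundle (G : Type*) [Group G] [TopologicalSpace G] where
  Fiber : G → Type*
  [normedAddCommGroup : ∀ t, NormedAddCommGroup (Fiber t)]
  [normedSpace : ∀ t, NormedSpace ℂ (Fiber t)]
  [completeSpace : ∀ t, CompleteSpace (Fiber t)]
  -- the Banach bundle
  [topologicalSpace : TopologicalSpace (BundlePoint Fiber)]
  t2Space : T2Space (BundlePoint Fiber)
  continuous_base : Continuous (BundlePoint.base : BundlePoint Fiber → G)
  isOpenMap_base : IsOpenMap (BundlePoint.base : BundlePoint Fiber → G)
  continuous_norm : Continuous fun x : BundlePoint Fiber => ‖x.val‖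
  continuous_add : Continuous
    fun p : {p : BundlePoint Fiber × BundlePoint Fiber // p.1.base = p.2.base} =>
      (⟨p.1.2.base, castFiber p.2 p.1.1.val + p.1.2.val⟩ : BundlePoint Fiber)
  continuous_smul : ∀ c : ℂ, Continuous
    fun x : BundlePoint Fiber => (⟨x.base, c • x.val⟩ : BundlePoint Fiber)
  -- if `‖b_i‖ → 0` and `b_i` lies over a point that tends to `t`, then `b_i → 0 ∈ A_t`
  tendsto_zero : ∀ t : G, (𝓝 t).comap BundlePoint.base ⊓
    (𝓝 (0 : ℝ)).comap (fun x : BundlePoint Fiber => ‖x.val‖) ≤ 𝓝 ⟨t, 0⟩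
  -- the multiplication
  mul : ∀ {r s t : G}, r * s = t → Fiber r → Fiber s → Fiber t
  add_mul : ∀ {r s t : G} (h : r * s = t) (a a' : Fiber r) (b : Fiber s),
    mul h (a + a') b = mul h a b + mul h a' b
  mul_add : ∀ {r s t : G} (h : r * s = t) (a : Fiber r) (b b' : Fiber s),
    mul h a (b + b') = mul h a b + mul h a b'
  smul_mul : ∀ {r s t : G} (h : r * s = t) (c : ℂ) (a : Fiber r) (b : Fiber s),
    mul h (c • a) b = c • mul h a b
  mul_smul : ∀ {r s t : G} (h : r * s = t) (c : ℂ) (a : Fiber r) (b : Fiber s),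
    mul h a (c • b) = c • mul h a b
  mul_assoc : ∀ {r s t u v w : G} (h₁ : r * s = u) (h₂ : u * t = w) (h₃ : s * t = v)
    (h₄ : r * v = w) (a : Fiber r) (b : Fiber s) (c : Fiber t),
    mul h₂ (mul h₁ a b) c = mul h₄ a (mul h₃ b c)
  norm_mul_le : ∀ {r s t : G} (h : r * s = t) (a : Fiber r) (b : Fiber s),
    ‖mul h a b‖ ≤ ‖a‖ * ‖b‖
  continuous_mul : Continuous fun p : BundlePoint Fiber × BundlePoint Fiber =>
    (⟨p.1.base * p.2.base, mul rfl p.1.val p.2.val⟩ : BundlePoint Fiber)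
  -- the involution
  star : ∀ {s t : G}, s⁻¹ = t → Fiber s → Fiber t
  star_add : ∀ {s t : G} (h : s⁻¹ = t) (a b : Fiber s), star h (a + b) = star h a + star h b
  star_smul : ∀ {s t : G} (h : s⁻¹ = t) (c : ℂ) (a : Fiber s),
    star h (c • a) = (starRingEnd ℂ c) • star h a
  star_star : ∀ {s t : G} (h : s⁻¹ = t) (h' : t⁻¹ = s) (a : Fiber s), star h' (star h a) = a
  star_mul : ∀ {r s t r' s' t' : G} (h : r * s = t) (hr : r⁻¹ = r') (hs : s⁻¹ = s') (ht : t⁻¹ = t')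
    (h' : s' * r' = t') (a : Fiber r) (b : Fiber s),
    star ht (mul h a b) = mul h' (star hs b) (star hr a)
  norm_star : ∀ {s t : G} (h : s⁻¹ = t) (a : Fiber s), ‖star h a‖ = ‖a‖
  continuous_star : Continuous
    fun x : BundlePoint Fiber => (⟨x.base⁻¹, star rfl x.val⟩ : BundlePoint Fiber)
  -- `‖a* a‖ = ‖a‖²`, and `a* a` is a positive element of the C⋆-algebra `A_e`
  norm_star_mul_self : ∀ {s t : G} (h : s⁻¹ = t) (h' : t * s = 1) (a : Fiber s),
    ‖mul h' (star h a) a‖ = ‖a‖ ^ 2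
  star_mul_self_pos : ∀ {s t : G} (h : s⁻¹ = t) (h' : t * s = 1) (a : Fiber s),
    ∃ b : Fiber 1, mul h' (star h a) a = mul (one_mul 1) (star inv_one b) b

attribute [instance] FellBundle.normedAddCommGroup FellBundle.normedSpace FellBundle.completeSpace
  FellBundle.topologicalSpace

namespace FellBundle

variable {G : Type*} [Group G] [TopologicalSpace G] (A : FellBundle G)

/-- The total space of a Fell bundle. -/
abbrev Total : Type _ := BundlePoint A.Fiber

/-- The unit fibre `A_e` is a C⋆-algebra. -/
instance : NonUnitalCStarAlgebra (A.Fiber 1) where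
  __ := A.normedAddCommGroup 1
  __ := A.normedSpace 1
  __ := A.completeSpace 1
  mul := A.mul (_root_.one_mul 1)
  star := A.star inv_one
  left_distrib a b c := A.mul_add _ a b c
  right_distrib a b c := A.add_mul _ a b c
  zero_mul a := by
    have h := A.smul_mul (_root_.one_mul 1) 0 0 a
    rwa [zero_smul, zero_smul] at h
  mul_zero a := by
    have h := A.mul_smul (_root_.one_mul 1) 0 a 0
    rwa [zero_smul, zero_smul] at h
  mul_assoc a b c := A.mul_assoc _ _ _ _ a b c
  norm_mul_le a b := A.norm_mul_le _ a b
  star_involutive a := A.star_star _ _ a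
  star_mul a b := A.star_mul _ _ _ _ _ a b
  star_add a b := A.star_add _ a b
  norm_mul_self_le a := ((A.norm_star_mul_self inv_one (_root_.one_mul 1) a).trans (sq _)).ge
  smul_assoc c a b := A.smul_mul _ c a b
  smul_comm c a b := (A.mul_smul _ c a b).symm
  star_smul c a := A.star_smul _ c a

theorem mk_mul {r s t : G} (h : r * s = t) (a : A.Fiber r) (b : A.Fiber s) :
    (⟨t, A.mul h a b⟩ : A.Total) = ⟨r * s, A.mul rfl a b⟩ := by subst h; rfl

/-- The topology of a fibre is its norm topology. -/
theorem continuous_of_mk {X : Type*} [TopologicalSpace X] {t : G} {f : X → A.Fiber t}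
    (hf : Continuous fun x => (⟨t, f x⟩ : A.Total)) : Continuous f := by
  rw [continuous_iff_continuousAt]
  intro x₀
  have h1 : Continuous fun x => (⟨t, f x + (-1 : ℂ) • f x₀⟩ : A.Total) :=
    A.continuous_add.comp (f := fun x => (⟨(⟨t, f x⟩, ⟨t, (-1 : ℂ) • f x₀⟩), rfl⟩ :
      {p : A.Total × A.Total // p.1.base = p.2.base}))
      ((hf.prodMk continuous_const).subtype_mk _)
  have h2 := (A.continuous_norm.comp h1).tendsto x₀
  rw [ContinuousAt, tendsto_iff_norm_sub_tendsto_zero]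
  simpa [Function.comp_def, sub_eq_add_neg] using h2

theorem continuous_zero : Continuous fun t : G => (⟨t, 0⟩ : A.Total) := by
  rw [continuous_iff_continuousAt]
  intro t
  refine Filter.Tendsto.mono_right ?_ (A.tendsto_zero t)
  rw [Filter.tendsto_inf]
  refine ⟨Filter.tendsto_comap_iff.2 Filter.tendsto_id, Filter.tendsto_comap_iff.2 ?_⟩
  simp only [Function.comp_def, norm_zero]
  exact tendsto_const_nhds

variable [IsTopologicalGroup G]

/-- `C_c^t(𝒜)`: the continuous sections `ξ : G → 𝒜` of compact support with `ξ(r) ∈ A_{rt}`. -/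
def Cc (t : G) : Submodule ℂ (∀ r : G, A.Fiber (r * t)) where
  carrier := {ξ | Continuous (fun r => (⟨r * t, ξ r⟩ : A.Total)) ∧
    ∃ K : Set G, IsCompact K ∧ ∀ r ∉ K, ξ r = 0}
  add_mem' := by
    rintro ξ η ⟨hξ, K, hK, hK'⟩ ⟨hη, L, hL, hL'⟩
    refine ⟨?_, K ∪ L, hK.union hL, fun r hr => ?_⟩
    · exact A.continuous_add.comp (f := fun r => (⟨(⟨r * t, ξ r⟩, ⟨r * t, η r⟩), rfl⟩ :
        {p : A.Total × A.Total // p.1.base = p.2.base})) ((hξ.prodMk hη).subtype_mk _)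
    · rw [Set.mem_union, not_or] at hr
      simp [hK' r hr.1, hL' r hr.2]
  zero_mem' := ⟨A.continuous_zero.comp (continuous_mul_const t), ∅, isCompact_empty,
    fun _ _ => rfl⟩
  smul_mem' := by
    rintro c ξ ⟨hξ, K, hK, hK'⟩
    exact ⟨(A.continuous_smul c).comp hξ, K, hK, fun r hr => by simp [hK' r hr]⟩

/-- The function `r ↦ ξ(r)* η(r)` with values in `A_e`. -/
def pairing {t : G} (ξ η : A.Cc t) (r : G) : A.Fiber 1 :=
  A.mul (inv_mul_cancel (r * t)) (A.star rfl (ξ.1 r)) (η.1 r)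

theorem continuous_pairing {t : G} (ξ η : A.Cc t) : Continuous (A.pairing ξ η) := by
  refine A.continuous_of_mk ?_
  simp only [pairing, A.mk_mul]
  exact A.continuous_mul.comp ((A.continuous_star.comp ξ.2.1).prodMk η.2.1)

theorem pairing_add {t : G} (ξ η ζ : A.Cc t) (r : G) :
    A.pairing ξ (η + ζ) r = A.pairing ξ η r + A.pairing ξ ζ r := A.mul_add _ _ _ _

theorem pairing_smul {t : G} (c : ℂ) (ξ η : A.Cc t) (r : G) :
    A.pairing ξ (c • η) r = c • A.pairing ξ η r := A.mul_smul _ _ _ _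

theorem star_pairing {t : G} (ξ η : A.Cc t) (r : G) :
    Star.star (A.pairing ξ η r) = A.pairing η ξ r := by
  refine (A.star_mul _ (inv_inv _) rfl inv_one (inv_mul_cancel _) _ _).trans ?_
  rw [A.star_star]
  rfl

theorem pairing_self_pos {t : G} (ξ : A.Cc t) (r : G) : IsPos (A.pairing ξ ξ r) :=
  A.star_mul_self_pos _ _ _

theorem hasCompactSupport_pairing [T2Space G] {t : G} (ξ η : A.Cc t) :
    HasCompactSupport (A.pairing ξ η) := by
  obtain ⟨K, hK, hK'⟩ := η.2.2
  refine HasCompactSupport.intro hK fun r hr => ?_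
  have h := A.mul_smul (inv_mul_cancel (r * t)) 0 (A.star rfl (ξ.1 r)) 0
  rw [zero_smul, zero_smul] at h
  rw [pairing, hK' r hr, h]

/-- The section `ξ a`, `(ξ a)(r) = ξ(r) a`. -/
def ccAct {t : G} (ξ : A.Cc t) (a : A.Fiber 1) : A.Cc t :=
  ⟨fun r => A.mul (mul_one _) (ξ.1 r) a, by
    refine ⟨?_, ?_⟩
    · simp only [A.mk_mul]
      exact A.continuous_mul.comp (ξ.2.1.prodMk (continuous_const (y := (⟨1, a⟩ : A.Total))))
    · obtain ⟨K, hK, hK'⟩ := ξ.2.2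
      refine ⟨K, hK, fun r hr => ?_⟩
      have h := A.smul_mul (mul_one (r * t)) 0 0 a
      rw [zero_smul, zero_smul] at h
      simp only [hK' r hr, h]⟩

theorem pairing_ccAct {t : G} (ξ η : A.Cc t) (a : A.Fiber 1) (r : G) :
    A.pairing ξ (A.ccAct η a) r = A.pairing ξ η r * a :=
  (A.mul_assoc _ _ _ _ _ _ _).symm

end FellBundle

/-- A (left) Haar measure on `G`: a regular measure on the Borel sets. -/
structure HaarMeasure (G : Type*) [Group G] [TopologicalSpace G] where
  measure : @MeasureTheory.Measure G (borel G)
  isHaarMeasure : @MeasureTheory.Measure.IsHaarMeasure G _ _ (borel G) measure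
  regular : @MeasureTheory.Measure.Regular G (borel G) _ measure

/-- The integral with respect to a Haar measure. -/
def HaarMeasure.integral {G E : Type*} [Group G] [TopologicalSpace G] [NormedAddCommGroup E]
    [NormedSpace ℝ E] (μ : HaarMeasure G) (f : G → E) : E :=
  @MeasureTheory.integral G E _ _ (borel G) μ.measure f

/-- `κ` is the product of the Haar measures `μ` and `ν`. -/
def HaarMeasure.IsProd {G H : Type*} [Group G] [TopologicalSpace G] [Group H] [TopologicalSpace H]
    (μ : HaarMeasure G) (ν : HaarMeasure H) (κ : HaarMeasure (G × H)) : Prop :=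
  ∀ (f : G → ℝ) (g : H → ℝ), Continuous f → HasCompactSupport f → Continuous g →
    HasCompactSupport g → κ.integral (fun x => f x.1 * g x.2) = μ.integral f * ν.integral g

namespace FellBundle

variable {G : Type*} [Group G] [TopologicalSpace G] [IsTopologicalGroup G] [T2Space G]
  (A : FellBundle G) (μ : HaarMeasure G)

/-- `C_c^t(𝒜)` with the `A_e`-valued inner product `⟨ξ, η⟩ = ∫ ξ(r)* η(r) dr`. -/
def preL2 (t : G) : PreHilbert (A.Fiber 1) (A.Cc t) :=
  let _ : MeasurableSpace G := borel G
  have : BorelSpace G := ⟨rfl⟩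
  have := μ.isHaarMeasure
  have hint : ∀ ξ η : A.Cc t, MeasureTheory.Integrable (A.pairing ξ η) μ.measure := fun ξ η =>
    (A.continuous_pairing ξ η).integrable_of_hasCompactSupport (A.hasCompactSupport_pairing ξ η)
  { inner := fun ξ η => μ.integral (A.pairing ξ η)
    inner_add := fun ξ η ζ => by
      refine Eq.trans ?_ (MeasureTheory.integral_add (hint ξ η) (hint ξ ζ))
      exact congrArg μ.integral (funext fun r => A.pairing_add ξ η ζ r)
    inner_smul := fun c ξ η => by
      refine Eq.trans ?_ (MeasureTheory.integral_smul c (A.pairing ξ η))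
      exact congrArg μ.integral (funext fun r => A.pairing_smul c ξ η r)
    star_inner := fun ξ η => by
      refine ((starL' ℝ (A := A.Fiber 1)).integral_comp_comm _).symm.trans ?_
      exact congrArg μ.integral (funext fun r => A.star_pairing ξ η r)
    inner_self_pos := fun ξ => by
      let _ := CStarAlgebra.spectralOrder (A.Fiber 1)
      have := CStarAlgebra.spectralOrderedRing (A.Fiber 1)
      refine isPos_iff.2 (MeasureTheory.integral_nonneg fun r => ?_)
      exact isPos_iff.1 (A.pairing_self_pos ξ r)
    dense_act := by
      convert dense_univ
      refine Set.eq_univ_of_forall fun a ξ => ⟨A.ccAct ξ a, fun η => ?_⟩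
      refine Eq.trans ?_ 
        (((ContinuousLinearMap.mul ℝ (A.Fiber 1)).flip a).integral_comp_comm (hint η ξ))
      exact congrArg μ.integral (funext fun r => A.pairing_ccAct η ξ a r) }

/-- The Hilbert `A_e`-module `L²_t(𝒜)`, the completion of `C_c^t(𝒜)`. -/
abbrev L2 (t : G) : Type _ := (A.preL2 μ t).Compl

/-- The canonical map `C_c^t(𝒜) → L²_t(𝒜)`. -/
abbrev toL2 {t : G} : A.Cc t →ₗ[ℂ] A.L2 μ t := (A.preL2 μ t).toCompl

/-- `I_t(𝒜)`, the C⋆-algebra of compact operators on `L²_t(𝒜)`. -/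
abbrev I (t : G) : Type _ := HilbertModule.Compacts (A.L2 μ t)

/-- The modular function of `G`, normalised by `∫ f(rt) dr = Δ(t)⁻¹ ∫ f(r) dr` for the left Haar
measure. -/
def modular [LocallyCompactSpace G] (t : G) : ℝ :=
  ((MeasureTheory.Measure.modularCharacter t : NNReal) : ℝ)⁻¹

/-- The translation `ρ_t : C_c(𝒜) → C_c^t(𝒜)`, `ρ_t(ξ)(r) = Δ(t)^{1/2} ξ(rt)`. -/
def rho [LocallyCompactSpace G] (t : G) (ξ : A.Cc 1) : A.Cc t :=
  ⟨fun r => ((√(modular t) : ℝ) : ℂ) • castFiber (mul_one (r * t)) (ξ.1 (r * t)), by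
    refine ⟨(A.continuous_smul _).comp
      (f := fun r => (⟨r * t, castFiber (mul_one (r * t)) (ξ.1 (r * t))⟩ : A.Total)) ?_, ?_⟩
    · simp only [castFiber_mk]
      exact ξ.2.1.comp (continuous_mul_const t)
    · obtain ⟨K, hK, hK'⟩ := ξ.2.2
      refine ⟨(· * t⁻¹) '' K, hK.image (continuous_mul_const t⁻¹), fun r hr => ?_⟩
      have : r * t ∉ K := fun h => hr ⟨r * t, h, mul_inv_cancel_right r t⟩
      have h0 : ∀ {s u : G} (h : s = u), castFiber h (0 : A.Fiber s) = 0 := by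
        rintro s _ rfl; rfl
      simp only [hK' _ this, h0, smul_zero]⟩

end FellBundle

end FellBundles

section FellTensorProducts

variable {G H : Type*} [Group G] [TopologicalSpace G] [Group H] [TopologicalSpace H]

/-- `C` is the tensor product `𝒜 ⊗_α ℬ` of the Fell bundles `𝒜` and `ℬ`, for `α` the minimal or the
maximal C⋆-norm: it is a Fell bundle over `G × H` whose fibre over `(t, s)` is a completion of
`A_t ⊙ B_s`, with `(a ⊗ b)(a' ⊗ b') = a a' ⊗ b b'`, `(a ⊗ b)* = a* ⊗ b*`, with the topology for which
`(a, b) ↦ a ⊗ b` is continuous, and whose norm on `A_e ⊙ B_e` is the C⋆-norm `α`.  These properties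
determine `C` up to isomorphism; in particular the unit fibre of `C` is `A_e ⊗_α B_e`, and
`‖z‖² = α(z* z)` for `z ∈ A_t ⊙ B_s`. -/
structure FellTensor (α : TensorKind) (A : FellBundle G) (B : FellBundle H)
    (C : FellBundle (G × H)) where
  tmul : ∀ {t : G} {s : H} {w : G × H}, (t, s) = w →
    A.Fiber t →ₗ[ℂ] B.Fiber s →ₗ[ℂ] C.Fiber w
  tmul_mul_tmul : ∀ {t t' t'' : G} {s s' s'' : H} {w w' w'' : G × H} (ht : t * t' = t'')
    (hs : s * s' = s'') (hw : (t, s) = w) (hw' : (t', s') = w') (hw'' : (t'', s'') = w'')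
    (h : w * w' = w'') (a : A.Fiber t) (a' : A.Fiber t') (b : B.Fiber s) (b' : B.Fiber s'),
    C.mul h (tmul hw a b) (tmul hw' a' b') = tmul hw'' (A.mul ht a a') (B.mul hs b b')
  star_tmul : ∀ {t t' : G} {s s' : H} {w w' : G × H} (ht : t⁻¹ = t') (hs : s⁻¹ = s')
    (hw : (t, s) = w) (hw' : (t', s') = w') (h : w⁻¹ = w') (a : A.Fiber t) (b : B.Fiber s),
    C.star h (tmul hw a b) = tmul hw' (A.star ht a) (B.star hs b)
  dense_span : ∀ {t : G} {s : H} {w : G × H} (hw : (t, s) = w),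
    Dense (Submodule.span ℂ {c : C.Fiber w | ∃ a b, c = tmul hw a b} : Set (C.Fiber w))
  continuous_tmul : Continuous fun p : A.Total × B.Total =>
    (⟨(p.1.base, p.2.base), tmul rfl p.1.val p.2.val⟩ : C.Total)
  isNorm : α.IsNorm fun z : A.Fiber 1 ⊗[ℂ] B.Fiber 1 =>
    ‖TensorProduct.lift (tmul (rfl : ((1 : G), (1 : H)) = 1)) z‖

namespace FellTensor

variable {α : TensorKind} {A : FellBundle G} {B : FellBundle H} {C : FellBundle (G × H)}
  (T : FellTensor α A B C)

/-- The canonical `*`-homomorphism `A_e ⊙ B_e → A_e ⊗_α B_e`. -/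
def unitHom : A.Fiber 1 ⊗[ℂ] B.Fiber 1 →⋆ₙₐ[ℂ] C.Fiber 1 where
  __ := TensorProduct.lift (T.tmul (rfl : ((1 : G), (1 : H)) = 1))
  map_zero' := map_zero _
  map_mul' x y := by
    change TensorProduct.lift _ (x * y) = TensorProduct.lift _ x * TensorProduct.lift _ y
    induction x with
    | zero => simp
    | add x x' hx hx' => simp only [_root_.add_mul, map_add, hx, hx']
    | tmul a b =>
      induction y with
      | zero => simp
      | add y y' hy hy' => simp only [_root_.mul_add, map_add, hy, hy']
      | tmul a' b' =>
        rw [Algebra.TensorProduct.tmul_mul_tmul]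
        exact (T.tmul_mul_tmul _ _ _ _ _ _ a a' b b').symm
  map_star' x := by
    change TensorProduct.lift _ (star x) = star (TensorProduct.lift _ x)
    induction x with
    | zero => simp
    | add x x' hx hx' => simp only [star_add, map_add, hx, hx']
    | tmul a b =>
      rw [TensorProduct.star_tmul]
      exact (T.star_tmul _ _ _ _ _ a b).symm

theorem denseRange_unitHom : DenseRange T.unitHom := by
  refine (T.dense_span (rfl : ((1 : G), (1 : H)) = 1)).mono ?_
  have h : Submodule.span ℂ {c : C.Fiber 1 | ∃ a b, c = T.tmul rfl a b} ≤
      LinearMap.range (TensorProduct.lift (T.tmul (rfl : ((1 : G), (1 : H)) = 1))) := by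
    rw [Submodule.span_le]
    rintro _ ⟨a, b, rfl⟩
    exact ⟨a ⊗ₜ[ℂ] b, rfl⟩
  exact fun c hc => h hc

variable [IsTopologicalGroup G] [IsTopologicalGroup H]

/-- The section `ξ ⊘ η`, `(ξ ⊘ η)(g, h) = ξ(g) ⊗ η(h)`. -/
def oslash {r : G} {s : H} (ξ : A.Cc r) (η : B.Cc s) : C.Cc (r, s) :=
  ⟨fun x => T.tmul rfl (ξ.1 x.1) (η.1 x.2), by
    refine ⟨?_, ?_⟩
    · exact T.continuous_tmul.comp
        ((ξ.2.1.comp continuous_fst).prodMk (η.2.1.comp continuous_snd))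
    · obtain ⟨K, hK, hK'⟩ := ξ.2.2
      obtain ⟨L, hL, hL'⟩ := η.2.2
      refine ⟨K ×ˢ L, hK.prod hL, fun x hx => ?_⟩
      rw [Set.mem_prod, not_and_or] at hx
      rcases hx with hx | hx
      · simp only [hK' _ hx, map_zero, LinearMap.zero_apply]
      · simp only [hL' _ hx, map_zero]⟩

variable [T2Space G] [T2Space H] (μ : HaarMeasure G) (ν : HaarMeasure H) (κ : HaarMeasure (G × H))

/-- `L²_r(𝒜) ⊙ L²_s(ℬ)` as a pre-Hilbert module over `A_e ⊗_α B_e`. -/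
abbrev preL2Tensor (r : G) (s : H) : PreHilbert (C.Fiber 1) (A.L2 μ r ⊗[ℂ] B.L2 ν s) :=
  preTensor (A.L2 μ r) (B.L2 ν s) T.unitHom T.denseRange_unitHom

/-- The Hilbert `A_e ⊗_α B_e`-module `L²_r(𝒜) ⊗_α L²_s(ℬ)`. -/
abbrev L2Tensor (r : G) (s : H) : Type _ := (T.preL2Tensor μ ν r s).Compl

/-- The elementary tensor `x ⊗ y` in `L²_r(𝒜) ⊗_α L²_s(ℬ)`. -/
def tensor {r : G} {s : H} (x : A.L2 μ r) (y : B.L2 ν s) : T.L2Tensor μ ν r s :=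
  (T.preL2Tensor μ ν r s).toCompl (x ⊗ₜ[ℂ] y)

/-- `j` extends the map `ξ ⊙ η ↦ ξ ⊘ η` on `C_c^r(𝒜) ⊙ C_c^s(ℬ)`. -/
def ExtendsOslash {r : G} {s : H}
    (j : HilbertModule.Iso (T.L2Tensor μ ν r s) (C.L2 κ (r, s))) : Prop :=
  ∀ (ξ : A.Cc r) (η : B.Cc s),
    j.toLinearEquiv (T.tensor μ ν (A.toL2 μ ξ) (B.toL2 ν η)) = C.toL2 κ (T.oslash ξ η)

end FellTensor

/-- `U : L²(𝒜) → L²_t(𝒜)` extends `ρ_t : C_c(𝒜) → C_c^t(𝒜)`. -/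
def FellBundle.ExtendsRho [IsTopologicalGroup G] [T2Space G] [LocallyCompactSpace G]
    (A : FellBundle G) (μ : HaarMeasure G) {t : G}
    (U : HilbertModule.Iso (A.L2 μ 1) (A.L2 μ t)) : Prop :=
  ∀ ξ : A.Cc 1, U.toLinearEquiv (A.toL2 μ ξ) = A.toL2 μ (A.rho t ξ)

end FellTensorProducts

end

/-! Two complete Hilbert modules are isomorphic as soon as one vector space maps linearly into both
with dense range and the same inner products (`exists_iso_of_denseRange`). The module statements
thus reduce to an inner product formula and a density statement.

For `j` the inner product of `ξ ⊘ η` and `ξ' ⊘ η'` factors by a Fubini theorem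
(`IsProd.integral_bilin`), obtained from the case of real product functions by uniform
approximation. For density (`denseRange_toL2_oslash`), finite sums of sections `ξ ⊘ η` have dense
values in every fibre, a partition of unity patches local approximations together, and its weights
on `G × H` are in turn approximated by sums of products of functions of one variable. Fibrewise
density needs enough continuous sections. A Fell bundle is given only as a Banach bundle with open
projection, so they are constructed (`exists_section`) from discontinuous selections whose
oscillation is reduced step by step, in the manner of Douady and dal Soglio-Hérault. The
translations `ρ` are isometric because `Δ(t)` cancels the factor `Δ(t)⁻¹` from the change of
variables, and the square commutes on elementary sections because `Δ` of the product group is the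
product of the modular functions.

For the compact operators, `𝒦(E) ⊙ 𝒦(F)` acts on `E ⊗_α F` and its image is dense in the compacts,
since `θ ⊗ θ` is again a `θ`. It remains to see that the operator norm is the norm `α` on `𝒦(E) ⊙
𝒦(F)` (`tensorRep_isNorm`). This is a Morita argument. A C⋆-norm on `A ⊙ B` induces one on `𝒦(E) ⊙
𝒦(F)` by the action on `E ⊗ F`, and this induction is monotone (`norm_tensorRep_mono`). Conversely,
the conjugate modules `Ē` and `F̄` are Hilbert modules over `𝒦(E)` and `𝒦(F)` on which `A` and `B`
act, so a C⋆-norm on `𝒦(E) ⊙ 𝒦(F)` induces one on `A ⊙ B`; inducing back returns the original norm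
(`norm_tensorRep_of_norm_eq`). A monotone map onto the C⋆-norms of `𝒦(E) ⊙ 𝒦(F)` carries the least
norm to the least and the greatest to the greatest, which treats both choices of `α` at once.
Faithfulness of `A` on `E` is required, and `L²_r(𝒜)` is faithful because sections have dense values
in the unit fibre. -/

noncomputable section

/-! ### Extension and positivity in C⋆-algebras -/

/-- A contractive `*`-homomorphism on a dense `*`-subalgebra extends to the closure. -/
theorem exists_starHom_extension {R D D' : Type*} [NonUnitalRing R] [Module ℂ R] [StarRing R]
    [NonUnitalCStarAlgebra D] [NonUnitalCStarAlgebra D'] (ι : R →⋆ₙₐ[ℂ] D) (hι : DenseRange ι)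
    (f : R →⋆ₙₐ[ℂ] D') (hf : ∀ x, ‖f x‖ ≤ ‖ι x‖) :
    ∃ φ : D →⋆ₙₐ[ℂ] D', ∀ x, φ (ι x) = f x := by
  let f' : R →ₗ[ℂ] D' := { toFun := f, map_add' := map_add f, map_smul' := map_smul f }
  let e : R →ₗ[ℂ] D := { toFun := ι, map_add' := map_add ι, map_smul' := map_smul ι }
  let u : D →L[ℂ] D' := f'.extendOfNorm e
  have hu : ∀ x, u (ι x) = f x := fun x =>
    LinearMap.extendOfNorm_eq (f := f') (e := e) hι ⟨1, fun x => (hf x).trans_eq (one_mul _).symm⟩ x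
  refine ⟨{ toFun := u, map_smul' := fun c x => map_smul u c x, map_zero' := map_zero u,
            map_add' := fun x y => map_add u x y, map_mul' := fun x y => ?_,
            map_star' := fun x => ?_ }, hu⟩
  · refine hι.induction_on₂ (p := fun x y => u (x * y) = u x * u y)
      (isClosed_eq (by fun_prop) (by fun_prop)) (fun x y => ?_) x y
    rw [← map_mul, hu, hu, hu, map_mul]
  · refine hι.induction_on (p := fun x => u (star x) = star (u x)) x
      (isClosed_eq (by fun_prop) (by fun_prop)) fun x => ?_
    rw [← map_star, hu, hu, map_star]

theorem IsPos.map {D D' : Type*} [NonUnitalCStarAlgebra D] [NonUnitalCStarAlgebra D']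
    (φ : D →⋆ₙₐ[ℂ] D') {a : D} (h : IsPos a) : IsPos (φ a) := by
  obtain ⟨b, rfl⟩ := h
  exact ⟨φ b, by rw [map_mul, map_star]⟩

theorem IsPos.norm_le_of_sub {D : Type*} [NonUnitalCStarAlgebra D] {a b : D} (ha : IsPos a)
    (hab : IsPos (b - a)) : ‖a‖ ≤ ‖b‖ := by
  let _ := CStarAlgebra.spectralOrder D
  have := CStarAlgebra.spectralOrderedRing D
  exact CStarAlgebra.norm_le_norm_of_nonneg_of_le (isPos_iff.1 ha)
    (sub_nonneg.1 (isPos_iff.1 hab))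

/-- `‖a‖² - a* a` is of the form `m* m`. -/
theorem CStarAlgebra.exists_norm_sq_sub {D : Type*} [CStarAlgebra D] (a : D) :
    ∃ m : D, ((‖a‖ ^ 2 : ℝ) : ℂ) • (1 : D) - star a * a = star m * m := by
  let _ := CStarAlgebra.spectralOrder D
  have := CStarAlgebra.spectralOrderedRing D
  have h := sub_nonneg.2 (CStarAlgebra.star_mul_le_algebraMap_norm_sq (a := a))
  rw [Algebra.algebraMap_eq_smul_one] at h
  obtain ⟨m, hm⟩ := CStarAlgebra.nonneg_iff_eq_star_mul_self.1 h
  exact ⟨m, by rw [← hm, Complex.coe_smul]⟩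

/-! ### Hilbert modules, rank one operators and compact operators -/

namespace HilbertModule

section Basic

variable {A E F : Type*} [NonUnitalCStarAlgebra A] [NormedAddCommGroup E] [NormedSpace ℂ E]
  [NormedAddCommGroup F] [NormedSpace ℂ F] [HilbertModule A E] [HilbertModule A F]

variable (A E) in
theorem continuous_inner : Continuous fun p : E × E => (inner p.1 p.2 : A) := by
  let g := LinearMap.mkContinuous₂ (innerₛₗ A E) 1 fun x y => by
    rw [one_mul]; exact norm_inner_le x y
  exact (g.continuous.comp continuous_fst).clm_apply continuous_snd

@[fun_prop]
theorem continuous_inner' {Y : Type*} [TopologicalSpace Y] {f g : Y → E}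
    (hf : Continuous f) (hg : Continuous g) : Continuous fun t => (inner (f t) (g t) : A) :=
  (continuous_inner A E).comp (hf.prodMk hg)

theorem inner_zero_right (x : E) : (inner x 0 : A) = 0 := map_zero (innerₛₗ A E x)

theorem zero_act (a : A) : act (0 : E) a = 0 := map_zero (actₗ a)

theorem inner_sub (x y z : E) : (inner x (y - z) : A) = inner x y - inner x z :=
  map_sub (innerₛₗ A E x) y z

theorem norm_eq_of_inner_eq {x : E} {y : F} (h : (inner x x : A) = inner y y) : ‖x‖ = ‖y‖ := by
  rw [← sq_eq_sq₀ (norm_nonneg _) (norm_nonneg _), norm_sq, norm_sq, h]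

theorem Iso.norm_map (j : Iso E F) (x : E) : ‖j.toLinearEquiv x‖ = ‖x‖ :=
  norm_eq_of_inner_eq (A := A) (j.inner_map x x)

theorem Iso.continuous (j : Iso E F) : Continuous j.toLinearEquiv :=
  (⟨j.toLinearEquiv.toLinearMap, j.norm_map⟩ : E →ₗᵢ[ℂ] F).continuous

theorem Iso.ext {j j' : Iso E F} (h : ∀ x, j.toLinearEquiv x = j'.toLinearEquiv x) : j = j' := by
  cases j; cases j'
  congr
  exact LinearEquiv.ext h

/-- Two linear maps with dense range and equal inner products give an isomorphism. -/
theorem exists_iso_of_denseRange [CompleteSpace E] [CompleteSpace F] {X : Type*} [AddCommGroup X]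
    [Module ℂ X] (f : X →ₗ[ℂ] E) (g : X →ₗ[ℂ] F) (hf : DenseRange f) (hg : DenseRange g)
    (h : ∀ x y, (inner (f x) (f y) : A) = inner (g x) (g y)) :
    ∃ j : Iso E F, ∀ x, j.toLinearEquiv (f x) = g x := by
  have hn : ∀ x, ‖f x‖ = ‖g x‖ := fun x => norm_eq_of_inner_eq (h x x)
  let u : E →L[ℂ] F := g.extendOfNorm f
  let v : F →L[ℂ] E := f.extendOfNorm g
  have hu : ∀ x, u (f x) = g x := fun x =>
    LinearMap.extendOfNorm_eq hf ⟨1, fun x => by rw [one_mul, hn]⟩ x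
  have hv : ∀ x, v (g x) = f x := fun x =>
    LinearMap.extendOfNorm_eq hg ⟨1, fun x => by rw [one_mul, hn]⟩ x
  have huv : ∀ x, u (v x) = x := fun x =>
    hg.induction_on x (isClosed_eq (by fun_prop) (by fun_prop)) fun x => by rw [hv, hu]
  have hvu : ∀ x, v (u x) = x := fun x =>
    hf.induction_on x (isClosed_eq (by fun_prop) (by fun_prop)) fun x => by rw [hu, hv]
  have hin : ∀ x y, (inner (u x) (u y) : A) = inner x y := fun x y =>
    hf.induction_on₂ (p := fun x y => (inner (u x) (u y) : A) = inner x y)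
      (isClosed_eq (by fun_prop) (by fun_prop)) (fun x y => by rw [hu, hu, h]) x y
  refine ⟨{ toLinearEquiv := LinearEquiv.ofLinearMap u.toLinearMap v.toLinearMap
              (LinearMap.ext huv) (LinearMap.ext hvu),
            map_act := fun x a => ?_, inner_map := hin }, hu⟩
  -- Module linearity comes for free: `u` is onto and preserves inner products, so both sides have
  -- the same inner product with `z = u (v z)`.
  refine ext_inner fun z => ?_
  rw [inner_act]
  change (inner z (u (act x a)) : A) = inner z (u x) * a
  rw [← huv z, hin, hin, inner_act]

end Basic

section Theta

variable {A E : Type*} [NonUnitalCStarAlgebra A] [NormedAddCommGroup E] [NormedSpace ℂ E]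
  [HilbertModule A E]

/-- Membership in `adjointable` asks only for complex linearity and an adjoint; moving the operator
to the other side of the inner product forces linearity over the C⋆-algebra. -/
theorem adjointable_apply_act (T : adjointable E) (x : E) (a : A) :
    T.1 (act x a) = act (T.1 x) a :=
  ext_inner fun z => by
    rw [inner_act, ← (isAdjoint_star T).symm, ← (isAdjoint_star T).symm, inner_act]

theorem adjointable_ext {S T : adjointable E} (h : ∀ x, S.1 x = T.1 x) : S = T :=
  Subtype.ext (ContinuousLinearMap.ext h)

theorem mul_theta (T : adjointable E) (x y : E) : T * theta x y = theta (T.1 x) y :=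
  adjointable_ext fun z => adjointable_apply_act T x (inner y z)

theorem star_theta (x y : E) : star (theta x y) = theta y x :=
  star_eq_of_isAdjoint fun z w => by
    rw [theta_apply, theta_apply, act_inner, inner_act, star_inner]

theorem theta_mul (T : adjointable E) (x y : E) : theta x y * T = theta x ((star T).1 y) := by
  have h := congrArg star (mul_theta (star T) y x)
  rwa [star_mul, star_theta, star_theta, star_star] at h

theorem theta_add_left (x x' y : E) : theta (x + x') y = theta x y + theta x' y :=
  adjointable_ext fun _ => add_act x x' _

theorem theta_smul_left (c : ℂ) (x y : E) : theta (c • x) y = c • theta x y :=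
  adjointable_ext fun _ => smul_act c x _

theorem theta_add_right (x y y' : E) : theta x (y + y') = theta x y + theta x y' := by
  rw [← star_theta, theta_add_left, star_add, star_theta, star_theta]

theorem theta_smul_right (c : ℂ) (x y : E) : theta x (c • y) = star c • theta x y := by
  rw [← star_theta, theta_smul_left, star_smul, star_theta]

theorem norm_theta_le (x y : E) : ‖theta x y‖ ≤ ‖x‖ * ‖y‖ :=
  ContinuousLinearMap.opNorm_le_bound _ (by positivity) fun z => by
    change ‖act x (inner y z)‖ ≤ _
    rw [mul_assoc]
    exact (norm_act_le _ _).trans (by gcongr; exact norm_inner_le y z)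

/-- The lower bound comes from evaluating at `x` itself: with `a = ⟨x, x⟩` one has `‖θ x‖² = ‖a³‖`,
and `‖a³‖` is at least `‖a‖³ = ‖x‖⁶`. This identity later recovers the norm of a vector of the
conjugate module from an operator norm. -/
theorem norm_theta_self (x : E) : ‖theta x x‖ = ‖x‖ ^ 2 := by
  refine le_antisymm ((norm_theta_le x x).trans_eq (sq _).symm) ?_
  rcases (norm_nonneg x).eq_or_lt with h0 | h0
  · rw [← h0, sq, zero_mul]; exact norm_nonneg _
  set a : A := inner x x with ha
  have hsa : star a = a := star_inner x x
  have hna : ‖a‖ = ‖x‖ ^ 2 := (norm_sq x).symm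
  have h1 : ‖(theta x x).1 x‖ ≤ ‖theta x x‖ * ‖x‖ := (theta x x).1.le_opNorm x
  have h2 : ‖a * a * a‖ = ‖(theta x x).1 x‖ ^ 2 := by
    rw [norm_sq, theta_apply, inner_act, act_inner, hsa]
  have h3 : ‖a * a‖ = ‖a‖ * ‖a‖ := by
    conv_lhs => rw [← hsa, hsa]
    nth_rewrite 1 [← hsa]
    exact CStarRing.norm_star_mul_self
  have h4 : ‖a * a * a * a‖ = ‖a * a‖ * ‖a * a‖ := by
    have : a * a * a * a = star (a * a) * (a * a) := by
      rw [star_mul, hsa]; simp only [mul_assoc]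
    rw [this, CStarRing.norm_star_mul_self]
  -- By the C⋆-identity `‖a‖⁴ = ‖a⁴‖ ≤ ‖a³‖ ‖a‖`; one factor is cancelled.
  have h5 : ‖a‖ ^ 3 ≤ ‖a * a * a‖ := by
    have h6 := norm_mul_le (a * a * a) a
    rw [h4, h3] at h6
    have : 0 < ‖a‖ := by rw [hna]; positivity
    refine le_of_mul_le_mul_right ?_ this
    calc _ = _ := by ring
      _ ≤ _ := h6
  rw [h2, hna] at h5
  have h6 : ‖x‖ ^ 3 ≤ ‖theta x x‖ * ‖x‖ := by
    refine le_trans ?_ h1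
    refine (abs_le_of_sq_le_sq' ?_ (norm_nonneg _)).2
    calc _ = _ := by ring
      _ ≤ _ := h5
  refine le_of_mul_le_mul_right ?_ h0
  calc _ = _ := by ring
    _ ≤ _ := h6

end Theta

section CompactOperators

variable {A E : Type*} [NonUnitalCStarAlgebra A] [NormedAddCommGroup E] [NormedSpace ℂ E]
  [HilbertModule A E] [CompleteSpace E]

variable (E) in
/-- The inclusion `𝒦(E) → ℒ(E)`. -/
def Compacts.incl : Compacts E →⋆ₙₐ[ℂ] adjointable E where
  toFun k := k.1
  map_smul' _ _ := rfl
  map_zero' := rfl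
  map_add' _ _ := rfl
  map_mul' _ _ := rfl
  map_star' _ := rfl

theorem Compacts.incl_injective : Function.Injective (Compacts.incl E) := Subtype.val_injective

/-- The rank one operators span a dense subspace of `𝒦(E)`. -/
theorem Compacts.mem_closure_span_theta (k : Compacts E) :
    Compacts.incl E k ∈ closure
      (Submodule.span ℂ {T : adjointable E | ∃ x y, T = theta x y} : Set (adjointable E)) := by
  have h : (NonUnitalStarAlgebra.adjoin ℂ {T : adjointable E | ∃ x y, T = theta x y} :
      Set (adjointable E)) ⊆ Submodule.span ℂ {T : adjointable E | ∃ x y, T = theta x y} := by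
    intro T hT
    induction hT using NonUnitalStarAlgebra.adjoin_induction with
    | mem T hT => exact Submodule.subset_span hT
    | zero => exact zero_mem _
    | add S T _ _ hS hT => exact add_mem hS hT
    | smul c T _ hT => exact Submodule.smul_mem _ c hT
    -- Only the right factor has to lie in the span, since by `mul_theta` the span is a left ideal
    -- among the adjointable operators.
    | mul S T _ hT' _ hT =>
      clear hT'
      induction hT using Submodule.span_induction with
      | mem T hT =>
        obtain ⟨x, y, rfl⟩ := hT
        exact Submodule.subset_span ⟨_, _, mul_theta S x y⟩
      | zero => rw [mul_zero]; exact zero_mem _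
      | add T T' _ _ h h' => rw [mul_add]; exact add_mem h h'
      | smul c T _ h => rw [mul_smul_comm]; exact Submodule.smul_mem _ c h
    | star T hT' hT =>
      clear hT'
      induction hT using Submodule.span_induction with
      | mem T hT =>
        obtain ⟨x, y, rfl⟩ := hT
        exact Submodule.subset_span ⟨_, _, star_theta x y⟩
      | zero => rw [star_zero]; exact zero_mem _
      | add T T' _ _ h h' => rw [star_add]; exact add_mem h h'
      | smul c T _ h => rw [star_smul]; exact Submodule.smul_mem _ _ h
  exact closure_mono h k.2

variable (E) in
theorem Compacts.dense_span_thetaK :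
    Dense (Submodule.span ℂ {k : Compacts E | ∃ x y, k = thetaK x y} : Set (Compacts E)) := by
  intro k
  have hemb : Topology.IsInducing (Compacts.incl E) := Topology.IsInducing.subtypeVal
  rw [hemb.closure_eq_preimage_closure_image, Set.mem_preimage]
  refine closure_mono ?_ (Compacts.mem_closure_span_theta k)
  intro T hT
  induction hT using Submodule.span_induction with
  | mem T hT =>
    obtain ⟨x, y, rfl⟩ := hT
    exact ⟨thetaK x y, Submodule.subset_span ⟨x, y, rfl⟩, rfl⟩
  | zero => exact ⟨0, zero_mem _, rfl⟩
  | add S T _ _ hS hT =>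
    obtain ⟨S', hS', rfl⟩ := hS
    obtain ⟨T', hT', rfl⟩ := hT
    exact ⟨S' + T', add_mem hS' hT', rfl⟩
  | smul c T _ hT =>
    obtain ⟨T', hT', rfl⟩ := hT
    exact ⟨c • T', Submodule.smul_mem _ c hT', rfl⟩

theorem Compacts.star_thetaK (x y : E) : star (thetaK x y) = thetaK y x :=
  Compacts.incl_injective (star_theta x y)

theorem Compacts.inner_app (k : Compacts E) (x y : E) :
    (inner (k.app x) y : A) = inner x ((star k).app y) :=
  isAdjoint_star k.1 x y

/-- `IsPos` demands a square root inside `𝒦(E)`. Let `q = s* s` be the negative part of `θ =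
θ_{x,x}`, so that `θ q = -q²`. Then `⟨q z, θ q z⟩ = ⟨x, q z⟩* ⟨x, q z⟩` is positive but equals `-⟨s
q z, s q z⟩`, whence `s q = 0` and `q² = s* (s q) = 0`. -/
theorem Compacts.isPos_thetaK (x : E) : IsPos (thetaK x x) := by
  obtain ⟨q, s, hq, hs, hmq, h0⟩ := exists_negPart (thetaK x x) (Compacts.star_thetaK x x)
  refine h0 ?_
  let _ := CStarAlgebra.spectralOrder A
  have := CStarAlgebra.spectralOrderedRing A
  have hsq : s * q = 0 := by
    refine Compacts.incl_injective (adjointable_ext fun z => ?_)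
    change s.app (q.app z) = 0
    have h1 : (inner (q.app z) ((thetaK x x * q).app z) : A) =
        star (inner x (q.app z)) * inner x (q.app z) := by
      change (inner (q.app z) (act x (inner x (q.app z))) : A) = _
      rw [inner_act, star_inner]
    have h2 : (inner (q.app z) ((q * q).app z) : A) =
        inner (s.app (q.app z)) (s.app (q.app z)) := by
      rw [Compacts.inner_app s]
      change (inner (q.app z) (q.app (q.app z)) : A) = inner (q.app z) ((star s * s).app (q.app z))
      rw [← hs]
    have h3 : (inner (q.app z) ((-(q * q)).app z) : A) = -inner (q.app z) ((q * q).app z) :=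
      map_neg (innerₛₗ A E (q.app z)) _
    rw [hmq, h3, h2] at h1
    have h4 : (0 : A) ≤ -inner (s.app (q.app z)) (s.app (q.app z)) :=
      h1 ▸ star_mul_self_nonneg _
    have h5 : (inner (s.app (q.app z)) (s.app (q.app z)) : A) = 0 :=
      le_antisymm (neg_nonneg.1 h4) (isPos_iff.1 (inner_self_pos _))
    rw [← norm_eq_zero, ← sq_eq_zero_iff, norm_sq (A := A), h5, norm_zero]
  rw [← CStarRing.star_mul_self_eq_zero_iff, hq]
  calc q * q = star s * (s * q) := by rw [← mul_assoc, ← hs]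
    _ = 0 := by rw [hsq, mul_zero]

end CompactOperators

end HilbertModule

/-! ### Operators on the completion of a pre-Hilbert module -/

namespace PreHilbert

variable {A X : Type*} [NonUnitalCStarAlgebra A] [AddCommGroup X] [Module ℂ X]
  (P : PreHilbert A X)

theorem inner_toCompl (x y : X) :
    (HilbertModule.inner (P.toCompl x) (P.toCompl y) : A) = P.inner x y := P.cinner_coe x y

theorem norm_sq_toCompl (x : X) : ‖P.toCompl x‖ ^ 2 = ‖P.inner x x‖ := by
  rw [HilbertModule.norm_sq (A := A), inner_toCompl]

/-- A bounded linear map with a bounded formal adjoint extends to an adjointable operator on the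
completion. -/
theorem exists_adjointable (f g : X →ₗ[ℂ] X) (hfg : ∀ x y, P.inner (f x) y = P.inner x (g y))
    {C : ℝ} (hf : ∀ x, ‖P.toCompl (f x)‖ ≤ C * ‖P.toCompl x‖)
    {C' : ℝ} (hg : ∀ x, ‖P.toCompl (g x)‖ ≤ C' * ‖P.toCompl x‖) :
    ∃ T : HilbertModule.adjointable P.Compl, ∀ x, T.1 (P.toCompl x) = P.toCompl (f x) := by
  let u : P.Compl →L[ℂ] P.Compl := (P.toCompl.comp f).extendOfNorm P.toCompl
  let v : P.Compl →L[ℂ] P.Compl := (P.toCompl.comp g).extendOfNorm P.toCompl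
  have hu : ∀ x, u (P.toCompl x) = P.toCompl (f x) := fun x =>
    LinearMap.extendOfNorm_eq (f := P.toCompl.comp f) P.denseRange_toCompl ⟨C, hf⟩ x
  have hv : ∀ x, v (P.toCompl x) = P.toCompl (g x) := fun x =>
    LinearMap.extendOfNorm_eq (f := P.toCompl.comp g) P.denseRange_toCompl ⟨C', hg⟩ x
  refine ⟨⟨u, v, fun x y => ?_⟩, hu⟩
  refine P.denseRange_toCompl.induction_on₂
    (p := fun x y => (HilbertModule.inner (u x) y : A) = HilbertModule.inner x (v y))
    (isClosed_eq (by fun_prop) (by fun_prop)) (fun x y => ?_) x y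
  rw [hu, hv, inner_toCompl, inner_toCompl, hfg]

end PreHilbert


open HilbertModule

/-! ### Separating families and algebraic tensor products -/

section Separation

/-- A tensor is zero if it is killed by a separating family of linear maps on the left factor. -/
theorem TensorProduct.eq_zero_of_map_left {k V V' W I : Type*} [Field k] [AddCommGroup V]
    [Module k V] [AddCommGroup V'] [Module k V'] [AddCommGroup W] [Module k W]
    (u : I → V →ₗ[k] V') (hu : ∀ v, (∀ i, u i v = 0) → v = 0) (t : V ⊗[k] W)
    (ht : ∀ i, TensorProduct.map (u i) (LinearMap.id : W →ₗ[k] W) t = 0) : t = 0 := by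
  -- In a basis of the right factor a tensor has unique coefficients in `V`, and `u i ⊗ id` acts on
  -- these coefficients one by one.
  let b := Module.Basis.ofVectorSpace k W
  obtain ⟨c, rfl⟩ := TensorProduct.eq_repr_basis_right b t
  have hc : c = 0 := by
    ext j
    refine hu _ fun i => ?_
    have h := ht i
    rw [Finsupp.sum, map_sum] at h
    simp only [TensorProduct.map_tmul, LinearMap.id_apply] at h
    have h2 : (c.mapRange (u i) (map_zero _)).sum (fun j m => m ⊗ₜ[k] b j) = 0 := by
      rw [Finsupp.sum_mapRange_index (by simp), Finsupp.sum]
      exact h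
    have h3 := TensorProduct.sum_tmul_basis_right_eq_zero b _ h2
    exact DFunLike.congr_fun h3 j
  rw [hc, Finsupp.sum_zero_index]

theorem TensorProduct.eq_zero_of_map_right {k V W W' J : Type*} [Field k] [AddCommGroup V]
    [Module k V] [AddCommGroup W'] [Module k W'] [AddCommGroup W] [Module k W]
    (w : J → W →ₗ[k] W') (hw : ∀ v, (∀ i, w i v = 0) → v = 0) (t : V ⊗[k] W)
    (ht : ∀ i, TensorProduct.map (LinearMap.id : V →ₗ[k] V) (w i) t = 0) : t = 0 := by
  refine (TensorProduct.comm k V W).injective ?_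
  rw [map_zero]
  refine TensorProduct.eq_zero_of_map_left w hw _ fun i => ?_
  rw [TensorProduct.map_comm, ht, map_zero]

/-- A tensor is zero if it is killed by the tensor products of two separating families. -/
theorem TensorProduct.eq_zero_of_map {k V V' W W' I J : Type*} [Field k] [AddCommGroup V]
    [Module k V] [AddCommGroup V'] [Module k V'] [AddCommGroup W] [Module k W]
    [AddCommGroup W'] [Module k W'] (u : I → V →ₗ[k] V') (hu : ∀ v, (∀ i, u i v = 0) → v = 0)
    (w : J → W →ₗ[k] W') (hw : ∀ v, (∀ i, w i v = 0) → v = 0) (t : V ⊗[k] W)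
    (ht : ∀ i j, TensorProduct.map (u i) (w j) t = 0) : t = 0 := by
  refine TensorProduct.eq_zero_of_map_left u hu t fun i => ?_
  refine TensorProduct.eq_zero_of_map_right w hw _ fun j => ?_
  rw [← ht i j, ← LinearMap.comp_apply, ← TensorProduct.map_comp, LinearMap.id_comp,
    LinearMap.comp_id]

end Separation

/-! ### Tensor products of adjointable operators -/

section TensorOperators

variable {A B D E F : Type*} [NonUnitalCStarAlgebra A] [NonUnitalCStarAlgebra B]
  [NonUnitalCStarAlgebra D] [NormedAddCommGroup E] [NormedSpace ℂ E] [NormedAddCommGroup F]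
  [NormedSpace ℂ F] [HilbertModule A E] [HilbertModule B F]

/-- `S ⊙ T` on the algebraic tensor product of two Hilbert modules. -/
def tensorMap (S : adjointable E) (T : adjointable F) : E ⊗[ℂ] F →ₗ[ℂ] E ⊗[ℂ] F :=
  TensorProduct.map S.1.toLinearMap T.1.toLinearMap

theorem tensorMap_tmul (S : adjointable E) (T : adjointable F) (x : E) (y : F) :
    tensorMap S T (x ⊗ₜ[ℂ] y) = S.1 x ⊗ₜ[ℂ] T.1 y := rfl

theorem tensorMap_mul (S S' : adjointable E) (T T' : adjointable F) (z : E ⊗[ℂ] F) :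
    tensorMap (S * S') (T * T') z = tensorMap S T (tensorMap S' T' z) :=
  LinearMap.congr_fun (TensorProduct.map_comp S.1.toLinearMap T.1.toLinearMap
    S'.1.toLinearMap T'.1.toLinearMap) z

theorem tensorMap_one (z : E ⊗[ℂ] F) : tensorMap 1 1 z = z :=
  LinearMap.congr_fun TensorProduct.map_id z

theorem tensorInner_tensorMap (S : adjointable E) (T : adjointable F) (z w : E ⊗[ℂ] F) :
    (tensorInner (tensorMap S T z) w : A ⊗[ℂ] B) = tensorInner z (tensorMap (star S) (star T) w) := by
  induction z with
  | zero => simp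
  | add z z' hz hz' => simp [hz, hz']
  | tmul x y =>
    induction w with
    | zero => simp
    | add w w' hw hw' => simp [hw, hw']
    | tmul x' y' =>
      rw [tensorMap_tmul, tensorMap_tmul, tensorInner_tmul, tensorInner_tmul, isAdjoint_star S,
        isAdjoint_star T]

theorem tensorMap_add_left (S S' : adjointable E) (T : adjointable F) (z : E ⊗[ℂ] F) :
    tensorMap (S + S') T z = tensorMap S T z + tensorMap S' T z :=
  LinearMap.congr_fun (TensorProduct.map_add_left S.1.toLinearMap S'.1.toLinearMap
    T.1.toLinearMap) z

theorem tensorMap_add_right (S : adjointable E) (T T' : adjointable F) (z : E ⊗[ℂ] F) :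
    tensorMap S (T + T') z = tensorMap S T z + tensorMap S T' z :=
  LinearMap.congr_fun (TensorProduct.map_add_right S.1.toLinearMap T.1.toLinearMap
    T'.1.toLinearMap) z

theorem tensorMap_sub_left (S S' : adjointable E) (T : adjointable F) (z : E ⊗[ℂ] F) :
    tensorMap (S - S') T z = tensorMap S T z - tensorMap S' T z := by
  rw [eq_sub_iff_add_eq, ← tensorMap_add_left, sub_add_cancel]

theorem tensorMap_smul_left (c : ℂ) (S : adjointable E) (T : adjointable F) (z : E ⊗[ℂ] F) :
    tensorMap (c • S) T z = c • tensorMap S T z :=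
  LinearMap.congr_fun (TensorProduct.map_smul_left c S.1.toLinearMap T.1.toLinearMap) z

theorem tensorMap_sub_right (S : adjointable E) (T T' : adjointable F) (z : E ⊗[ℂ] F) :
    tensorMap S (T - T') z = tensorMap S T z - tensorMap S T' z := by
  rw [eq_sub_iff_add_eq, ← tensorMap_add_right, sub_add_cancel]

theorem tensorMap_smul_right (c : ℂ) (S : adjointable E) (T : adjointable F) (z : E ⊗[ℂ] F) :
    tensorMap S (c • T) z = c • tensorMap S T z :=
  LinearMap.congr_fun (TensorProduct.map_smul_right c S.1.toLinearMap T.1.toLinearMap) z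

/-- Writing `‖S‖² - S* S = m* m` gives `‖S‖² ⟨z, z⟩ - ⟨S z, S z⟩ = ⟨m z, m z⟩`, which is positive
after applying `ι`. Thus boundedness on the exterior tensor product needs no assumption on `ι`
beyond its being a `*`-homomorphism. -/
theorem norm_tensorInner_tensorMap_one_right_le [CompleteSpace E] (ι : A ⊗[ℂ] B →⋆ₙₐ[ℂ] D)
    (S : adjointable E) (z : E ⊗[ℂ] F) :
    ‖ι (tensorInner (tensorMap S 1 z) (tensorMap S 1 z))‖ ≤ ‖S‖ ^ 2 * ‖ι (tensorInner z z)‖ := by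
  obtain ⟨m, hm⟩ := CStarAlgebra.exists_norm_sq_sub S
  have h : ((‖S‖ ^ 2 : ℝ) : ℂ) • ι (tensorInner z z)
      - ι (tensorInner (tensorMap S 1 z) (tensorMap S 1 z))
      = ι (tensorInner (tensorMap m 1 z) (tensorMap m 1 z)) := by
    rw [tensorInner_tensorMap, tensorInner_tensorMap, ← tensorMap_mul, ← tensorMap_mul, ← hm,
      star_one, mul_one, tensorMap_sub_left, tensorMap_smul_left, tensorMap_one, map_sub, map_sub,
      map_smul, map_smul]
  have h1 := IsPos.norm_le_of_sub (tensorInner_self_pos ι (tensorMap S 1 z))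
    (h ▸ tensorInner_self_pos ι (tensorMap m 1 z))
  rwa [norm_smul, Complex.norm_real, Real.norm_of_nonneg (by positivity)] at h1

theorem norm_tensorInner_tensorMap_one_left_le [CompleteSpace F] (ι : A ⊗[ℂ] B →⋆ₙₐ[ℂ] D)
    (T : adjointable F) (z : E ⊗[ℂ] F) :
    ‖ι (tensorInner (tensorMap 1 T z) (tensorMap 1 T z))‖ ≤ ‖T‖ ^ 2 * ‖ι (tensorInner z z)‖ := by
  obtain ⟨m, hm⟩ := CStarAlgebra.exists_norm_sq_sub T
  have h : ((‖T‖ ^ 2 : ℝ) : ℂ) • ι (tensorInner z z)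
      - ι (tensorInner (tensorMap 1 T z) (tensorMap 1 T z))
      = ι (tensorInner (tensorMap 1 m z) (tensorMap 1 m z)) := by
    rw [tensorInner_tensorMap, tensorInner_tensorMap, ← tensorMap_mul, ← tensorMap_mul, ← hm,
      star_one, mul_one, tensorMap_sub_right, tensorMap_smul_right, tensorMap_one, map_sub, map_sub,
      map_smul, map_smul]
  have h1 := IsPos.norm_le_of_sub (tensorInner_self_pos ι (tensorMap 1 T z))
    (h ▸ tensorInner_self_pos ι (tensorMap 1 m z))
  rwa [norm_smul, Complex.norm_real, Real.norm_of_nonneg (by positivity)] at h1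

theorem norm_tensorInner_tensorMap_le [CompleteSpace E] [CompleteSpace F]
    (ι : A ⊗[ℂ] B →⋆ₙₐ[ℂ] D) (S : adjointable E) (T : adjointable F) (z : E ⊗[ℂ] F) :
    ‖ι (tensorInner (tensorMap S T z) (tensorMap S T z))‖
      ≤ (‖S‖ * ‖T‖) ^ 2 * ‖ι (tensorInner z z)‖ := by
  have h : tensorMap S T z = tensorMap S 1 (tensorMap 1 T z) := by
    rw [← tensorMap_mul, mul_one, one_mul]
  rw [h, mul_pow, mul_assoc]
  exact (norm_tensorInner_tensorMap_one_right_le ι S _).trans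
    (by gcongr; exact norm_tensorInner_tensorMap_one_left_le ι T z)

end TensorOperators

/-! ### The bound `‖ι(a ⊗ b)‖ ≤ ‖a‖ ‖b‖` -/

section CrossNorm

variable {A B D : Type*} [NonUnitalCStarAlgebra A] [NonUnitalCStarAlgebra B]
  [NonUnitalCStarAlgebra D]

variable (A) in
/-- A C⋆-algebra as a Hilbert module over itself. -/
@[reducible]
def selfHilbertModule : HilbertModule A A where
  act := (· * ·)
  inner x y := star x * y
  add_act := add_mul
  act_add := mul_add
  act_mul x a b := (mul_assoc x a b).symm
  smul_act := smul_mul_assoc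
  act_smul c x a := mul_smul_comm c x a
  inner_add x y z := mul_add (star x) y z
  inner_smul c x y := mul_smul_comm c (star x) y
  inner_act x y a := (mul_assoc (star x) y a).symm
  star_inner x y := by rw [star_mul, star_star]
  inner_self_pos x := ⟨x, rfl⟩
  norm_sq x := by rw [CStarRing.norm_star_mul_self, sq]

attribute [local instance] selfHilbertModule

/-- Left multiplication as an adjointable operator. -/
def leftMul (a : A) : adjointable A :=
  ⟨ContinuousLinearMap.mul ℂ A a, ContinuousLinearMap.mul ℂ A (star a), fun x y => by
    change star (a * x) * y = star x * (star a * y)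
    rw [star_mul, mul_assoc]⟩

theorem norm_leftMul_le (a : A) : ‖leftMul a‖ ≤ ‖a‖ :=
  ContinuousLinearMap.opNorm_mul_apply_le ℂ A a

/-- A C⋆-algebra is a Hilbert module over itself and left multiplications are adjointable, so this
is the operator bound for `leftMul a ⊗ leftMul b` at an elementary tensor. -/
theorem norm_map_mul_tmul_mul_le (ι : A ⊗[ℂ] B →⋆ₙₐ[ℂ] D) (a a' : A) (b b' : B) :
    ‖ι ((a * a') ⊗ₜ[ℂ] (b * b'))‖ ≤ ‖a‖ * ‖b‖ * ‖ι (a' ⊗ₜ[ℂ] b')‖ := by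
  have h := norm_tensorInner_tensorMap_le ι (leftMul a) (leftMul b) (a' ⊗ₜ[ℂ] b')
  have h1 : ∀ (x : A) (y : B), ‖ι (tensorInner (x ⊗ₜ[ℂ] y) (x ⊗ₜ[ℂ] y))‖ =
      ‖ι (x ⊗ₜ[ℂ] y)‖ ^ 2 := fun x y => by
    have : (tensorInner (x ⊗ₜ[ℂ] y) (x ⊗ₜ[ℂ] y) : A ⊗[ℂ] B) =
        star (x ⊗ₜ[ℂ] y) * (x ⊗ₜ[ℂ] y) := by
      rw [TensorProduct.star_tmul, Algebra.TensorProduct.tmul_mul_tmul]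
      rfl
    rw [this, map_mul, map_star, CStarRing.norm_star_mul_self, sq]
  rw [tensorMap_tmul, h1, h1, ← mul_pow] at h
  refine ((abs_le_of_sq_le_sq' h (by positivity)).2 : ‖ι ((a * a') ⊗ₜ[ℂ] (b * b'))‖ ≤ _).trans ?_
  gcongr <;> exact norm_leftMul_le _

/-- A `*`-homomorphism from `A ⊙ B` into a C⋆-algebra satisfies `‖ι(a ⊗ b)‖ ≤ ‖a‖ ‖b‖`. -/
theorem norm_map_tmul_le (ι : A ⊗[ℂ] B →⋆ₙₐ[ℂ] D) (a : A) (b : B) :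
    ‖ι (a ⊗ₜ[ℂ] b)‖ ≤ ‖a‖ * ‖b‖ := by
  have hsq : ∀ (a : A) (b : B), ‖ι ((star a * a) ⊗ₜ[ℂ] (star b * b))‖ = ‖ι (a ⊗ₜ[ℂ] b)‖ ^ 2 :=
    fun a b => by
      rw [← Algebra.TensorProduct.tmul_mul_tmul, ← TensorProduct.star_tmul, map_mul, map_star,
        CStarRing.norm_star_mul_self, sq]
  -- For self-adjoint elements the preceding bound with equal factors reads `‖ι(a ⊗ b)‖² ≤ ‖a‖ ‖b‖
  -- ‖ι(a ⊗ b)‖`. The general case follows by passing to `a* a` and `b* b`.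
  have key : ∀ (a : A) (b : B), star a = a → star b = b → ‖ι (a ⊗ₜ[ℂ] b)‖ ≤ ‖a‖ * ‖b‖ := by
    intro a b ha hb
    have h := norm_map_mul_tmul_mul_le ι a a b b
    have h2 := hsq a b
    rw [ha, hb] at h2
    rw [h2, sq] at h
    rcases (norm_nonneg (ι (a ⊗ₜ[ℂ] b))).eq_or_lt with h0 | h0
    · rw [← h0]; positivity
    · exact le_of_mul_le_mul_right h h0
  refine (abs_le_of_sq_le_sq' ?_ (by positivity)).2
  rw [← hsq, mul_pow, sq, sq, ← CStarRing.norm_star_mul_self, ← CStarRing.norm_star_mul_self]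
  exact key _ _ (by rw [star_mul, star_star]) (by rw [star_mul, star_star])

end CrossNorm


open HilbertModule

/-! ### Representations on an exterior tensor product -/

theorem PreHilbert.adjointable_ext {A X : Type*} [NonUnitalCStarAlgebra A] [AddCommGroup X]
    [Module ℂ X] (P : PreHilbert A X) {S T : adjointable P.Compl}
    (h : ∀ x, S.1 (P.toCompl x) = T.1 (P.toCompl x)) : S = T :=
  HilbertModule.adjointable_ext fun x => P.compl_induction x
    (isClosed_eq S.1.continuous T.1.continuous) h

/-- The `*`-homomorphism on `K ⊙ L` given by a multiplicative, star-preserving bilinear map. -/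
def tensorLiftStar {K L R : Type*} [NonUnitalCStarAlgebra K] [NonUnitalCStarAlgebra L]
    [NonUnitalRing R] [Module ℂ R] [StarRing R] (f : K →ₗ[ℂ] L →ₗ[ℂ] R)
    (hmul : ∀ k k' l l', f (k * k') (l * l') = f k l * f k' l')
    (hstar : ∀ k l, f (star k) (star l) = star (f k l)) : K ⊗[ℂ] L →⋆ₙₐ[ℂ] R where
  toFun := TensorProduct.lift f
  map_smul' c x := map_smul (TensorProduct.lift f) c x
  map_zero' := map_zero (TensorProduct.lift f)
  map_add' x y := map_add (TensorProduct.lift f) x y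
  map_mul' x y := by
    induction x with
    | zero => simp only [zero_mul, map_zero]
    | add x x' hx hx' => simp only [add_mul, map_add, hx, hx']
    | tmul k l =>
      induction y with
      | zero => simp only [mul_zero, map_zero]
      | add y y' hy hy' => simp only [mul_add, map_add, hy, hy']
      | tmul k' l' =>
        rw [Algebra.TensorProduct.tmul_mul_tmul]
        exact hmul k k' l l'
  map_star' x := by
    induction x with
    | zero => simp only [star_zero, map_zero]
    | add x x' hx hx' => simp only [star_add, map_add, hx, hx']
    | tmul k l => exact hstar k l

section TensorAct

variable {A B E F K L : Type*} [NonUnitalCStarAlgebra A] [NonUnitalCStarAlgebra B]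
  [NormedAddCommGroup E] [NormedSpace ℂ E] [NormedAddCommGroup F]
  [NormedSpace ℂ F] [HilbertModule A E] [HilbertModule B F] [NonUnitalCStarAlgebra K]
  [NonUnitalCStarAlgebra L] (σ : K →⋆ₙₐ[ℂ] adjointable E) (τ : L →⋆ₙₐ[ℂ] adjointable F)

/-- The action of `K ⊙ L` on the algebraic tensor product of two Hilbert modules. -/
def tensorAct : K ⊗[ℂ] L →ₗ[ℂ] E ⊗[ℂ] F →ₗ[ℂ] E ⊗[ℂ] F :=
  TensorProduct.lift (LinearMap.mk₂ ℂ (fun k l => tensorMap (σ k) (τ l))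
    (fun k k' l => LinearMap.ext fun z => by
      rw [map_add, tensorMap_add_left]; rfl)
    (fun c k l => LinearMap.ext fun z => by
      rw [map_smul, tensorMap_smul_left]; rfl)
    (fun k l l' => LinearMap.ext fun z => by
      rw [map_add, tensorMap_add_right]; rfl)
    (fun c k l => LinearMap.ext fun z => by
      rw [map_smul, tensorMap_smul_right]; rfl))

theorem tensorAct_tmul (k : K) (l : L) (z : E ⊗[ℂ] F) :
    tensorAct σ τ (k ⊗ₜ[ℂ] l) z = tensorMap (σ k) (τ l) z := rfl

end TensorAct

section TensorOp

variable {A B D E F : Type*} [NonUnitalCStarAlgebra A] [NonUnitalCStarAlgebra B]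
  [NonUnitalCStarAlgebra D] [NormedAddCommGroup E] [NormedSpace ℂ E] [NormedAddCommGroup F]
  [NormedSpace ℂ F] [HilbertModule A E] [HilbertModule B F]
  (ι : A ⊗[ℂ] B →⋆ₙₐ[ℂ] D) (hι : DenseRange ι)

theorem preTensor_norm_sq (z : E ⊗[ℂ] F) :
    ‖(preTensor E F ι hι).toCompl z‖ ^ 2 = ‖ι (tensorInner z z)‖ :=
  PreHilbert.norm_sq_toCompl _ z

theorem norm_toCompl_tmul_le (x : E) (y : F) :
    ‖(preTensor E F ι hι).toCompl (x ⊗ₜ[ℂ] y)‖ ≤ ‖x‖ * ‖y‖ := by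
  refine (abs_le_of_sq_le_sq' ?_ (by positivity)).2
  rw [preTensor_norm_sq, tensorInner_tmul, mul_pow, norm_sq (A := A) x, norm_sq (A := B) y]
  exact norm_map_tmul_le ι _ _

theorem continuous_toCompl_tmul :
    Continuous fun p : E × F => (preTensor E F ι hι).toCompl (p.1 ⊗ₜ[ℂ] p.2) := by
  let g := LinearMap.mkContinuous₂
    ((TensorProduct.mk ℂ E F).compr₂ (preTensor E F ι hι).toCompl) 1 fun x y => by
      rw [one_mul]; exact norm_toCompl_tmul_le ι hι x y
  exact (g.continuous.comp continuous_fst).clm_apply continuous_snd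

/-- The action on a completion is characterised only by its inner products, so the equality is
tested against the dense set of algebraic tensors. -/
theorem act_toCompl_tmul (x : E) (y : F) (a : A) (b : B) :
    act ((preTensor E F ι hι).toCompl (x ⊗ₜ[ℂ] y)) (ι (a ⊗ₜ[ℂ] b)) =
      (preTensor E F ι hι).toCompl (act x a ⊗ₜ[ℂ] act y b) := by
  refine ext_inner fun w => ?_
  refine (preTensor E F ι hι).compl_induction w (isClosed_eq (by fun_prop) (by fun_prop)) fun w => ?_
  rw [inner_act, PreHilbert.inner_toCompl, PreHilbert.inner_toCompl]
  change ι (tensorInner w (x ⊗ₜ[ℂ] y)) * ι (a ⊗ₜ[ℂ] b) = ι (tensorInner w (act x a ⊗ₜ[ℂ] act y b))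
  rw [← map_mul, ← tensorInner_act]
  rfl

variable [CompleteSpace E] [CompleteSpace F]

theorem norm_toCompl_tensorMap_le (S : adjointable E) (T : adjointable F) (z : E ⊗[ℂ] F) :
    ‖(preTensor E F ι hι).toCompl (tensorMap S T z)‖
      ≤ ‖S‖ * ‖T‖ * ‖(preTensor E F ι hι).toCompl z‖ := by
  refine (abs_le_of_sq_le_sq' ?_ (by positivity)).2
  rw [mul_pow, preTensor_norm_sq, preTensor_norm_sq]
  exact norm_tensorInner_tensorMap_le ι S T z

/-- The operator `S ⊗ T` on the exterior tensor product. -/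
def tensorOp (S : adjointable E) (T : adjointable F) :
    adjointable (preTensor E F ι hι).Compl :=
  ((preTensor E F ι hι).exists_adjointable (tensorMap S T) (tensorMap (star S) (star T))
    (fun z w => congrArg ι (tensorInner_tensorMap S T z w))
    (norm_toCompl_tensorMap_le ι hι S T)
    (norm_toCompl_tensorMap_le ι hι (star S) (star T))).choose

theorem tensorOp_toCompl (S : adjointable E) (T : adjointable F) (z : E ⊗[ℂ] F) :
    (tensorOp ι hι S T).1 ((preTensor E F ι hι).toCompl z) =
      (preTensor E F ι hι).toCompl (tensorMap S T z) :=
  ((preTensor E F ι hι).exists_adjointable (tensorMap S T) (tensorMap (star S) (star T))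
    (fun z w => congrArg ι (tensorInner_tensorMap S T z w))
    (norm_toCompl_tensorMap_le ι hι S T)
    (norm_toCompl_tensorMap_le ι hι (star S) (star T))).choose_spec z

theorem norm_adjointable_le {A E : Type*} [NonUnitalCStarAlgebra A] [NormedAddCommGroup E]
    [NormedSpace ℂ E] [HilbertModule A E] (T : adjointable E) {C : ℝ} (hC : 0 ≤ C) {s : Set E}
    (hs : Dense s) (h : ∀ x ∈ s, ‖T.1 x‖ ≤ C * ‖x‖) : ‖T‖ ≤ C :=
  ContinuousLinearMap.opNorm_le_bound T.1 hC fun x =>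
    hs.induction h (isClosed_le (by fun_prop) (by fun_prop)) x

theorem norm_adjointable_apply_le {A E : Type*} [NonUnitalCStarAlgebra A] [NormedAddCommGroup E]
    [NormedSpace ℂ E] [HilbertModule A E] (T : adjointable E) (x : E) : ‖T.1 x‖ ≤ ‖T‖ * ‖x‖ :=
  T.1.le_opNorm x

theorem tensorOp_mul (S S' : adjointable E) (T T' : adjointable F) :
    tensorOp ι hι (S * S') (T * T') = tensorOp ι hι S T * tensorOp ι hι S' T' :=
  PreHilbert.adjointable_ext _ fun z => by
    change _ = (tensorOp ι hι S T).1 ((tensorOp ι hι S' T').1 _)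
    simp only [tensorOp_toCompl, tensorMap_mul]

theorem star_tensorOp (S : adjointable E) (T : adjointable F) :
    star (tensorOp ι hι S T) = tensorOp ι hι (star S) (star T) := by
  refine star_eq_of_isAdjoint fun z w => ?_
  refine (preTensor E F ι hι).denseRange_toCompl.induction_on₂
    (p := fun z w => (inner ((tensorOp ι hι S T).1 z) w : D) =
      inner z ((tensorOp ι hι (star S) (star T)).1 w))
    (isClosed_eq (by fun_prop) (by fun_prop)) (fun z w => ?_) z w
  rw [tensorOp_toCompl, tensorOp_toCompl, PreHilbert.inner_toCompl, PreHilbert.inner_toCompl]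
  exact congrArg ι (tensorInner_tensorMap S T z w)

theorem tensorOp_tmul (S : adjointable E) (T : adjointable F) (x : E) (y : F) :
    (tensorOp ι hι S T).1 ((preTensor E F ι hι).toCompl (x ⊗ₜ[ℂ] y)) =
      (preTensor E F ι hι).toCompl (S.1 x ⊗ₜ[ℂ] T.1 y) := by
  rw [tensorOp_toCompl, tensorMap_tmul]

/-- This is why `𝒦(E) ⊙ 𝒦(F)` acts on the exterior tensor product by compact operators, and why its
image is dense in them. -/
theorem tensorOp_theta (x x' : E) (y y' : F) :
    tensorOp ι hι (theta x x') (theta y y') =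
      theta ((preTensor E F ι hι).toCompl (x ⊗ₜ[ℂ] y))
        ((preTensor E F ι hι).toCompl (x' ⊗ₜ[ℂ] y')) := by
  refine PreHilbert.adjointable_ext _ fun z => ?_
  induction z with
  | zero => rw [map_zero, map_zero, map_zero]
  | add z w hz hw => simp only [map_add, hz, hw]
  | tmul v w =>
    rw [tensorOp_tmul, theta_apply, theta_apply, theta_apply, PreHilbert.inner_toCompl,
      ← act_toCompl_tmul]
    rfl

variable {K L : Type*} [NonUnitalCStarAlgebra K] [NonUnitalCStarAlgebra L]
  (σ : K →⋆ₙₐ[ℂ] adjointable E) (τ : L →⋆ₙₐ[ℂ] adjointable F)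

/-- The operators `σ(k) ⊗ τ(l)`, as a bilinear map. -/
def tensorOpₗ : K →ₗ[ℂ] L →ₗ[ℂ] adjointable (preTensor E F ι hι).Compl :=
  LinearMap.mk₂ ℂ (fun k l => tensorOp ι hι (σ k) (τ l))
    (fun k k' l => PreHilbert.adjointable_ext _ fun z => by
      change _ = (tensorOp ι hι (σ k) (τ l)).1 _ + (tensorOp ι hι (σ k') (τ l)).1 _
      rw [tensorOp_toCompl, tensorOp_toCompl, tensorOp_toCompl, map_add, tensorMap_add_left,
        map_add])
    (fun c k l => PreHilbert.adjointable_ext _ fun z => by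
      change _ = c • (tensorOp ι hι (σ k) (τ l)).1 _
      rw [tensorOp_toCompl, tensorOp_toCompl, map_smul, tensorMap_smul_left, map_smul])
    (fun k l l' => PreHilbert.adjointable_ext _ fun z => by
      change _ = (tensorOp ι hι (σ k) (τ l)).1 _ + (tensorOp ι hι (σ k) (τ l')).1 _
      rw [tensorOp_toCompl, tensorOp_toCompl, tensorOp_toCompl, map_add, tensorMap_add_right,
        map_add])
    (fun c k l => PreHilbert.adjointable_ext _ fun z => by
      change _ = c • (tensorOp ι hι (σ k) (τ l)).1 _
      rw [tensorOp_toCompl, tensorOp_toCompl, map_smul, tensorMap_smul_right, map_smul])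

/-- The representation of `K ⊙ L` on an exterior tensor product of Hilbert modules on which `K` and
`L` act. -/
def tensorRep : K ⊗[ℂ] L →⋆ₙₐ[ℂ] adjointable (preTensor E F ι hι).Compl :=
  tensorLiftStar (tensorOpₗ ι hι σ τ)
    (fun k k' l l' => by
      change tensorOp ι hι (σ (k * k')) (τ (l * l')) = tensorOp ι hι _ _ * tensorOp ι hι _ _
      rw [map_mul, map_mul, tensorOp_mul])
    (fun k l => by
      change tensorOp ι hι (σ (star k)) (τ (star l)) = star (tensorOp ι hι (σ k) (τ l))
      rw [star_tensorOp, map_star, map_star])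

theorem tensorRep_tmul (k : K) (l : L) :
    tensorRep ι hι σ τ (k ⊗ₜ[ℂ] l) = tensorOp ι hι (σ k) (τ l) := rfl

theorem tensorRep_toCompl (c : K ⊗[ℂ] L) (z : E ⊗[ℂ] F) :
    (tensorRep ι hι σ τ c).1 ((preTensor E F ι hι).toCompl z) =
      (preTensor E F ι hι).toCompl (tensorAct σ τ c z) := by
  induction c with
  | zero => rw [map_zero, map_zero, LinearMap.zero_apply, map_zero]; rfl
  | add c c' h h' =>
    rw [map_add, map_add, LinearMap.add_apply, map_add, ← h, ← h']; rfl
  | tmul k l => rw [tensorRep_tmul, tensorAct_tmul, tensorOp_toCompl]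

/-- The representation of `K ⊙ L` is faithful if `K` and `L` act faithfully. -/
theorem tensorRep_injective (hinj : ∀ c, ι c = 0 → c = 0) (hσ : Function.Injective σ)
    (hτ : Function.Injective τ) (c : K ⊗[ℂ] L) (hc : tensorRep ι hι σ τ c = 0) : c = 0 := by
  -- Matrix coefficients separate the points of `K` and of `L`. Their tensor products are, up to
  -- `ι`, the matrix coefficients of the tensor representation at elementary tensors, so injectivity
  -- of `ι` finishes the argument.
  let u : E × E → K →ₗ[ℂ] A := fun p =>
    { toFun := fun k => inner p.1 ((σ k).1 p.2)
      map_add' := fun k k' => by rw [map_add]; exact inner_add _ _ _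
      map_smul' := fun c k => by rw [map_smul]; exact inner_smul _ _ _ }
  let w : F × F → L →ₗ[ℂ] B := fun p =>
    { toFun := fun k => inner p.1 ((τ k).1 p.2)
      map_add' := fun k k' => by rw [map_add]; exact inner_add _ _ _
      map_smul' := fun c k => by rw [map_smul]; exact inner_smul _ _ _ }
  have hu : ∀ k, (∀ p, u p k = 0) → k = 0 := fun k hk => by
    refine (map_eq_zero_iff σ hσ).1 (HilbertModule.adjointable_ext fun x => ?_)
    exact ext_inner fun z => (hk (z, x)).trans (HilbertModule.inner_zero_right z).symm
  have hw : ∀ k, (∀ p, w p k = 0) → k = 0 := fun k hk => by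
    refine (map_eq_zero_iff τ hτ).1 (HilbertModule.adjointable_ext fun x => ?_)
    exact ext_inner fun z => (hk (z, x)).trans (HilbertModule.inner_zero_right z).symm
  refine TensorProduct.eq_zero_of_map u hu w hw c fun p p' => ?_
  have h1 : ∀ c : K ⊗[ℂ] L, TensorProduct.map (u p) (w p') c =
      tensorInner (p.1 ⊗ₜ[ℂ] p'.1) (tensorAct σ τ c (p.2 ⊗ₜ[ℂ] p'.2)) := fun c => by
    induction c with
    | zero => simp
    | add c c' h h' => simp [h, h']
    | tmul k l => rfl
  refine hinj _ ?_
  rw [h1]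
  have h2 := tensorRep_toCompl ι hι σ τ c (p.2 ⊗ₜ[ℂ] p'.2)
  rw [hc] at h2
  have h3 := PreHilbert.inner_toCompl (preTensor E F ι hι) (p.1 ⊗ₜ[ℂ] p'.1)
    (tensorAct σ τ c (p.2 ⊗ₜ[ℂ] p'.2))
  rw [← h2] at h3
  exact h3.symm.trans (HilbertModule.inner_zero_right _)

theorem tensorRep_isCStarNorm (hinj : ∀ c, ι c = 0 → c = 0) (hσ : Function.Injective σ)
    (hτ : Function.Injective τ) : IsCStarNorm fun c : K ⊗[ℂ] L => ‖tensorRep ι hι σ τ c‖ where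
  add_le x y := by rw [map_add]; exact norm_add_le _ _
  smul c x := by rw [map_smul, norm_smul]
  eq_zero x hx := tensorRep_injective ι hι σ τ hinj hσ hτ x (norm_eq_zero.1 hx)
  mul_le x y := by rw [map_mul]; exact norm_mul_le _ _
  star_mul_self x := by rw [map_mul, map_star, CStarRing.norm_star_mul_self, sq]

/-- A larger norm on `A ⊙ B` gives a larger norm on `K ⊙ L`. -/
theorem norm_tensorRep_mono {D' : Type*} [NonUnitalCStarAlgebra D'] (ι' : A ⊗[ℂ] B →⋆ₙₐ[ℂ] D')
    (hι' : DenseRange ι') (h : ∀ c, ‖ι c‖ ≤ ‖ι' c‖) (c : K ⊗[ℂ] L) :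
    ‖tensorRep ι hι σ τ c‖ ≤ ‖tensorRep ι' hι' σ τ c‖ := by
  -- As `ι'` dominates `ι`, there is a `*`-homomorphism `φ : D' → D` with `φ ∘ ι' = ι`. The operator
  -- bound over `D'`, written as the inequality `⟨T Z, T Z⟩ ≤ ‖T‖² ⟨Z, Z⟩` of elements of `D'`, is
  -- carried by `φ` to the same inequality in `D`.
  obtain ⟨φ, hφ⟩ := exists_starHom_extension ι' hι' ι h
  refine norm_adjointable_le _ (norm_nonneg _) (preTensor E F ι hι).denseRange_toCompl ?_
  rintro _ ⟨z, rfl⟩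
  set T := tensorRep ι' hι' σ τ c with hT
  obtain ⟨m, hm⟩ := CStarAlgebra.exists_norm_sq_sub T
  have h1 : IsPos (((‖T‖ ^ 2 : ℝ) : ℂ) • ι' (tensorInner z z)
      - ι' (tensorInner (tensorAct σ τ c z) (tensorAct σ τ c z))) := by
    let Z := (preTensor E F ι' hι').toCompl z
    have e1 : (inner (m.1 Z) (m.1 Z) : D') =
        ((‖T‖ ^ 2 : ℝ) : ℂ) • inner Z Z - inner (T.1 Z) (T.1 Z) := by
      rw [isAdjoint_star m, isAdjoint_star T, ← inner_smul, ← inner_sub]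
      refine congrArg (inner Z) ?_
      exact (congrArg (fun S : adjointable (preTensor E F ι' hι').Compl => S.1 Z) hm).symm
    have e2 := inner_self_pos (A := D') (m.1 Z)
    rwa [e1, hT, tensorRep_toCompl, PreHilbert.inner_toCompl, PreHilbert.inner_toCompl] at e2
  have h2 := h1.map φ
  rw [map_sub, map_smul, hφ, hφ] at h2
  have h3 := IsPos.norm_le_of_sub (tensorInner_self_pos ι (tensorAct σ τ c z)) h2
  rw [norm_smul, Complex.norm_real, Real.norm_of_nonneg (by positivity)] at h3
  rw [tensorRep_toCompl]
  refine (abs_le_of_sq_le_sq' ?_ (by positivity)).2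
  rw [mul_pow, preTensor_norm_sq, preTensor_norm_sq]
  exact h3

end TensorOp


open HilbertModule

/-! ### Density arguments and completions of tensor products -/

section BilinearDensity

/-- A closed submodule that contains `β(s, t)` for `s` and `t` in sets with dense span contains all
values of the separately continuous bilinear map `β`. -/
theorem mem_of_dense_span {V W U : Type*} [AddCommGroup V] [Module ℂ V] [TopologicalSpace V]
    [AddCommGroup W] [Module ℂ W] [TopologicalSpace W] [AddCommGroup U] [Module ℂ U]
    [TopologicalSpace U] (β : V →ₗ[ℂ] W →ₗ[ℂ] U) (h₁ : ∀ w, Continuous fun v => β v w)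
    (h₂ : ∀ v, Continuous fun w => β v w) {S : Set V} {S' : Set W}
    (hS : Dense (Submodule.span ℂ S : Set V)) (hS' : Dense (Submodule.span ℂ S' : Set W))
    (M : Submodule ℂ U) (hM : IsClosed (M : Set U)) (h : ∀ s ∈ S, ∀ t ∈ S', β s t ∈ M)
    (v : V) (w : W) : β v w ∈ M := by
  have key : ∀ t ∈ S', ∀ v, β v t ∈ M := fun t ht v => by
    refine hS.induction (P := fun v => β v t ∈ M) (fun v hv => ?_) (hM.preimage (h₁ t)) v
    have : Submodule.span ℂ S ≤ M.comap (β.flip t) :=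
      Submodule.span_le.2 fun s hs => h s hs t ht
    exact this hv
  refine hS'.induction (P := fun w => β v w ∈ M) (fun w hw => ?_) (hM.preimage (h₂ v)) w
  have : Submodule.span ℂ S' ≤ M.comap (β v) := Submodule.span_le.2 fun t ht => key t ht v
  exact this hw

variable {K L D : Type*} [NonUnitalCStarAlgebra K] [NonUnitalCStarAlgebra L]
  [NonUnitalCStarAlgebra D]

/-- No continuity of `ι` has to be assumed: `norm_map_tmul_le` makes `(k, l) ↦ ι(k ⊗ l)` jointly
continuous. -/
theorem map_mem_of_dense_span (ι : K ⊗[ℂ] L →⋆ₙₐ[ℂ] D) {S : Set K} {S' : Set L}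
    (hS : Dense (Submodule.span ℂ S : Set K)) (hS' : Dense (Submodule.span ℂ S' : Set L))
    (M : Submodule ℂ D) (hM : IsClosed (M : Set D)) (h : ∀ s ∈ S, ∀ t ∈ S', ι (s ⊗ₜ[ℂ] t) ∈ M)
    (c : K ⊗[ℂ] L) : ι c ∈ M := by
  let e : K ⊗[ℂ] L →ₗ[ℂ] D := { toFun := ι, map_add' := map_add ι, map_smul' := map_smul ι }
  let β := (TensorProduct.mk ℂ K L).compr₂ e
  have hβ : ∀ k l, ‖β k l‖ ≤ 1 * ‖k‖ * ‖l‖ := fun k l => by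
    rw [one_mul]; exact norm_map_tmul_le ι k l
  let g := LinearMap.mkContinuous₂ β 1 hβ
  have hg : Continuous fun p : K × L => β p.1 p.2 :=
    (g.continuous.comp continuous_fst).clm_apply continuous_snd
  induction c with
  | zero => rw [map_zero]; exact M.zero_mem
  | add c c' hc hc' => rw [map_add]; exact M.add_mem hc hc'
  | tmul k l =>
    exact mem_of_dense_span β (fun l => hg.comp (continuous_id.prodMk continuous_const))
      (fun k => hg.comp (continuous_const.prodMk continuous_id)) hS hS' M hM h k l

end BilinearDensity

namespace IsCStarNorm

variable {A B : Type*} [NonUnitalCStarAlgebra A] [NonUnitalCStarAlgebra B] {p : A ⊗[ℂ] B → ℝ}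
  (hp : IsCStarNorm p)

/-- The canonical map `A ⊙ B → A ⊗_p B` as a `*`-homomorphism. -/
def toComplHom : A ⊗[ℂ] B →⋆ₙₐ[ℂ] hp.Compl where
  toFun := hp.toCompl
  map_smul' c x := Completion.coe_smul (X := hp.Carrier) c x
  map_zero' := rfl
  map_add' x y := Completion.coe_add (α := hp.Carrier) x y
  map_mul' x y := (complMul_coe (R := hp.Carrier) x y).symm
  map_star' x := (complStar_coe (R := hp.Carrier) x).symm

theorem norm_toComplHom (x : A ⊗[ℂ] B) : ‖hp.toComplHom x‖ = p x :=
  Completion.norm_coe (E := hp.Carrier) x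

theorem denseRange_toComplHom : DenseRange hp.toComplHom :=
  Completion.denseRange_coe (α := hp.Carrier)

theorem toComplHom_injective (x : A ⊗[ℂ] B) (hx : hp.toComplHom x = 0) : x = 0 :=
  hp.eq_zero x (by rw [← hp.norm_toComplHom, hx, norm_zero])

end IsCStarNorm

/-! ### The conjugate module over the compact operators -/

section Conjugate

/-- The conjugate of a complex vector space. -/
def ConjModule (E : Type*) : Type _ := E

variable {A E : Type*} [NonUnitalCStarAlgebra A] [NormedAddCommGroup E] [NormedSpace ℂ E]

instance : NormedAddCommGroup (ConjModule E) := inferInstanceAs (NormedAddCommGroup E)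

instance : Module ℂ (ConjModule E) := Module.compHom E (starRingEnd ℂ)

instance : NormedSpace ℂ (ConjModule E) where
  norm_smul_le c x :=
    ((norm_smul (β := E) (starRingEnd ℂ c) x).trans (by rw [RCLike.norm_conj]; rfl)).le

instance [CompleteSpace E] : CompleteSpace (ConjModule E) := inferInstanceAs (CompleteSpace E)

variable (E) in
/-- The conjugate-linear identity `E → Ē`. -/
def toConj : E →ₗ⋆[ℂ] ConjModule E where
  toFun x := x
  map_add' _ _ := rfl
  map_smul' c x := by
    change c • x = starRingEnd ℂ (starRingEnd ℂ c) • x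
    rw [starRingEnd_self_apply]

variable [HilbertModule A E] [CompleteSpace E]

theorem HilbertModule.Compacts.norm_thetaK_self (x : E) : ‖thetaK x x‖ = ‖x‖ ^ 2 :=
  norm_theta_self x

/-- `Ē` is a right Hilbert module over `𝒦(E)`, with `x̄ k = (k* x)‾` and `⟨x̄, ȳ⟩ = θ_{x,y}`. -/
instance : HilbertModule (Compacts E) (ConjModule E) where
  act x k := toConj E ((star k).app x)
  inner x y := thetaK (E := E) x y
  add_act x y k := (star k).1.1.map_add x y
  act_add x k l := by rw [star_add]; rfl
  act_mul x k l := by rw [star_mul]; rfl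
  smul_act c x k := (star k).1.1.map_smul (starRingEnd ℂ c) x
  act_smul c x k := by rw [star_smul]; rfl
  inner_add x y z := Compacts.incl_injective (theta_add_right (E := E) x y z)
  inner_smul c x y := Compacts.incl_injective ((theta_smul_right (E := E) (starRingEnd ℂ c) x y).trans
    (by rw [← starRingEnd_apply, starRingEnd_self_apply]; rfl))
  inner_act x y k := by
    refine Compacts.incl_injective ?_
    exact (theta_mul (E := E) k.1 x y).symm
  star_inner x y := Compacts.star_thetaK (E := E) x y
  inner_self_pos x := Compacts.isPos_thetaK (E := E) x
  norm_sq x := (Compacts.norm_thetaK_self (E := E) x).symm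

theorem ConjModule.act_eq (x : E) (k : Compacts E) :
    act (toConj E x) k = toConj E ((star k).app x) := rfl

variable (E) in
/-- The action of `A` on `Ē`, `a x̄ = (x a*)‾`. -/
def conjRep : A →⋆ₙₐ[ℂ] adjointable (ConjModule E) :=
  let T (a : A) : ConjModule E →L[ℂ] ConjModule E := LinearMap.mkContinuous
    { toFun := fun x : E => toConj E (act x (star a))
      map_add' := fun x y : E => add_act x y (star a)
      map_smul' := fun c (x : E) => smul_act (starRingEnd ℂ c) x (star a) } ‖a‖ fun x => by
        refine (norm_act_le (E := E) x (star a)).trans_eq ?_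
        rw [norm_star, mul_comm]
        rfl
  -- In terms of rank one operators this is `θ_{x a*, y} = θ_{x, y a}`.
  have hT : ∀ a, IsAdjoint (ConjModule E) (T a) (T (star a)) := fun a (x y : E) =>
    Compacts.incl_injective <| HilbertModule.adjointable_ext fun (z : E) => by
      change act (act x (star a)) (inner y z) =
        act x (inner (act y (star (star a))) z)
      rw [act_inner, star_star, act_mul]
  { toFun := fun a => ⟨T a, T (star a), hT a⟩
    map_smul' := fun c a => HilbertModule.adjointable_ext fun (x : E) => by
      change act x (star (c • a)) = starRingEnd ℂ c • act x (star a)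
      rw [star_smul, act_smul]
      rfl
    map_zero' := HilbertModule.adjointable_ext fun (x : E) => by
      change act x (star 0) = 0
      rw [star_zero]
      simpa using act_smul (0 : ℂ) x (0 : A)
    map_add' := fun a b => HilbertModule.adjointable_ext fun (x : E) => by
      change act x (star (a + b)) = act x (star a) + act x (star b)
      rw [star_add, act_add]
    map_mul' := fun a b => HilbertModule.adjointable_ext fun (x : E) => by
      change act x (star (a * b)) = act (act x (star b)) (star a)
      rw [star_mul, act_mul]
    map_star' := fun a => (star_eq_of_isAdjoint (hT a)).symm }

theorem conjRep_apply (a : A) (x : E) :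
    (conjRep E a).1 (toConj E x) = toConj E (act x (star a)) := rfl

/-- This is the compatibility `z ⟨y, x⟩ = θ_{z,y} x` of the two inner products of an imprimitivity
bimodule, read in `Ē`. -/
theorem conjRep_inner (x y : E) : conjRep E (inner x y) = theta (toConj E x) (toConj E y) :=
  HilbertModule.adjointable_ext fun (z : E) => by
    change act z (star (inner x y : A)) = (star (thetaK y z)).app x
    rw [Compacts.star_thetaK, star_inner]
    rfl

/-- No nonzero element of `A` annihilates `E`. -/
def HilbertModule.IsFaithful (A E : Type*) [NonUnitalCStarAlgebra A] [NormedAddCommGroup E]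
    [NormedSpace ℂ E] [HilbertModule A E] : Prop :=
  ∀ a : A, (∀ x : E, act x a = 0) → a = 0

theorem conjRep_injective (h : HilbertModule.IsFaithful A E) : Function.Injective (conjRep E) := by
  refine (injective_iff_map_eq_zero _).2 fun a ha => ?_
  rw [← star_eq_zero]
  refine h _ fun x => ?_
  exact (conjRep_apply a x).symm.trans (by rw [ha]; rfl)

/-- An injective `*`-homomorphism of C⋆-algebras is isometric. Applied to `conjRep` it shows that
the norm of an element equals the norm of right multiplication by it on a faithful module, and the
latter can be estimated on a dense set. -/
theorem norm_le_of_norm_act_le (h : HilbertModule.IsFaithful A E) {a : A} {M : ℝ} (hM : 0 ≤ M)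
    {s : Set E} (hs : Dense s) (ha : ∀ x ∈ s, ‖act x a‖ ≤ M * ‖x‖) : ‖a‖ ≤ M := by
  rw [← norm_star, ← NonUnitalStarAlgHom.norm_map (conjRep E) (conjRep_injective h)]
  refine norm_adjointable_le _ hM (s := (s : Set E)) hs fun (x : E) hx => ?_
  change ‖act x (star (star a))‖ ≤ M * ‖x‖
  rw [star_star]
  exact ha x hx

end Conjugate


open HilbertModule

/-! ### Induction of C⋆-norms between `A ⊙ B` and `𝒦(E) ⊙ 𝒦(F)` -/

section Induced

variable {A B E F : Type*} [NonUnitalCStarAlgebra A] [NonUnitalCStarAlgebra B]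
  [NormedAddCommGroup E] [NormedSpace ℂ E] [NormedAddCommGroup F]
  [NormedSpace ℂ F] [HilbertModule A E] [HilbertModule B F]

variable (E F) in
/-- The conjugation `E ⊙ F → Ē ⊙ F̄`. -/
def conjTensor : E ⊗[ℂ] F →ₗ⋆[ℂ] ConjModule E ⊗[ℂ] ConjModule F :=
  TensorProduct.map (toConj E) (toConj F)

theorem conjTensor_surjective : Function.Surjective (conjTensor E F) := by
  intro z
  induction z with
  | zero => exact ⟨0, map_zero _⟩
  | add z w hz hw =>
    obtain ⟨z, rfl⟩ := hz
    obtain ⟨w, rfl⟩ := hw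
    exact ⟨z + w, map_add _ _ _⟩
  | tmul x y => exact ⟨(show E from x) ⊗ₜ[ℂ] (show F from y), rfl⟩

variable [CompleteSpace E] [CompleteSpace F]

variable {D : Type*} [NonUnitalCStarAlgebra D] (ι : Compacts E ⊗[ℂ] Compacts F →⋆ₙₐ[ℂ] D)
  (hι : DenseRange ι)

/-- The exterior tensor product of `Ē` and `F̄` for `ι : 𝒦(E) ⊙ 𝒦(F) → D`. -/
abbrev conjPreTensor : PreHilbert D (ConjModule E ⊗[ℂ] ConjModule F) :=
  preTensor (ConjModule E) (ConjModule F) ι hι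

/-- The action of `A ⊙ B` on the exterior tensor product of `Ē` and `F̄`. -/
abbrev conjTensorRep : A ⊗[ℂ] B →⋆ₙₐ[ℂ] adjointable (conjPreTensor ι hι).Compl :=
  tensorRep ι hι (conjRep E) (conjRep F)

/-- With `norm_theta_self` this turns the norm of `⟨z, z⟩` in the representation on `Ē ⊗ F̄` into
the squared norm of the conjugate of `z`, so conjugation becomes isometric once `A ⊙ B` carries that
norm. -/
theorem conjTensorRep_tensorInner (z w : E ⊗[ℂ] F) :
    conjTensorRep ι hι (tensorInner z w) =
      theta ((conjPreTensor ι hι).toCompl (conjTensor E F z))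
        ((conjPreTensor ι hι).toCompl (conjTensor E F w)) := by
  have theta_zero_left : ∀ W : (conjPreTensor ι hι).Compl, theta 0 W = 0 := fun W =>
    HilbertModule.adjointable_ext fun _ => zero_act _
  induction z with
  | zero =>
    rw [map_zero, LinearMap.zero_apply, map_zero, map_zero, map_zero, theta_zero_left]
  | add z z' hz hz' =>
    rw [map_add, LinearMap.add_apply, map_add, hz, hz', map_add, map_add, theta_add_left]
  | tmul x y =>
    induction w with
    | zero =>
      rw [map_zero, map_zero, map_zero, map_zero, ← star_theta, theta_zero_left, star_zero]
    | add w w' hw hw' => rw [map_add, map_add, hw, hw', map_add, map_add, theta_add_right]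
    | tmul x' y' =>
      exact (congrArg₂ (tensorOp ι hι) (conjRep_inner x x') (conjRep_inner y y')).trans
        (tensorOp_theta ι hι _ _ _ _)

/-- Under conjugation the left action of the compacts on `E ⊙ F` becomes the right action by
adjoints, which is how `Ē` and `F̄` were made Hilbert modules. -/
theorem toCompl_conjTensor_tensorAct (c : Compacts E ⊗[ℂ] Compacts F) (z : E ⊗[ℂ] F) :
    (conjPreTensor ι hι).toCompl
        (conjTensor E F (tensorAct (Compacts.incl E) (Compacts.incl F) c z)) =
      act ((conjPreTensor ι hι).toCompl (conjTensor E F z)) (ι (star c)) := by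
  have act_zero : ∀ Z : (conjPreTensor ι hι).Compl, act Z (0 : D) = 0 := fun Z => by
    simpa using act_smul (0 : ℂ) Z (0 : D)
  induction c with
  | zero => rw [map_zero, star_zero, map_zero, act_zero, LinearMap.zero_apply, map_zero, map_zero]
  | add c c' h h' =>
    rw [map_add, LinearMap.add_apply, map_add, map_add, h, h', star_add, map_add, act_add]
  | tmul k l =>
    induction z with
    | zero => simp only [map_zero, zero_act]
    | add z z' h h' => simp only [map_add, add_act, h, h']
    | tmul x y =>
      refine Eq.trans ?_ (act_toCompl_tmul ι hι (toConj E x) (toConj F y) (star k) (star l)).symm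
      rw [ConjModule.act_eq, ConjModule.act_eq, star_star, star_star]
      rfl

/-- Here nothing is assumed of `E` and `F`: the inner products of `Ē` are the operators `θ`, which
span a dense subspace of `𝒦(E)`. Hence an annihilating `d` satisfies `e d = 0` for all `e ∈ D`, in
particular for `e = d*`. -/
theorem isFaithful_conjPreTensor : HilbertModule.IsFaithful D (conjPreTensor ι hι).Compl := by
  intro d hd
  let M : Submodule ℂ D := LinearMap.ker (LinearMap.mulRight ℂ d)
  have hM : IsClosed (M : Set D) :=
    isClosed_eq (continuous_id.mul continuous_const) continuous_const
  have h1 : ∀ c, ι c ∈ M := by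
    refine map_mem_of_dense_span ι (Compacts.dense_span_thetaK E)
      (Compacts.dense_span_thetaK F) M hM ?_
    rintro _ ⟨x, x', rfl⟩ _ ⟨y, y', rfl⟩
    have h := inner_act ((conjPreTensor ι hι).toCompl (toConj E x ⊗ₜ[ℂ] toConj F y))
      ((conjPreTensor ι hι).toCompl (toConj E x' ⊗ₜ[ℂ] toConj F y')) d
    rw [hd, HilbertModule.inner_zero_right, PreHilbert.inner_toCompl] at h
    exact h.symm
  have h2 : star d ∈ M := hι.induction_on (p := fun e => e ∈ M) (star d) hM h1
  exact (CStarRing.star_mul_self_eq_zero_iff d).1 h2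

/-- The norm on `A ⊙ B` given by `Ē ⊗ F̄` induces the original norm on `𝒦(E) ⊙ 𝒦(F)`. -/
theorem norm_tensorRep_of_norm_eq {D' : Type*} [NonUnitalCStarAlgebra D']
    (ι' : A ⊗[ℂ] B →⋆ₙₐ[ℂ] D') (hι' : DenseRange ι') (h : ∀ c, ‖ι' c‖ = ‖conjTensorRep ι hι c‖)
    (c : Compacts E ⊗[ℂ] Compacts F) :
    ‖tensorRep ι' hι' (Compacts.incl E) (Compacts.incl F) c‖ = ‖ι c‖ := by
  let P := preTensor E F ι' hι'
  let U := fun z => (conjPreTensor ι hι).toCompl (conjTensor E F z)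
  have hU : Dense (Set.range U) := by
    rw [Set.range_comp' (conjPreTensor ι hι).toCompl, conjTensor_surjective.range_eq,
      Set.image_univ]
    exact (conjPreTensor ι hι).denseRange_toCompl
  have hnorm : ∀ z, ‖P.toCompl z‖ = ‖U z‖ := fun z => by
    rw [← sq_eq_sq₀ (norm_nonneg _) (norm_nonneg _), preTensor_norm_sq, ← norm_theta_self,
      ← conjTensorRep_tensorInner, h]
  -- Via the isometry `P.toCompl z ↦ U z` the operator of `c` is right multiplication by `ι(c*)`.
  -- Its norm is at most `‖ι(c*)‖` in any module, and at least that because the module is faithful.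
  have hact : ∀ z, ‖(tensorRep ι' hι' (Compacts.incl E) (Compacts.incl F) c).1 (P.toCompl z)‖ =
      ‖act (U z) (ι (star c))‖ := fun z => by
    rw [tensorRep_toCompl, hnorm, ← toCompl_conjTensor_tensorAct]
  have hstar : ‖ι (star c)‖ = ‖ι c‖ := by rw [map_star, norm_star]
  refine le_antisymm ?_ ?_
  · refine norm_adjointable_le _ (norm_nonneg _) P.denseRange_toCompl ?_
    rintro _ ⟨z, rfl⟩
    rw [hact, hnorm, mul_comm, ← hstar]
    exact norm_act_le _ _
  · rw [← hstar]
    refine norm_le_of_norm_act_le (isFaithful_conjPreTensor ι hι) (norm_nonneg _) hU ?_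
    rintro _ ⟨z, rfl⟩
    rw [← hact, ← hnorm]
    exact norm_adjointable_apply_le _ _

/-- Every C⋆-norm on `𝒦(E) ⊙ 𝒦(F)` is induced by a C⋆-norm on `A ⊙ B`. -/
theorem exists_inducing_norm (hE : HilbertModule.IsFaithful A E) (hF : HilbertModule.IsFaithful B F)
    {q : Compacts E ⊗[ℂ] Compacts F → ℝ} (hq : IsCStarNorm q) :
    ∃ (p : A ⊗[ℂ] B → ℝ) (hp : IsCStarNorm p), ∀ c,
      ‖tensorRep hp.toComplHom hp.denseRange_toComplHom (Compacts.incl E) (Compacts.incl F) c‖ =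
        q c := by
  -- The norm `p` is that of the action of `A ⊙ B` on `Ē ⊗_q F̄`. Faithfulness of `E` and `F` makes
  -- `A` and `B` act faithfully on the conjugates, so that `p` vanishes only at zero.
  obtain ⟨p, hp, hpc⟩ : ∃ (p : A ⊗[ℂ] B → ℝ) (_ : IsCStarNorm p), ∀ c,
      p c = ‖conjTensorRep (E := E) (F := F) hq.toComplHom hq.denseRange_toComplHom c‖ :=
    ⟨_, tensorRep_isCStarNorm _ _ _ _ hq.toComplHom_injective (conjRep_injective hE)
      (conjRep_injective hF), fun _ => rfl⟩
  refine ⟨p, hp, fun c => ?_⟩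
  refine (norm_tensorRep_of_norm_eq hq.toComplHom hq.denseRange_toComplHom hp.toComplHom
    hp.denseRange_toComplHom (fun c => ?_) c).trans (hq.norm_toComplHom c)
  exact (hp.norm_toComplHom c).trans (hpc c)

/-- The operators on `E ⊗_α F` induce the norm `α` on `𝒦(E) ⊙ 𝒦(F)`. -/
theorem tensorRep_isNorm {D : Type*} [NonUnitalCStarAlgebra D] (ι : A ⊗[ℂ] B →⋆ₙₐ[ℂ] D)
    (hι : DenseRange ι) (α : TensorKind) (hα : α.IsNorm fun c => ‖ι c‖)
    (hE : HilbertModule.IsFaithful A E) (hF : HilbertModule.IsFaithful B F) :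
    α.IsNorm fun c : Compacts E ⊗[ℂ] Compacts F =>
      ‖tensorRep ι hι (Compacts.incl E) (Compacts.incl F) c‖ := by
  have h : IsCStarNorm fun c : Compacts E ⊗[ℂ] Compacts F =>
      ‖tensorRep ι hι (Compacts.incl E) (Compacts.incl F) c‖ :=
    tensorRep_isCStarNorm _ _ _ _
      (fun c hc => hα.isCStarNorm.eq_zero c (by rw [hc, norm_zero]))
      Compacts.incl_injective Compacts.incl_injective
  cases α with
  | min =>
    refine ⟨h, fun q hq c => ?_⟩
    -- A competitor `q` is induced by some `p` on `A ⊙ B`; there `α` is extremal, and monotonicity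
    -- of induction transports the comparison with `p` to one with `q`.
    obtain ⟨p, hp, hpq⟩ := exists_inducing_norm hE hF hq
    rw [← hpq]
    refine norm_tensorRep_mono _ _ _ _ _ _ (fun c => ?_) c
    rw [hp.norm_toComplHom]
    exact hα.2 hp c
  | max =>
    refine ⟨h, fun q hq c => ?_⟩
    obtain ⟨p, hp, hpq⟩ := exists_inducing_norm hE hF hq
    rw [← hpq]
    refine norm_tensorRep_mono _ _ _ _ _ _ (fun c => ?_) c
    rw [hp.norm_toComplHom]
    exact hα.2 hp c

end Induced

/-! ### Transport of compact operators along isomorphisms -/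

section CompactsEquiv

variable {A E F : Type*} [NonUnitalCStarAlgebra A] [NormedAddCommGroup E] [NormedSpace ℂ E]
  [NormedAddCommGroup F] [NormedSpace ℂ F] [HilbertModule A E] [HilbertModule A F]

/-- An isomorphism of Hilbert modules as an isometric equivalence. -/
def HilbertModule.Iso.toLinearIsometryEquiv (j : HilbertModule.Iso E F) : E ≃ₗᵢ[ℂ] F :=
  ⟨j.toLinearEquiv, j.norm_map⟩

/-- Conjugation of adjointable operators by an isomorphism of Hilbert modules. -/
def HilbertModule.Iso.conjAdjointable (j : HilbertModule.Iso E F) :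
    adjointable E →⋆ₙₐ[ℂ] adjointable F :=
  let J := j.toLinearIsometryEquiv
  let c (T : E →L[ℂ] E) : F →L[ℂ] F :=
    (J.toContinuousLinearEquiv : E →L[ℂ] F).comp
      (T.comp (J.symm.toContinuousLinearEquiv : F →L[ℂ] E))
  have hc : ∀ T : adjointable E, IsAdjoint F (c T.1) (c (star T).1) := fun T x y => by
    obtain ⟨x, rfl⟩ := J.surjective x
    obtain ⟨y, rfl⟩ := J.surjective y
    change inner (J (T.1 (J.symm (J x)))) (J y) = inner (J x) (J ((star T).1 (J.symm (J y))))
    rw [J.symm_apply_apply, J.symm_apply_apply]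
    exact (j.inner_map _ _).trans ((isAdjoint_star T x y).trans (j.inner_map _ _).symm)
  { toFun := fun T => ⟨c T.1, c (star T).1, hc T⟩
    map_smul' := fun a T => HilbertModule.adjointable_ext fun x => map_smul J a _
    map_zero' := HilbertModule.adjointable_ext fun x => map_zero J
    map_add' := fun S T => HilbertModule.adjointable_ext fun x => map_add J _ _
    map_mul' := fun S T => HilbertModule.adjointable_ext fun x => by
      change J (S.1 (T.1 (J.symm x))) = J (S.1 (J.symm (J (T.1 (J.symm x)))))
      rw [J.symm_apply_apply]
    map_star' := fun T => (star_eq_of_isAdjoint (hc T)).symm }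

theorem HilbertModule.Iso.conjAdjointable_apply (j : HilbertModule.Iso E F) (T : adjointable E)
    (x : E) : (j.conjAdjointable T).1 (j.toLinearEquiv x) = j.toLinearEquiv (T.1 x) :=
  congrArg (fun y => j.toLinearEquiv (T.1 y)) (j.toLinearEquiv.symm_apply_apply x)

theorem HilbertModule.Iso.conjAdjointable_theta (j : HilbertModule.Iso E F) (x y : E) :
    j.conjAdjointable (theta x y) = theta (j.toLinearEquiv x) (j.toLinearEquiv y) :=
  HilbertModule.adjointable_ext fun z => by
    obtain ⟨z, rfl⟩ := j.toLinearEquiv.surjective z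
    rw [j.conjAdjointable_apply, theta_apply, theta_apply]
    exact (j.map_act x _).trans (congrArg _ (j.inner_map y z).symm)

theorem HilbertModule.Iso.conjAdjointable_injective (j : HilbertModule.Iso E F) :
    Function.Injective j.conjAdjointable := fun S T h =>
  HilbertModule.adjointable_ext fun x => j.toLinearEquiv.injective <| by
    rw [← j.conjAdjointable_apply, h, j.conjAdjointable_apply]

theorem HilbertModule.continuous_thetaK [CompleteSpace E] :
    Continuous fun p : E × E => thetaK p.1 p.2 := by
  -- The operator `θ_{x,y}` is linear in `x` and conjugate-linear in `y`, hence the exchange of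
  -- arguments.
  let f : E →ₗ⋆[ℂ] E →ₗ[ℂ] adjointable E :=
    LinearMap.mk₂'ₛₗ (starRingEnd ℂ) (RingHom.id ℂ) (fun x y => theta y x)
      (fun x x' y => theta_add_right y x x') (fun c x y => theta_smul_right c y x)
      (fun x y y' => theta_add_left y y' x) (fun c x y => theta_smul_left c y x)
  let g := LinearMap.mkContinuous₂ f 1 fun x y => by
    rw [one_mul, mul_comm]; exact norm_theta_le y x
  have : Continuous fun p : E × E => theta p.1 p.2 :=
    (g.continuous.comp continuous_snd).clm_apply continuous_fst
  exact this.subtype_mk _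

end CompactsEquiv

/-! ### Compact operators on an exterior tensor product -/

section TensorCompacts

variable {A B D E F Z : Type*} [NonUnitalCStarAlgebra A] [NonUnitalCStarAlgebra B]
  [NonUnitalCStarAlgebra D] [NormedAddCommGroup E] [NormedSpace ℂ E] [NormedAddCommGroup F]
  [NormedSpace ℂ F] [HilbertModule A E] [HilbertModule B F] [CompleteSpace E] [CompleteSpace F]
  [NormedAddCommGroup Z] [NormedSpace ℂ Z] [HilbertModule D Z]
  (ι : A ⊗[ℂ] B →⋆ₙₐ[ℂ] D) (hι : DenseRange ι)

/-- The action of `𝒦(E) ⊙ 𝒦(F)` on `Z ≅ E ⊗ F`. -/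
def tensorCompactsRep (j : HilbertModule.Iso (preTensor E F ι hι).Compl Z) :
    Compacts E ⊗[ℂ] Compacts F →⋆ₙₐ[ℂ] adjointable Z :=
  j.conjAdjointable.comp (tensorRep ι hι (Compacts.incl E) (Compacts.incl F))

theorem tensorCompactsRep_thetaK (j : HilbertModule.Iso (preTensor E F ι hι).Compl Z)
    (x x' : E) (y y' : F) :
    tensorCompactsRep ι hι j (thetaK x x' ⊗ₜ[ℂ] thetaK y y') =
      theta (j.toLinearEquiv ((preTensor E F ι hι).toCompl (x ⊗ₜ[ℂ] y)))
        (j.toLinearEquiv ((preTensor E F ι hι).toCompl (x' ⊗ₜ[ℂ] y'))) := by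
  change j.conjAdjointable (tensorOp ι hι (theta x x') (theta y y')) = _
  rw [tensorOp_theta, j.conjAdjointable_theta]

theorem tensorCompactsRep_apply (j : HilbertModule.Iso (preTensor E F ι hι).Compl Z)
    (k : Compacts E) (l : Compacts F) (x : E) (y : F) :
    (tensorCompactsRep ι hι j (k ⊗ₜ[ℂ] l)).1
        (j.toLinearEquiv ((preTensor E F ι hι).toCompl (x ⊗ₜ[ℂ] y))) =
      j.toLinearEquiv ((preTensor E F ι hι).toCompl (k.app x ⊗ₜ[ℂ] l.app y)) :=
  (j.conjAdjointable_apply _ _).trans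
    (congrArg j.toLinearEquiv (tensorOp_tmul ι hι k.1 l.1 x y))

variable [CompleteSpace Z]

theorem norm_tensorCompactsRep (j : HilbertModule.Iso (preTensor E F ι hι).Compl Z)
    (c : Compacts E ⊗[ℂ] Compacts F) : ‖tensorCompactsRep ι hι j c‖ =
      ‖tensorRep ι hι (Compacts.incl E) (Compacts.incl F) c‖ :=
  NonUnitalStarAlgHom.norm_map j.conjAdjointable j.conjAdjointable_injective _

theorem tensorCompactsRep_mem (j : HilbertModule.Iso (preTensor E F ι hι).Compl Z)
    (c : Compacts E ⊗[ℂ] Compacts F) : tensorCompactsRep ι hι j c ∈ compactSubalgebra Z := by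
  refine map_mem_of_dense_span (tensorCompactsRep ι hι j) (Compacts.dense_span_thetaK E)
    (Compacts.dense_span_thetaK F) (compactSubalgebra Z).toSubmodule
    (NonUnitalStarSubalgebra.isClosed_topologicalClosure _) ?_ c
  rintro _ ⟨x, x', rfl⟩ _ ⟨y, y', rfl⟩
  rw [tensorCompactsRep_thetaK]
  exact (thetaK _ _).2

/-- The action of `𝒦(E) ⊙ 𝒦(F)` on `Z ≅ E ⊗ F`, as a map into `𝒦(Z)`. -/
def tensorCompactsHom (j : HilbertModule.Iso (preTensor E F ι hι).Compl Z) :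
    Compacts E ⊗[ℂ] Compacts F →⋆ₙₐ[ℂ] Compacts Z where
  toFun c := ⟨tensorCompactsRep ι hι j c, tensorCompactsRep_mem ι hι j c⟩
  map_smul' a c := Subtype.ext (map_smul (tensorCompactsRep ι hι j) a c)
  map_zero' := Subtype.ext (map_zero (tensorCompactsRep ι hι j))
  map_add' c d := Subtype.ext (map_add (tensorCompactsRep ι hι j) c d)
  map_mul' c d := Subtype.ext (map_mul (tensorCompactsRep ι hι j) c d)
  map_star' c := Subtype.ext (map_star (tensorCompactsRep ι hι j) c)

/-- The closure of the range contains `θ` of images of elementary tensors, by sesquilinearity `θ` of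
images of all algebraic tensors, by continuity every `θ`, and these span a dense subspace. -/
theorem denseRange_tensorCompactsHom (j : HilbertModule.Iso (preTensor E F ι hι).Compl Z) :
    DenseRange (tensorCompactsHom ι hι j) := by
  let f : Compacts E ⊗[ℂ] Compacts F →ₗ[ℂ] Compacts Z :=
    { toFun := tensorCompactsHom ι hι j
      map_add' := map_add (tensorCompactsHom ι hι j)
      map_smul' := map_smul (tensorCompactsHom ι hι j) }
  let M : Submodule ℂ (Compacts Z) := (LinearMap.range f).topologicalClosure
  have hMc : IsClosed (M : Set (Compacts Z)) := Submodule.isClosed_topologicalClosure _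
  have hJ : DenseRange fun z => j.toLinearEquiv ((preTensor E F ι hι).toCompl z) :=
    j.toLinearEquiv.surjective.denseRange.comp (preTensor E F ι hι).denseRange_toCompl j.continuous
  have hz : ∀ w : Z, thetaK (0 : Z) w = 0 := fun w =>
    Compacts.incl_injective (HilbertModule.adjointable_ext fun x => zero_act _)
  have hadd : ∀ z z' w : Z, thetaK (z + z') w = thetaK z w + thetaK z' w := fun z z' w =>
    Compacts.incl_injective (theta_add_left z z' w)
  have hstar : ∀ z w : Z, star (thetaK z w) = thetaK w z := Compacts.star_thetaK
  have h1 : ∀ z w, thetaK (j.toLinearEquiv ((preTensor E F ι hι).toCompl z))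
      (j.toLinearEquiv ((preTensor E F ι hι).toCompl w)) ∈ M := fun z w => by
    induction z with
    | zero => rw [map_zero, map_zero, hz]; exact M.zero_mem
    | add z z' h h' => rw [map_add, map_add, hadd]; exact M.add_mem h h'
    | tmul x y =>
      induction w with
      | zero => rw [map_zero, map_zero, ← hstar, hz, star_zero]; exact M.zero_mem
      | add w w' h h' =>
        rw [map_add, map_add, ← hstar, hadd, star_add, hstar, hstar]; exact M.add_mem h h'
      | tmul x' y' =>
        refine Submodule.le_topologicalClosure _ ⟨thetaK x x' ⊗ₜ[ℂ] thetaK y y', ?_⟩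
        exact Subtype.ext (tensorCompactsRep_thetaK ι hι j x x' y y')
  have h2 : ∀ z w : Z, thetaK z w ∈ M := fun z w =>
    hJ.induction_on₂ (p := fun z w => thetaK z w ∈ M) (hMc.preimage continuous_thetaK) h1 z w
  intro k
  refine (Compacts.dense_span_thetaK Z).induction (P := fun k => k ∈ M) (fun k hk => ?_) hMc k
  have : Submodule.span ℂ {k : Compacts Z | ∃ x y, k = thetaK x y} ≤ M :=
    Submodule.span_le.2 (by rintro _ ⟨x, y, rfl⟩; exact h2 x y)
  exact this hk

/-- A `*`-homomorphism with dense range on `A ⊙ B` that is isometric for a C⋆-norm extends to an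
isomorphism of the completion. -/
theorem IsCStarNorm.exists_equiv {p : A ⊗[ℂ] B → ℝ} (hp : IsCStarNorm p)
    (f : A ⊗[ℂ] B →⋆ₙₐ[ℂ] D) (hf : DenseRange f) (hnorm : ∀ c, ‖f c‖ = p c) :
    ∃ Φ : hp.Compl ≃⋆ₐ[ℂ] D, ∀ c, Φ (hp.toCompl c) = f c := by
  obtain ⟨φ, hφ⟩ := exists_starHom_extension hp.toComplHom hp.denseRange_toComplHom f
    fun c => by rw [hnorm, hp.norm_toComplHom]
  have hcont : Continuous φ :=
    AddMonoidHomClass.continuous_of_bound φ 1 fun x => by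
      rw [one_mul]; exact NonUnitalStarAlgHom.norm_apply_le φ x
  have hiso : Isometry φ := AddMonoidHomClass.isometry_of_norm φ fun x =>
    hp.denseRange_toComplHom.induction_on (p := fun x => ‖φ x‖ = ‖x‖) x
      (isClosed_eq hcont.norm continuous_norm) fun c => by rw [hφ, hnorm, hp.norm_toComplHom]
  -- An isometry on a complete space has closed range; since that range contains the dense range of
  -- `f`, it is everything.
  have hclosed : IsClosed (Set.range φ) := hiso.isClosedEmbedding.isClosed_range
  have hsurj : Function.Surjective φ := fun d =>
    hf.induction_on (p := fun d => d ∈ Set.range φ) d hclosed fun c => ⟨_, hφ c⟩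
  exact ⟨StarAlgEquiv.ofBijective φ ⟨hiso.injective, hsurj⟩, hφ⟩

end TensorCompacts


/-! ### Partitions of unity on a compact set -/

theorem IsCompact.exists_partition {X : Type*} [TopologicalSpace X] [T2Space X]
    [LocallyCompactSpace X] {K : Set X} (hK : IsCompact K) (U : X → Set X)
    (hU : ∀ x ∈ K, IsOpen (U x) ∧ x ∈ U x) :
    ∃ (s : Finset X) (φ : X → C(X, ℝ)), (∀ x ∈ s, x ∈ K) ∧ (∀ x ∈ s, tsupport (φ x) ⊆ U x) ∧
      (∀ x ∈ s, HasCompactSupport (φ x)) ∧ (∀ x ∈ s, ∀ y, 0 ≤ φ x y) ∧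
      (∀ y, ∑ x ∈ s, φ x y ≤ 1) ∧ ∀ y ∈ K, ∑ x ∈ s, φ x y = 1 := by
  classical
  obtain ⟨s, hs, hKs⟩ := hK.elim_nhds_subcover U fun x hx => (hU x hx).1.mem_nhds (hU x hx).2
  obtain ⟨f, hf, hfc⟩ := PartitionOfUnity.exists_isSubordinate_of_locallyFinite_t2space hK
    (fun i : s => U i) (fun i => (hU i (hs i i.2)).1) (locallyFinite_of_finite _)
    (fun x hx => by
      obtain ⟨i, hi, hxi⟩ := Set.mem_iUnion₂.1 (hKs hx)
      exact Set.mem_iUnion.2 ⟨⟨i, hi⟩, hxi⟩)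
  have hsum : ∀ y, ∑ x ∈ s, (if h : x ∈ s then f ⟨x, h⟩ else 0 : C(X, ℝ)) y = ∑ᶠ i, f i y := by
    intro y
    rw [finsum_eq_sum_of_fintype, ← Finset.sum_coe_sort]
    refine Finset.sum_congr rfl fun i _ => ?_
    rw [dif_pos i.2]
  -- The functions are indexed by points of `X` and set to zero off `s`, so that families chosen at
  -- points can be summed against them.
  refine ⟨s, fun x => if h : x ∈ s then f ⟨x, h⟩ else 0, hs, fun x hx => ?_, fun x hx => ?_,
    fun x hx y => ?_, fun y => ?_, fun y hy => ?_⟩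
  · simp only [dif_pos hx]; exact hf ⟨x, hx⟩
  · simp only [dif_pos hx]; exact hfc ⟨x, hx⟩
  · simp only [dif_pos hx]; exact f.nonneg _ _
  · rw [hsum]; exact f.sum_le_one y
  · rw [hsum]; exact f.sum_eq_one hy

/-! ### Enough continuous sections -/

namespace FellBundle

open Filter

variable {G : Type*} [Group G] [TopologicalSpace G] (A : FellBundle G)

section Limits

variable {X : Type*} {l : Filter X} {b : X → G} {t : G}

theorem tendsto_base {u : ∀ x, A.Fiber (b x)} {a : A.Fiber t}
    (hu : Tendsto (fun x => (⟨b x, u x⟩ : A.Total)) l (𝓝 ⟨t, a⟩)) : Tendsto b l (𝓝 t) :=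
  (A.continuous_base.tendsto _).comp hu

theorem tendsto_norm {u : ∀ x, A.Fiber (b x)} {a : A.Fiber t}
    (hu : Tendsto (fun x => (⟨b x, u x⟩ : A.Total)) l (𝓝 ⟨t, a⟩)) :
    Tendsto (fun x => ‖u x‖) l (𝓝 ‖a‖) :=
  (A.continuous_norm.tendsto _).comp hu

theorem tendsto_mk_zero {u : ∀ x, A.Fiber (b x)} (hb : Tendsto b l (𝓝 t))
    (hu : Tendsto (fun x => ‖u x‖) l (𝓝 0)) :
    Tendsto (fun x => (⟨b x, u x⟩ : A.Total)) l (𝓝 ⟨t, 0⟩) := by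
  refine Tendsto.mono_right ?_ (A.tendsto_zero t)
  rw [tendsto_inf]
  exact ⟨tendsto_comap_iff.2 hb, tendsto_comap_iff.2 hu⟩

theorem tendsto_mk_add {u v : ∀ x, A.Fiber (b x)} {a a' : A.Fiber t}
    (hu : Tendsto (fun x => (⟨b x, u x⟩ : A.Total)) l (𝓝 ⟨t, a⟩))
    (hv : Tendsto (fun x => (⟨b x, v x⟩ : A.Total)) l (𝓝 ⟨t, a'⟩)) :
    Tendsto (fun x => (⟨b x, u x + v x⟩ : A.Total)) l (𝓝 ⟨t, a + a'⟩) := by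
  have h : Tendsto (fun x => (⟨(⟨b x, u x⟩, ⟨b x, v x⟩), rfl⟩ :
      {p : A.Total × A.Total // p.1.base = p.2.base})) l (𝓝 ⟨(⟨t, a⟩, ⟨t, a'⟩), rfl⟩) :=
    tendsto_subtype_rng.2 (hu.prodMk_nhds hv)
  exact (A.continuous_add.tendsto _).comp h

theorem tendsto_mk_const_smul (c : ℂ) {u : ∀ x, A.Fiber (b x)} {a : A.Fiber t}
    (hu : Tendsto (fun x => (⟨b x, u x⟩ : A.Total)) l (𝓝 ⟨t, a⟩)) :
    Tendsto (fun x => (⟨b x, c • u x⟩ : A.Total)) l (𝓝 ⟨t, c • a⟩) :=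
  ((A.continuous_smul c).tendsto _).comp hu

theorem tendsto_mk_sub {u v : ∀ x, A.Fiber (b x)} {a a' : A.Fiber t}
    (hu : Tendsto (fun x => (⟨b x, u x⟩ : A.Total)) l (𝓝 ⟨t, a⟩))
    (hv : Tendsto (fun x => (⟨b x, v x⟩ : A.Total)) l (𝓝 ⟨t, a'⟩)) :
    Tendsto (fun x => (⟨b x, u x - v x⟩ : A.Total)) l (𝓝 ⟨t, a - a'⟩) := by
  have h := A.tendsto_mk_add hu (A.tendsto_mk_const_smul (-1) hv)
  simpa only [neg_one_smul, ← sub_eq_add_neg] using h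

/-- The axioms give continuity only for each fixed scalar. In `c u = c₀ u + (c - c₀) u` the last
term tends to zero in norm, hence to the zero of the limit fibre. -/
theorem tendsto_mk_smul {c : X → ℂ} {c₀ : ℂ} (hc : Tendsto c l (𝓝 c₀)) {u : ∀ x, A.Fiber (b x)}
    {a : A.Fiber t} (hu : Tendsto (fun x => (⟨b x, u x⟩ : A.Total)) l (𝓝 ⟨t, a⟩)) :
    Tendsto (fun x => (⟨b x, c x • u x⟩ : A.Total)) l (𝓝 ⟨t, c₀ • a⟩) := by
  have h1 : Tendsto (fun x => ‖(c x - c₀) • u x‖) l (𝓝 0) := by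
    have := (hc.sub_const c₀).norm.mul (A.tendsto_norm hu)
    simpa only [norm_smul, sub_self, norm_zero, zero_mul] using this
  have h := A.tendsto_mk_add (A.tendsto_mk_const_smul c₀ hu)
    (A.tendsto_mk_zero (A.tendsto_base hu) h1)
  simpa only [← add_smul, add_sub_cancel, add_zero] using h

end Limits

/-- The filter of pairs `(u, v)` in the same fibre with `u → a` and `v → a'`. -/
def pairNhds {t : G} (a a' : A.Fiber t) : Filter (Σ b, A.Fiber b × A.Fiber b) :=
  (𝓝 ((⟨t, a⟩, ⟨t, a'⟩) : A.Total × A.Total)).comap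
    fun x => (⟨x.1, x.2.1⟩, ⟨x.1, x.2.2⟩)

theorem tendsto_pairNhds_fst {t : G} (a a' : A.Fiber t) :
    Tendsto (fun x => (⟨x.1, x.2.1⟩ : A.Total)) (A.pairNhds a a') (𝓝 ⟨t, a⟩) :=
  (continuous_fst.tendsto _).comp tendsto_comap

theorem tendsto_pairNhds_snd {t : G} (a a' : A.Fiber t) :
    Tendsto (fun x => (⟨x.1, x.2.2⟩ : A.Total)) (A.pairNhds a a') (𝓝 ⟨t, a'⟩) :=
  (continuous_snd.tendsto _).comp tendsto_comap

theorem exists_nhds_of_pairNhds {t : G} {a a' : A.Fiber t} {Q : ∀ b, A.Fiber b → A.Fiber b → Prop}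
    (hQ : ∀ᶠ x in A.pairNhds a a', Q x.1 x.2.1 x.2.2) :
    ∃ U ∈ 𝓝 (⟨t, a⟩ : A.Total), ∃ V ∈ 𝓝 (⟨t, a'⟩ : A.Total), ∀ b (u v : A.Fiber b),
      (⟨b, u⟩ : A.Total) ∈ U → (⟨b, v⟩ : A.Total) ∈ V → Q b u v := by
  obtain ⟨W, hW, hWQ⟩ := mem_comap.1 hQ
  obtain ⟨U, hU, V, hV, hUV⟩ := mem_nhds_prod_iff.1 hW
  exact ⟨U, hU, V, hV, fun b u v hu hv => @hWQ ⟨b, u, v⟩ (hUV (Set.mk_mem_prod hu hv))⟩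

/-- Given `a, a' ∈ A_t`, every `u` near `a` has a partner `v` near `a'` in the same fibre. -/
theorem eventually_exists_pair {t : G} {a a' : A.Fiber t}
    {Q : ∀ b, A.Fiber b → A.Fiber b → Prop} (hQ : ∀ᶠ x in A.pairNhds a a', Q x.1 x.2.1 x.2.2) :
    ∀ᶠ p in 𝓝 (⟨t, a⟩ : A.Total), ∃ v, Q p.base p.val v := by
  obtain ⟨U, hU, V, hV, hUV⟩ := A.exists_nhds_of_pairNhds hQ
  -- Openness of the projection provides a point of `V` over every base point near `t`.
  have hV' : BundlePoint.base '' V ∈ 𝓝 t := A.isOpenMap_base.image_mem_nhds hV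
  filter_upwards [hU, A.continuous_base.continuousAt.preimage_mem_nhds hV'] with p hp hp'
  obtain ⟨b, u⟩ := p
  obtain ⟨⟨b', v⟩, hv, hbb⟩ := hp'
  obtain rfl : b' = b := hbb
  exact ⟨v, hUV _ u v hp hv⟩

/-- The section `f` oscillates by at most `ε` at `t`. -/
def OscAt (f : ∀ t, A.Fiber t) (t : G) (ε : ℝ) : Prop :=
  ∀ ε' > ε, ∀ᶠ p in 𝓝 (⟨t, f t⟩ : A.Total), ‖f p.base - p.val‖ < ε'

variable {A} {f g : ∀ t, A.Fiber t} {t : G} {ε δ : ℝ}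

theorem OscAt.mono (h : A.OscAt f t ε) (hεδ : ε ≤ δ) : A.OscAt f t δ :=
  fun ε' hε' => h ε' (hεδ.trans_lt hε')

/-- A point `p` near `f(t) + g(t)` is not given as a sum. Openness of the projection yields `v` near
`g(t)` in the fibre of `p`; then `p - v` is near `f(t)` and the two oscillations add. -/
theorem OscAt.add (hf : A.OscAt f t ε) (hg : A.OscAt g t δ) :
    A.OscAt (fun t => f t + g t) t (ε + δ) := by
  intro r hr
  obtain ⟨η, hη, hr'⟩ : ∃ η > 0, ε + η + (δ + η) = r :=
    ⟨(r - (ε + δ)) / 2, by linarith, by ring⟩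
  have h1 : Tendsto (fun x => (⟨x.1, x.2.1 - x.2.2⟩ : A.Total)) (A.pairNhds (f t + g t) (g t))
      (𝓝 ⟨t, f t⟩) := by
    have := A.tendsto_mk_sub (A.tendsto_pairNhds_fst (f t + g t) (g t))
      (A.tendsto_pairNhds_snd (f t + g t) (g t))
    rwa [add_sub_cancel_right] at this
  have h2 := (h1.eventually (hf (ε + η) (by linarith))).and
    ((A.tendsto_pairNhds_snd (f t + g t) (g t)).eventually (hg (δ + η) (by linarith)))
  filter_upwards [A.eventually_exists_pair
    (Q := fun b u v => ‖f b - (u - v)‖ < ε + η ∧ ‖g b - v‖ < δ + η) h2] with p hp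
  obtain ⟨v, hv1, hv2⟩ := hp
  calc ‖f p.base + g p.base - p.val‖ = ‖(f p.base - (p.val - v)) + (g p.base - v)‖ := by
        congr 1; abel
    _ ≤ _ := norm_add_le _ _
    _ < r := by linarith

theorem OscAt.smul (hf : A.OscAt f t ε) {φ : G → ℝ} (hφ : ContinuousAt φ t)
    (h0 : ∀ s, 0 ≤ φ s) : A.OscAt (fun t => (φ t : ℂ) • f t) t (φ t * ε) := by
  intro r hr
  -- The left side is the bound reached below when `φ`, the oscillation of `f` and the error in `p ≈
  -- φ v` are each allowed a slack `η`; it tends to `φ(t) ε` as `η → 0`.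
  obtain ⟨η, hη, hr'⟩ : ∃ η > 0, (φ t + η) * (ε + η) + η < r := by
    have hc : Tendsto (fun η : ℝ => (φ t + η) * (ε + η) + η) (𝓝[>] 0) (𝓝 (φ t * ε)) := by
      have : Continuous fun η : ℝ => (φ t + η) * (ε + η) + η := by fun_prop
      simpa using (this.tendsto 0).mono_left nhdsWithin_le_nhds
    obtain ⟨η, h1, h2⟩ := ((hc.eventually_lt_const hr).and self_mem_nhdsWithin).exists
    exact ⟨η, h2, h1⟩
  set l := A.pairNhds ((φ t : ℂ) • f t) (f t) with hl
  have hb : Tendsto (fun x : Σ b, A.Fiber b × A.Fiber b => φ x.1) l (𝓝 (φ t)) :=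
    hφ.tendsto.comp (A.tendsto_base (A.tendsto_pairNhds_snd _ _))
  have h1 : Tendsto (fun x : Σ b, A.Fiber b × A.Fiber b => ‖x.2.1 - (φ x.1 : ℂ) • x.2.2‖) l
      (𝓝 0) := by
    have h := A.tendsto_norm (A.tendsto_mk_sub (A.tendsto_pairNhds_fst ((φ t : ℂ) • f t) (f t))
      (A.tendsto_mk_smul ((Complex.continuous_ofReal.tendsto _).comp hb)
        (A.tendsto_pairNhds_snd ((φ t : ℂ) • f t) (f t))))
    rwa [sub_self, norm_zero] at h
  have h2 := ((A.tendsto_pairNhds_snd ((φ t : ℂ) • f t) (f t)).eventually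
    (hf (ε + η) (by linarith))).and ((h1.eventually_lt_const hη).and
      (hb.eventually_lt_const (by linarith : φ t < φ t + η)))
  filter_upwards [A.eventually_exists_pair (Q := fun b u v => ‖f b - v‖ < ε + η ∧
    ‖u - (φ b : ℂ) • v‖ < η ∧ φ b < φ t + η) h2] with p hp
  obtain ⟨v, hv1, hv2, hv3⟩ := hp
  calc ‖(φ p.base : ℂ) • f p.base - p.val‖
      = ‖(φ p.base : ℂ) • (f p.base - v) - (p.val - (φ p.base : ℂ) • v)‖ := by
        rw [smul_sub]; congr 1; abel
    _ ≤ ‖(φ p.base : ℂ) • (f p.base - v)‖ + ‖p.val - (φ p.base : ℂ) • v‖ := norm_sub_le _ _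
    _ ≤ (φ t + η) * (ε + η) + η := by
        rw [norm_smul, Complex.norm_real, Real.norm_of_nonneg (h0 _)]
        refine add_le_add (mul_le_mul hv3.le hv1.le (norm_nonneg _) ?_) hv2.le
        exact (h0 _).trans hv3.le
    _ < r := hr'

theorem oscAt_zero_of_eventuallyEq (hf : ∀ᶠ s in 𝓝 t, f s = 0) : A.OscAt f t 0 := by
  intro r hr
  have h0 : f t = 0 := hf.self_of_nhds
  have h1 : ∀ᶠ p in 𝓝 (⟨t, f t⟩ : A.Total), f p.base = 0 :=
    (A.continuous_base.tendsto (⟨t, f t⟩ : A.Total)).eventually hf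
  have h2 : ∀ᶠ p in 𝓝 (⟨t, f t⟩ : A.Total), ‖p.val‖ < r := by
    refine (A.continuous_norm.tendsto (⟨t, f t⟩ : A.Total)).eventually_lt_const ?_
    change ‖f t‖ < r
    rwa [h0, norm_zero]
  filter_upwards [h1, h2] with p hp hp'
  rwa [hp, zero_sub, norm_neg]

theorem OscAt.sum {ι : Type*} (s : Finset ι) (F : ι → ∀ t, A.Fiber t) (e : ι → ℝ)
    (h : ∀ i ∈ s, A.OscAt (F i) t (e i)) : A.OscAt (fun t => ∑ i ∈ s, F i t) t (∑ i ∈ s, e i) := by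
  classical
  induction s using Finset.induction_on with
  | empty =>
    simp only [Finset.sum_empty]
    exact oscAt_zero_of_eventuallyEq (Eventually.of_forall fun _ => rfl)
  | insert i s hi ih =>
    simp only [Finset.sum_insert hi]
    exact (h i (Finset.mem_insert_self i s)).add
      (ih fun j hj => h j (Finset.mem_insert_of_mem hj))

/-- The projection is open and continuous, so neighbourhoods of `t` are images of neighbourhoods of
`f(t)` in the total space. There `f(base p) - p` tends to zero in norm, and adding `p → f(t)` gives
continuity. -/
theorem OscAt.tendsto (h : A.OscAt f t 0) :
    Tendsto (fun s => (⟨s, f s⟩ : A.Total)) (𝓝 t) (𝓝 ⟨t, f t⟩) := by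
  have hmap : 𝓝 t = (𝓝 (⟨t, f t⟩ : A.Total)).map BundlePoint.base :=
    (A.isOpenMap_base.map_nhds_eq
      (A.continuous_base.continuousAt (x := (⟨t, f t⟩ : A.Total)))).symm
  rw [hmap, tendsto_map'_iff]
  have h1 : Tendsto (fun p : A.Total => ‖f p.base - p.val‖) (𝓝 ⟨t, f t⟩) (𝓝 0) := by
    rw [Metric.tendsto_nhds]
    intro r hr
    filter_upwards [h r hr] with p hp
    rwa [dist_zero_right, norm_norm]
  have h2 := A.tendsto_mk_add
    (A.tendsto_mk_zero (A.continuous_base.tendsto (⟨t, f t⟩ : A.Total)) h1)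
    (tendsto_id (x := 𝓝 (⟨t, f t⟩ : A.Total)))
  simp only [sub_add_cancel, zero_add] at h2
  exact h2

/-- Passing to a uniformly close section increases the oscillation by little. -/
theorem OscAt.of_norm_sub_le (hg : A.OscAt g t ε) {K : Set G} (hK : K ∈ 𝓝 t)
    (h : ∀ s ∈ K, ‖f s - g s‖ ≤ δ) : A.OscAt f t (ε + 2 * δ) := by
  intro r hr
  obtain ⟨η, hη, hr'⟩ : ∃ η > 0, δ + (ε + η) + (δ + η) = r :=
    ⟨(r - (ε + 2 * δ)) / 2, by linarith, by ring⟩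
  have h1 := A.tendsto_norm (A.tendsto_mk_sub (A.tendsto_pairNhds_snd (f t) (g t))
    (A.tendsto_pairNhds_fst (f t) (g t)))
  have h2 : ‖g t - f t‖ < δ + η := by
    rw [norm_sub_rev]; linarith [h t (mem_of_mem_nhds hK)]
  have h3 := ((A.tendsto_pairNhds_snd (f t) (g t)).eventually
    (hg (ε + η) (by linarith))).and ((h1.eventually_lt_const h2).and
      ((A.tendsto_base (A.tendsto_pairNhds_snd (f t) (g t))).eventually hK))
  filter_upwards [A.eventually_exists_pair (Q := fun b u v => ‖g b - v‖ < ε + η ∧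
    ‖v - u‖ < δ + η ∧ b ∈ K) h3] with p hp
  obtain ⟨v, hv1, hv2, hv3⟩ := hp
  calc ‖f p.base - p.val‖ = ‖(f p.base - g p.base) + (g p.base - v) + (v - p.val)‖ := by
        congr 1; abel
    _ ≤ ‖f p.base - g p.base‖ + ‖g p.base - v‖ + ‖v - p.val‖ := norm_add₃_le
    _ < r := by linarith [h _ hv3]

variable (A)

/-- Local selections of small oscillation. -/
theorem exists_local_selection (a : A.Fiber t) (hε : 0 < ε) {W : Set A.Total}
    (hW : W ∈ 𝓝 (⟨t, a⟩ : A.Total)) :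
    ∃ (O : Set G) (g : ∀ s, A.Fiber s), IsOpen O ∧ t ∈ O ∧
      (∀ s ∈ O, (⟨s, g s⟩ : A.Total) ∈ W) ∧ ∀ s ∈ O, A.OscAt g s ε := by
  classical
  have h1 := A.tendsto_norm (A.tendsto_mk_sub (A.tendsto_pairNhds_fst a a)
    (A.tendsto_pairNhds_snd a a))
  rw [sub_self, norm_zero] at h1
  obtain ⟨U, hU, V, hV, hUV⟩ := A.exists_nhds_of_pairNhds
    (Q := fun b u v => ‖u - v‖ < ε) (h1.eventually_lt_const hε)
  -- Any two points of `N` in one fibre differ by less than `ε`, so an arbitrary choice of points of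
  -- `N` is a selection of oscillation at most `ε`.
  obtain ⟨N, hN, hNo, haN⟩ := mem_nhds_iff.1 (inter_mem (inter_mem hU hV) hW)
  have hex : ∀ s ∈ BundlePoint.base '' N, ∃ u : A.Fiber s, (⟨s, u⟩ : A.Total) ∈ N := by
    rintro _ ⟨⟨s, u⟩, hu, rfl⟩
    exact ⟨u, hu⟩
  let g : ∀ s, A.Fiber s := fun s => if h : s ∈ BundlePoint.base '' N then (hex s h).choose else 0
  have hg : ∀ s ∈ BundlePoint.base '' N, (⟨s, g s⟩ : A.Total) ∈ N := fun s hs => by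
    simp only [g, dif_pos hs]
    exact (hex s hs).choose_spec
  refine ⟨BundlePoint.base '' N, g, A.isOpenMap_base _ hNo, ⟨_, haN, rfl⟩,
    fun s hs => (hN (hg s hs)).2, fun s hs r hr => ?_⟩
  filter_upwards [hNo.mem_nhds (hg s hs)] with p hp
  exact (hUV p.base _ _ (hN (hg _ ⟨p, hp, rfl⟩)).1.1 (hN hp).1.2).trans hr

/-- A section of oscillation `ε` on a compact set is close to one of arbitrarily small
oscillation. -/
theorem exists_refinement [T2Space G] [LocallyCompactSpace G] {K : Set G} (hK : IsCompact K)
    {f : ∀ t, A.Fiber t} (hf : ∀ t ∈ K, A.OscAt f t ε) {η : ℝ} (hη : ε < η) (hδ : 0 < δ) :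
    ∃ g : ∀ t, A.Fiber t, (∀ t ∈ K, A.OscAt g t δ) ∧ ∀ t ∈ K, ‖g t - f t‖ ≤ η := by
  classical
  -- The bound on the oscillation of `f` makes `‖f - p‖ < η` a neighbourhood of the point `f(t)`.
  -- Selections inside it stay within `η` of `f`, and convex combinations of them retain both this
  -- bound and oscillation `δ`.
  have hloc : ∀ t : G, ∃ (O : Set G) (g : ∀ s, A.Fiber s), t ∈ K → IsOpen O ∧ t ∈ O ∧
      (∀ s ∈ O, ‖f s - g s‖ < η) ∧ ∀ s ∈ O, A.OscAt g s δ := fun t => by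
    by_cases ht : t ∈ K
    · obtain ⟨O, g, h1, h2, h3, h4⟩ := A.exists_local_selection (f t) hδ (hf t ht η hη)
      exact ⟨O, g, fun _ => ⟨h1, h2, h3, h4⟩⟩
    · exact ⟨∅, 0, fun h => (ht h).elim⟩
  choose O F hOF using hloc
  obtain ⟨s, φ, hsK, hsupp, -, hnn, -, hone⟩ := hK.exists_partition O
    fun x hx => ⟨(hOF x hx).1, (hOF x hx).2.1⟩
  refine ⟨fun t => ∑ x ∈ s, (φ x t : ℂ) • F x t, fun t ht => ?_, fun t ht => ?_⟩
  · have h : ∀ x ∈ s, A.OscAt (fun t => (φ x t : ℂ) • F x t) t (φ x t * δ) := fun x hx => by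
      by_cases htx : t ∈ tsupport (φ x)
      · exact ((hOF x (hsK x hx)).2.2.2 t (hsupp x hx htx)).smul (φ x).continuous.continuousAt
          (hnn x hx)
      · refine (oscAt_zero_of_eventuallyEq ?_).mono (mul_nonneg (hnn x hx t) hδ.le)
        filter_upwards [notMem_tsupport_iff_eventuallyEq.1 htx] with u hu
        rw [hu, Pi.zero_apply, Complex.ofReal_zero, zero_smul]
    refine (OscAt.sum s _ _ h).mono ?_
    rw [← Finset.sum_mul, hone t ht, one_mul]
  · have h1 : (∑ x ∈ s, (φ x t : ℂ)) • f t = f t := by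
      rw [← Complex.ofReal_sum, hone t ht, Complex.ofReal_one, one_smul]
    nth_rewrite 1 [← h1]
    rw [Finset.sum_smul, ← Finset.sum_sub_distrib]
    calc _ ≤ ∑ x ∈ s, ‖(φ x t : ℂ) • F x t - (φ x t : ℂ) • f t‖ := norm_sum_le _ _
      _ ≤ ∑ x ∈ s, φ x t * η := by
        refine Finset.sum_le_sum fun x hx => ?_
        rw [← smul_sub, norm_smul, Complex.norm_real, Real.norm_of_nonneg (hnn x hx t)]
        by_cases htx : t ∈ tsupport (φ x)
        · refine mul_le_mul_of_nonneg_left ?_ (hnn x hx t)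
          rw [norm_sub_rev]
          exact ((hOF x (hsK x hx)).2.2.1 t (hsupp x hx htx)).le
        · rw [image_eq_zero_of_notMem_tsupport htx, zero_mul, zero_mul]
      _ = η := by rw [← Finset.sum_mul, hone t ht, one_mul]

/-- Local continuous sections through points close to a given one. -/
theorem exists_local_section [T2Space G] [LocallyCompactSpace G] (a : A.Fiber t) (hδ : 0 < δ) :
    ∃ (K : Set G) (f : ∀ t, A.Fiber t), IsCompact K ∧ K ∈ 𝓝 t ∧ ‖f t - a‖ < δ ∧
      ∀ s ∈ interior K, Tendsto (fun s => (⟨s, f s⟩ : A.Total)) (𝓝 s) (𝓝 ⟨s, f s⟩) := by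
  -- The initial selection is within `c` of `a` at `t`, and the limit is within `4c` of that
  -- selection, so the total error `5c` is below `δ`.
  set c := δ / 8 with hc
  have hc0 : 0 < c := by positivity
  have h1 := A.tendsto_norm (A.tendsto_mk_sub (A.tendsto_pairNhds_fst a a)
    (A.tendsto_pairNhds_snd a a))
  rw [sub_self, norm_zero] at h1
  obtain ⟨U, hU, V, hV, hUV⟩ := A.exists_nhds_of_pairNhds
    (Q := fun b u v => ‖u - v‖ < c) (h1.eventually_lt_const hc0)
  obtain ⟨O, g, hO, htO, hgU, hg⟩ := A.exists_local_selection a hc0 hU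
  obtain ⟨K, hK, htK, hKO⟩ := exists_compact_subset hO htO
  have hga : ‖g t - a‖ < c := hUV t _ _ (hgU t htO) (mem_of_mem_nhds hV)
  -- Stage `n` has oscillation `c / 2 ^ n` on `K`. Each refinement moves it by at most `2c / 2 ^ n`,
  -- just above its oscillation, so the stages converge uniformly on `K`.
  let S (n : ℕ) := {f : ∀ t, A.Fiber t // ∀ t ∈ K, A.OscAt f t (c / 2 ^ n)}
  have step : ∀ (n : ℕ) (f : S n), ∃ f' : S (n + 1), ∀ t ∈ K, ‖f'.1 t - f.1 t‖ ≤ 2 * c / 2 ^ n :=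
    fun n f => by
      obtain ⟨f', h, h'⟩ := A.exists_refinement hK f.2 (η := 2 * c / 2 ^ n)
        (δ := c / 2 ^ (n + 1)) (by gcongr; linarith) (by positivity)
      exact ⟨⟨f', h⟩, h'⟩
  choose next hnext using step
  let F : ∀ n, S n := fun n => Nat.rec
    (⟨g, fun t ht => by simpa using hg t (hKO ht)⟩ : S 0) (fun n f => next n f) n
  have hF : ∀ n, ∀ t ∈ K, ‖(F (n + 1)).1 t - (F n).1 t‖ ≤ 2 * c / 2 ^ n := fun n => hnext n (F n)
  have hdist : ∀ s ∈ K, ∀ n, dist ((F n).1 s) ((F (n + 1)).1 s) ≤ 4 * c / 2 / 2 ^ n :=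
    fun s hs n => by
      rw [dist_comm, dist_eq_norm]
      refine (hF n s hs).trans_eq (by ring)
  have hlim : ∀ s, ∃ v : A.Fiber s, s ∈ K → Tendsto (fun n => (F n).1 s) atTop (𝓝 v) := fun s => by
    by_cases hs : s ∈ K
    · obtain ⟨v, hv⟩ := cauchySeq_tendsto_of_complete (cauchySeq_of_le_geometric_two (hdist s hs))
      exact ⟨v, fun _ => hv⟩
    · exact ⟨0, fun h => (hs h).elim⟩
  choose f hf using hlim
  have hfF : ∀ s ∈ K, ∀ n, ‖f s - (F n).1 s‖ ≤ 4 * c / 2 ^ n := fun s hs n => by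
    rw [← dist_eq_norm, dist_comm]
    exact dist_le_of_le_geometric_two_of_tendsto (hdist s hs) (hf s hs) n
  refine ⟨K, f, hK, mem_interior_iff_mem_nhds.1 htK, ?_, fun s hs => ?_⟩
  · have h2 : ‖f t - (F 0).1 t‖ ≤ 4 * c :=
      (hfF t (interior_subset htK) 0).trans_eq (by rw [pow_zero, div_one])
    have h3 : ‖f t - a‖ ≤ ‖f t - (F 0).1 t‖ + ‖g t - a‖ := norm_sub_le_norm_sub_add_norm_sub _ _ _
    linarith
  -- Being within `4c / 2 ^ n` of stage `n`, the limit has oscillation at most `9c / 2 ^ n` for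
  -- every `n`, hence zero.
  · have hosc : ∀ n, A.OscAt f s (c / 2 ^ n + 2 * (4 * c / 2 ^ n)) := fun n =>
      ((F n).2 s (interior_subset hs)).of_norm_sub_le (mem_interior_iff_mem_nhds.1 hs) 
        fun u hu => hfF u hu n
    refine OscAt.tendsto fun r hr => ?_
    obtain ⟨n, hn⟩ : ∃ n : ℕ, 9 * c / 2 ^ n < r := by
      have h5 : Tendsto (fun n : ℕ => 9 * c * (1 / 2 : ℝ) ^ n) atTop (𝓝 0) := by
        simpa using (tendsto_pow_atTop_nhds_zero_of_lt_one (by norm_num : (0 : ℝ) ≤ 1 / 2)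
          (by norm_num)).const_mul (9 * c)
      obtain ⟨n, hn⟩ := (h5.eventually_lt_const hr).exists
      exact ⟨n, by simpa [div_eq_mul_inv] using hn⟩
    exact hosc n r (lt_of_eq_of_lt (by ring) hn)

/-- A Fell bundle over a locally compact group has enough continuous sections. -/
theorem exists_section [T2Space G] [LocallyCompactSpace G] (a : A.Fiber t) (hδ : 0 < δ) :
    ∃ f : ∀ t, A.Fiber t, Continuous (fun t => (⟨t, f t⟩ : A.Total)) ∧
      (∃ K, IsCompact K ∧ ∀ s ∉ K, f s = 0) ∧ ‖f t - a‖ < δ := by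
  obtain ⟨K, f, hK, htK, hfa, hf⟩ := A.exists_local_section a hδ
  obtain ⟨φ, hφ1, hφc, hφK, -⟩ := exists_continuousMap_one_of_isCompact_subset_isOpen
    (isCompact_singleton (x := t)) (isOpen_interior (s := K))
    (Set.singleton_subset_iff.2 (mem_interior_iff_mem_nhds.2 htK))
  have h1 : φ t = 1 := hφ1 rfl
  refine ⟨fun s => (φ s : ℂ) • f s, continuous_iff_continuousAt.2 fun s => ?_,
    ⟨tsupport φ, hφc, fun s hs => ?_⟩, ?_⟩
  · by_cases hs : s ∈ tsupport φ
    · exact A.tendsto_mk_smul ((Complex.continuous_ofReal.comp φ.continuous).tendsto s)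
        (hf s (hφK hs))
    -- Where `f` itself need not be continuous the product vanishes locally.
    · refine OscAt.tendsto (oscAt_zero_of_eventuallyEq ?_)
      filter_upwards [notMem_tsupport_iff_eventuallyEq.1 hs] with u hu
      rw [hu, Pi.zero_apply, Complex.ofReal_zero, zero_smul]
  · change (φ s : ℂ) • f s = 0
    rw [image_eq_zero_of_notMem_tsupport hs, Complex.ofReal_zero, zero_smul]
  · simpa only [h1, Complex.ofReal_one, one_smul] using hfa

/-- The values of the sections in `C_c^r(𝒜)` are dense in each fibre. -/
theorem denseRange_cc_apply [IsTopologicalGroup G] [T2Space G] [LocallyCompactSpace G] (r u : G) :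
    DenseRange fun ξ : A.Cc r => ξ.1 u := by
  refine Metric.denseRange_iff.2 fun a δ hδ => ?_
  obtain ⟨f, hf, ⟨K, hK, hK0⟩, hfa⟩ := A.exists_section a hδ
  refine ⟨⟨fun s => f (s * r), hf.comp (continuous_mul_const r), (· * r⁻¹) '' K,
    hK.image (continuous_mul_const r⁻¹), fun s hs => hK0 _ fun h => hs ⟨s * r, h, ?_⟩⟩, ?_⟩
  · exact mul_inv_cancel_right s r
  · rwa [dist_comm, dist_eq_norm]

/-- The product of a continuous function and a section. -/
def ccSmul [IsTopologicalGroup G] {r : G} (φ : C(G, ℝ)) (ξ : A.Cc r) : A.Cc r :=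
  ⟨fun s => (φ s : ℂ) • ξ.1 s, continuous_iff_continuousAt.2 fun s =>
      A.tendsto_mk_smul ((Complex.continuous_ofReal.comp φ.continuous).tendsto s)
        (ξ.2.1.tendsto s), by
    obtain ⟨K, hK, hK'⟩ := ξ.2.2
    refine ⟨K, hK, fun s hs => ?_⟩
    change (φ s : ℂ) • ξ.1 s = 0
    rw [hK' s hs, smul_zero]⟩

end FellBundle


/-! ### Gluing of approximations and integration against Haar measure -/

/-- Local approximations of a section of a family of normed spaces are glued to a global one by a
partition of unity. -/
theorem IsCompact.exists_partition_approx {X : Type*} [TopologicalSpace X] [T2Space X]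
    [LocallyCompactSpace X] {K K' : Set X} (hK : IsCompact K) (hK' : K ⊆ interior K')
    {V : X → Type*} [∀ y, NormedAddCommGroup (V y)] [∀ y, NormedSpace ℝ (V y)] (ζ : ∀ y, V y)
    (z : X → ∀ y, V y) {ε : ℝ} (hε : 0 ≤ ε)
    (hz : ∀ x ∈ K, ∀ᶠ y in 𝓝 x, ‖ζ y - z x y‖ < ε) :
    ∃ (s : Finset X) (φ : X → C(X, ℝ)), (∀ x ∈ s, x ∈ K) ∧ (∀ x ∈ s, HasCompactSupport (φ x)) ∧
      (∀ x ∈ s, ∀ y ∉ K', φ x y = 0) ∧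
      ∀ y, (y ∈ K ∨ ζ y = 0) → ‖ζ y - ∑ x ∈ s, φ x y • z x y‖ ≤ ε := by
  obtain ⟨s, φ, hs, hφU, hφc, hφ0, hφ1, hφK⟩ := hK.exists_partition
    (fun x => interior {y | ‖ζ y - z x y‖ < ε} ∩ interior K') fun x hx =>
      ⟨isOpen_interior.inter isOpen_interior, mem_interior_iff_mem_nhds.2 (hz x hx), hK' hx⟩
  refine ⟨s, φ, hs, hφc, fun x hx y hy => ?_, fun y hy => ?_⟩
  · exact image_eq_zero_of_notMem_tsupport fun h => hy (interior_subset (hφU x hx h).2)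
  -- Off `K` the weights need not add up to one, but there `ζ y = 0` and the identity still holds.
  · have h1 : ζ y = ∑ x ∈ s, φ x y • ζ y := by
      rw [← Finset.sum_smul]
      rcases hy with hy | hy
      · rw [hφK y hy, one_smul]
      · rw [hy, smul_zero]
    have h2 : ζ y - ∑ x ∈ s, φ x y • z x y = ∑ x ∈ s, φ x y • (ζ y - z x y) := by
      simp only [smul_sub, Finset.sum_sub_distrib, ← h1]
    rw [h2]
    calc _ ≤ ∑ x ∈ s, φ x y * ε := by
          refine norm_sum_le_of_le _ fun x hx => ?_
          rw [norm_smul, Real.norm_of_nonneg (hφ0 x hx y)]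
          by_cases h : y ∈ tsupport (φ x)
          · exact mul_le_mul_of_nonneg_left
              (Set.mem_ofPred.1 (interior_subset (hφU x hx h).1)).le (hφ0 x hx y)
          · rw [image_eq_zero_of_notMem_tsupport h, zero_mul, zero_mul]
      _ ≤ ε := by
          rw [← Finset.sum_mul]
          exact mul_le_of_le_one_left hε (hφ1 y)

namespace HaarMeasure

variable {G : Type*} [Group G] [TopologicalSpace G] (μ : HaarMeasure G)
variable {V : Type*} [NormedAddCommGroup V] [NormedSpace ℝ V]

section

variable {f g : G → V}

theorem integrable {V : Type*} [NormedAddCommGroup V] [T2Space G] {f : G → V} (hf : Continuous f)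
    (hfc : HasCompactSupport f) :
    letI := borel G; MeasureTheory.Integrable f μ.measure := by
  let _ : MeasurableSpace G := borel G
  have : BorelSpace G := ⟨rfl⟩
  have := μ.isHaarMeasure
  exact hf.integrable_of_hasCompactSupport hfc

theorem integral_sub [T2Space G] (hf : Continuous f) (hfc : HasCompactSupport f) (hg : Continuous g)
    (hgc : HasCompactSupport g) :
    μ.integral (fun x => f x - g x) = μ.integral f - μ.integral g := by
  let _ : MeasurableSpace G := borel G
  exact MeasureTheory.integral_sub (μ.integrable hf hfc) (μ.integrable hg hgc)

theorem integral_sum [T2Space G] {ι : Type*} (s : Finset ι) {f : ι → G → V} (hf : ∀ i ∈ s, Continuous (f i))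
    (hfc : ∀ i ∈ s, HasCompactSupport (f i)) :
    μ.integral (fun x => ∑ i ∈ s, f i x) = ∑ i ∈ s, μ.integral (f i) := by
  let _ : MeasurableSpace G := borel G
  exact MeasureTheory.integral_finsetSum s fun i hi => μ.integrable (hf i hi) (hfc i hi)

theorem integral_clm [T2Space G] {W : Type*} [NormedAddCommGroup W] [NormedSpace ℝ W] [CompleteSpace V]
    [CompleteSpace W] (L : V →L[ℝ] W) (hf : Continuous f) (hfc : HasCompactSupport f) :
    μ.integral (fun x => L (f x)) = L (μ.integral f) := by
  let _ : MeasurableSpace G := borel G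
  exact L.integral_comp_comm (μ.integrable hf hfc)

theorem integral_smul_const [T2Space G] [CompleteSpace V] {φ : G → ℝ} (hφ : Continuous φ)
    (hφc : HasCompactSupport φ) (v : V) :
    μ.integral (fun x => φ x • v) = μ.integral φ • v :=
  μ.integral_clm ((ContinuousLinearMap.id ℝ ℝ).smulRight v) hφ hφc

theorem norm_integral_le {K : Set G} (hK : IsCompact K) {M : ℝ} (h : ∀ x, ‖f x‖ ≤ M)
    (h0 : ∀ x ∉ K, f x = 0) :
    ‖μ.integral f‖ ≤ M * @MeasureTheory.Measure.real G (borel G) μ.measure K := by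
  let _ : MeasurableSpace G := borel G
  have : BorelSpace G := ⟨rfl⟩
  have := μ.isHaarMeasure
  refine (congrArg norm
    (MeasureTheory.setIntegral_eq_integral_of_forall_compl_eq_zero h0)).symm.trans_le ?_
  exact MeasureTheory.norm_setIntegral_le_of_norm_le_const hK.measure_lt_top fun x _ => h x

theorem integral_pos {φ : G → ℝ} (hφ : Continuous φ) (hφc : HasCompactSupport φ) (h0 : 0 ≤ φ)
    {x : G} (hx : φ x ≠ 0) : 0 < μ.integral φ := by
  let _ : MeasurableSpace G := borel G
  have : BorelSpace G := ⟨rfl⟩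
  have := μ.isHaarMeasure
  exact hφ.integral_pos_of_hasCompactSupport_nonneg_nonzero hφc h0 hx

end

theorem eq_of_forall_dual {x y : V} (h : ∀ ℓ : V →L[ℝ] ℝ, ℓ x = ℓ y) : x = y := by
  by_contra hne
  obtain ⟨ℓ, hℓ⟩ := SeparatingDual.exists_ne_zero (R := ℝ) (sub_ne_zero.2 hne)
  exact hℓ (by rw [map_sub, h, sub_self])

/-- For real functions this is uniqueness of Haar measure: the modular character is the factor by
which right translation scales it. Functionals reduce the vector-valued case to this one. -/
theorem integral_mul_right [IsTopologicalGroup G] [LocallyCompactSpace G] [T2Space G]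
    [CompleteSpace V] {f : G → V}
    (hf : Continuous f) (hfc : HasCompactSupport f) (t : G) :
    μ.integral (fun x => f (x * t)) = (FellBundle.modular t)⁻¹ • μ.integral f := by
  let _ : MeasurableSpace G := borel G
  have : BorelSpace G := ⟨rfl⟩
  have := μ.isHaarMeasure
  have hreal : ∀ φ : G → ℝ, Continuous φ → HasCompactSupport φ →
      μ.integral (fun x => φ (x * t)) = (FellBundle.modular t)⁻¹ * μ.integral φ := by
    intro φ hφ hφc
    have h1 := MeasureTheory.Measure.integral_isMulLeftInvariant_eq_smul_of_hasCompactSupport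
      (MeasureTheory.Measure.map (· * t) μ.measure) μ.measure hφ hφc
    rw [MeasureTheory.integral_map (measurable_mul_const t).aemeasurable
      hφ.aestronglyMeasurable, MeasureTheory.integral_smul_nnreal_measure,
      ← MeasureTheory.Measure.modularCharacterFun_eq_haarScalarFactor] at h1
    rw [FellBundle.modular, inv_inv]
    exact h1
  have hc : Continuous fun x => f (x * t) := hf.comp (continuous_mul_const t)
  have hcc : HasCompactSupport fun x => f (x * t) := hfc.comp_homeomorph (Homeomorph.mulRight t)
  refine eq_of_forall_dual fun ℓ => ?_
  rw [← μ.integral_clm ℓ hc hcc, map_smul, ← μ.integral_clm ℓ hf hfc]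
  exact hreal (fun x => ℓ (f x)) (ℓ.continuous.comp hf) (hfc.comp_left (map_zero ℓ))

end HaarMeasure

theorem HasCompactSupport.bilin {G H V W U : Type*} [TopologicalSpace G] [TopologicalSpace H]
    [T2Space G] [T2Space H] [Zero V] [Zero W] [Zero U] {f : G → V} {g : H → W} (β : V → W → U) (h₁ : ∀ w, β 0 w = 0) (h₂ : ∀ v, β v 0 = 0)
    (hf : HasCompactSupport f) (hg : HasCompactSupport g) :
    HasCompactSupport fun x : G × H => β (f x.1) (g x.2) := by
  refine HasCompactSupport.intro (hf.isCompact.prod hg.isCompact) fun x hx => ?_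
  rw [Set.mem_prod, not_and_or] at hx
  rcases hx with hx | hx
  · rw [image_eq_zero_of_notMem_tsupport hx, h₁]
  · rw [image_eq_zero_of_notMem_tsupport hx, h₂]

namespace HaarMeasure

variable {G H : Type*} [Group G] [TopologicalSpace G] [Group H] [TopologicalSpace H]
  {V : Type*} [NormedAddCommGroup V] [NormedSpace ℝ V]
  {μ : HaarMeasure G} {ν : HaarMeasure H} {κ : HaarMeasure (G × H)}

/-- `IsProd` speaks only of real product functions; applying functionals allows values in `V` in one
of the variables. -/
theorem IsProd.integral_smul [T2Space G] [T2Space H] (hκ : μ.IsProd ν κ) [CompleteSpace V]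
    {φ : G → ℝ} {f : H → V} (hφ : Continuous φ) (hφc : HasCompactSupport φ) (hf : Continuous f)
    (hfc : HasCompactSupport f) :
    κ.integral (fun x => φ x.1 • f x.2) = μ.integral φ • ν.integral f := by
  refine eq_of_forall_dual fun ℓ => ?_
  rw [← κ.integral_clm ℓ (by fun_prop) (HasCompactSupport.bilin (fun (a : ℝ) (b : V) => a • b)
    (fun _ => zero_smul _ _) (fun _ => smul_zero _) hφc hfc), map_smul, ← ν.integral_clm ℓ hf hfc]
  simp only [map_smul, smul_eq_mul]
  exact hκ φ (fun x => ℓ (f x)) hφ hφc (ℓ.continuous.comp hf) (hfc.comp_left (map_zero ℓ))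

/-- Fubini's theorem for a bounded bilinear map of functions of compact support. -/
theorem IsProd.integral_bilin [T2Space G] [LocallyCompactSpace G] [T2Space H] (hκ : μ.IsProd ν κ)
    {W U : Type*} [NormedAddCommGroup W] [NormedSpace ℝ W] [NormedAddCommGroup U] [NormedSpace ℝ U]
    [CompleteSpace V] [CompleteSpace W] [CompleteSpace U] (β : V →L[ℝ] W →L[ℝ] U)
    {f : G → V} {g : H → W} (hf : Continuous f) (hfc : HasCompactSupport f) (hg : Continuous g)
    (hgc : HasCompactSupport g) :
    κ.integral (fun x => β (f x.1) (g x.2)) = β (μ.integral f) (ν.integral g) := by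
  obtain ⟨K', hK', hfK'⟩ := exists_compact_superset hfc.isCompact
  obtain ⟨M, hM⟩ := hg.bounded_above_of_compact_support hgc
  have hM0 : 0 ≤ M := (norm_nonneg _).trans (hM 1)
  have hsupp : ∀ {f' : G → V}, HasCompactSupport f' →
      HasCompactSupport fun x : G × H => β (f' x.1) (g x.2) := fun {f'} hf' =>
    HasCompactSupport.bilin (fun v w => β v w) (fun w => by simp) (fun v => by simp) hf' hgc
  -- `f` is replaced, up to `ε` and with supports inside the fixed compact set `K'`, by a finite sum
  -- of scalar functions times vectors, for which the formula is `IsProd.integral_smul`. The bracket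
  -- collects the errors of the two sides and does not depend on `ε`.
  have key : ∀ ε > 0, ‖κ.integral (fun x => β (f x.1) (g x.2)) - β (μ.integral f) (ν.integral g)‖ ≤
      ε * (‖β‖ * M * @MeasureTheory.Measure.real _ (borel _) κ.measure (K' ×ˢ tsupport g)
        + ‖β‖ * @MeasureTheory.Measure.real _ (borel _) μ.measure K' * ‖ν.integral g‖) := by
    intro ε hε
    obtain ⟨s, φ, -, hφc, hφ0, hφ⟩ := hfc.isCompact.exists_partition_approx hfK'
      f (fun x _ => f x) hε.le fun x _ => by
        have h : Filter.Tendsto (fun y => ‖f y - f x‖) (𝓝 x) (𝓝 0) :=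
          tendsto_iff_norm_sub_tendsto_zero.1 (hf.tendsto x)
        exact h.eventually (gt_mem_nhds hε)
    have hφ' : ∀ y, ‖f y - ∑ x ∈ s, φ x y • f x‖ ≤ ε := fun y => by
      refine hφ y ?_
      by_cases hy : y ∈ tsupport f
      · exact Or.inl hy
      · exact Or.inr (image_eq_zero_of_notMem_tsupport hy)
    have h0 : ∀ y ∉ K', f y - ∑ x ∈ s, φ x y • f x = 0 := fun y hy => by
      rw [Finset.sum_eq_zero fun x hx => by rw [hφ0 x hx y hy, zero_smul], sub_zero]
      exact image_eq_zero_of_notMem_tsupport fun h => hy (interior_subset (hfK' h))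
    have hcont : Continuous fun y => ∑ x ∈ s, φ x y • f x := by fun_prop
    have hcc : HasCompactSupport fun y => ∑ x ∈ s, φ x y • f x :=
      HasCompactSupport.intro hK' fun y hy =>
        Finset.sum_eq_zero fun x hx => by rw [hφ0 x hx y hy, zero_smul]
    have hsum : κ.integral (fun x => β (∑ i ∈ s, φ i x.1 • f i) (g x.2)) =
        β (μ.integral fun y => ∑ x ∈ s, φ x y • f x) (ν.integral g) := by
      have h1 : ∀ i ∈ s, HasCompactSupport fun y : G × H => φ i y.1 • β (f i) (g y.2) :=
        fun i hi => HasCompactSupport.bilin (fun (a : ℝ) (w : W) => a • β (f i) w)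
          (fun _ => zero_smul _ _) (fun _ => by simp) (hφc i hi) hgc
      rw [μ.integral_sum (f := fun i y => φ i y • f i) s (fun i _ => by fun_prop)
        (fun i hi => (hφc i hi).smul_right), map_sum]
      simp only [map_sum, map_smul, sum_apply, smul_apply]
      rw [κ.integral_sum s (fun i _ => by fun_prop) h1]
      refine Finset.sum_congr rfl fun i hi => ?_
      rw [μ.integral_smul_const (φ i).continuous (hφc i hi), map_smul,
        smul_apply, ← ν.integral_clm (β (f i)) hg hgc]
      exact hκ.integral_smul (φ i).continuous (hφc i hi) (by fun_prop)
        (hgc.comp_left (map_zero (β (f i))))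
    have e1 : κ.integral (fun x => β (f x.1) (g x.2)) - β (μ.integral f) (ν.integral g) =
        κ.integral (fun x => β (f x.1 - ∑ i ∈ s, φ i x.1 • f i) (g x.2)) -
          β (μ.integral fun y => f y - ∑ x ∈ s, φ x y • f x) (ν.integral g) := by
      rw [μ.integral_sub hf hfc hcont hcc]
      simp only [map_sub, sub_apply]
      rw [κ.integral_sub (by fun_prop) (hsupp hfc) (by fun_prop) (hsupp hcc), hsum]
      abel
    rw [e1]
    refine (norm_sub_le _ _).trans ?_
    rw [mul_add]
    refine add_le_add ?_ ?_
    · refine (κ.norm_integral_le (M := ‖β‖ * ε * M) (hK'.prod hgc.isCompact) (fun x => ?_)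
        fun x hx => ?_).trans_eq (by ring)
      · refine (β.le_opNorm₂ _ _).trans ?_
        gcongr
        · exact hφ' _
        · exact hM _
      · rw [Set.mem_prod, not_and_or] at hx
        rcases hx with hx | hx
        · simp only [h0 _ hx, map_zero, zero_apply]
        · simp only [image_eq_zero_of_notMem_tsupport hx, map_zero]
    · refine (β.le_opNorm₂ _ _).trans ?_
      have := μ.norm_integral_le hK' hφ' h0
      calc _ ≤ ‖β‖ * (ε * @MeasureTheory.Measure.real _ (borel _) μ.measure K')
            * ‖ν.integral g‖ := by gcongr
        _ = _ := by ring
  refine sub_eq_zero.1 (norm_le_zero_iff.1 ?_)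
  set c := ‖β‖ * M * @MeasureTheory.Measure.real _ (borel _) κ.measure (K' ×ˢ tsupport g)
        + ‖β‖ * @MeasureTheory.Measure.real _ (borel _) μ.measure K' * ‖ν.integral g‖
  have hlim : Filter.Tendsto (fun ε : ℝ => ε * c) (𝓝[>] 0) (𝓝 0) := by
    have : Filter.Tendsto (fun ε : ℝ => ε * c) (𝓝 0) (𝓝 (0 * c)) :=
      (continuous_id.mul continuous_const).tendsto 0
    rw [zero_mul] at this
    exact this.mono_left nhdsWithin_le_nhds
  exact ge_of_tendsto hlim (Filter.eventually_of_mem self_mem_nhdsWithin fun ε hε => key ε hε)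

/-- The modular function of a product. -/
theorem IsProd.modular_prod [IsTopologicalGroup G] [LocallyCompactSpace G] [T2Space G]
    [IsTopologicalGroup H] [LocallyCompactSpace H] [T2Space H] (hκ : μ.IsProd ν κ) (t : G) (s : H) :
    FellBundle.modular (t, s) = FellBundle.modular t * FellBundle.modular s := by
  -- The translated product function `f ⊗ g` is integrated both over `G × H` and factor by factor;
  -- since `∫ f` and `∫ g` are nonzero, the modular factors can be compared.
  obtain ⟨⟨f, hf⟩, hfc, hf0, hf1⟩ :
    ∃ f : C(G, ℝ), HasCompactSupport f ∧ 0 ≤ f ∧ f 1 ≠ 0 := exists_continuous_nonneg_pos 1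
  obtain ⟨⟨g, hg⟩, hgc, hg0, hg1⟩ :
    ∃ g : C(H, ℝ), HasCompactSupport g ∧ 0 ≤ g ∧ g 1 ≠ 0 := exists_continuous_nonneg_pos 1
  have hF := (μ.integral_pos hf hfc hf0 hf1).ne'
  have hG := (ν.integral_pos hg hgc hg0 hg1).ne'
  have h1 := κ.integral_mul_right (f := fun x => f x.1 * g x.2) (by fun_prop)
    (HasCompactSupport.bilin (fun (a b : ℝ) => a * b) zero_mul mul_zero hfc hgc) (t, s)
  have h2 := hκ (fun x => f (x * t)) (fun x => g (x * s)) (by fun_prop)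
    (hfc.comp_homeomorph (Homeomorph.mulRight t)) (by fun_prop)
    (hgc.comp_homeomorph (Homeomorph.mulRight s))
  rw [hκ f g hf hfc hg hgc] at h1
  have h3 := h1.symm.trans h2
  rw [μ.integral_mul_right hf hfc, ν.integral_mul_right hg hgc] at h3
  simp only [smul_eq_mul] at h3
  have h4 : (FellBundle.modular (t, s))⁻¹ = (FellBundle.modular t * FellBundle.modular s)⁻¹ := by
    rw [mul_inv]
    refine mul_right_cancel₀ (mul_ne_zero hF hG) ?_
    rw [h3]; ring
  exact inv_injective h4

end HaarMeasure


/-! ### The Hilbert modules `L²_t(𝒜)` -/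

namespace FellBundle

variable {G : Type*} [Group G] [TopologicalSpace G] (A : FellBundle G)

theorem mul_zero' {r s t : G} (h : r * s = t) (a : A.Fiber r) : A.mul h a 0 = 0 := by
  have := A.mul_smul h 0 a 0
  rwa [zero_smul, zero_smul] at this

/-- The multiplication by a fixed element on the right. -/
def mulRightL {r s t : G} (h : r * s = t) (b : A.Fiber s) : A.Fiber r →L[ℂ] A.Fiber t :=
  LinearMap.mkContinuous
    { toFun := fun a => A.mul h a b
      map_add' := fun a a' => A.add_mul h a a' b
      map_smul' := fun c a => A.smul_mul h c a b } ‖b‖ fun a => by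
    rw [mul_comm]; exact A.norm_mul_le h a b

theorem mul_castFiber_left {t : G} (h : 1 = t) (b a : A.Fiber 1) :
    A.mul (mul_one t) (castFiber h b) a = castFiber h (b * a) := by
  subst h; rfl

theorem castFiber_eq_zero {s t : G} (h : s = t) {a : A.Fiber s} (ha : castFiber h a = 0) :
    a = 0 := by
  subst h; exact ha

theorem star_castFiber_mul {s t : G} (h : s = t) (a b : A.Fiber s) :
    A.mul (inv_mul_cancel t) (A.star rfl (castFiber h a)) (castFiber h b) =
      A.mul (inv_mul_cancel s) (A.star rfl a) b := by
  subst h; rfl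

variable [IsTopologicalGroup G] {r : G}

theorem norm_pairing_self (ξ : A.Cc r) (u : G) : ‖A.pairing ξ ξ u‖ = ‖ξ.1 u‖ ^ 2 :=
  A.norm_star_mul_self _ _ _

theorem continuous_norm_cc (ξ : A.Cc r) : Continuous fun u => ‖ξ.1 u‖ :=
  A.continuous_norm.comp ξ.2.1

theorem exists_norm_cc_le [T2Space G] (ξ : A.Cc r) : ∃ M, 0 ≤ M ∧ ∀ u, ‖ξ.1 u‖ ≤ M := by
  obtain ⟨K, hK, hK'⟩ := ξ.2.2
  obtain ⟨M, hM⟩ := (A.continuous_norm_cc ξ).bounded_above_of_compact_support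
    (HasCompactSupport.intro hK fun u hu => by rw [hK' u hu, norm_zero])
  exact ⟨M, (norm_nonneg _).trans (hM 1), fun u => by simpa using hM u⟩

theorem ccSmul_apply (φ : C(G, ℝ)) (ξ : A.Cc r) (u : G) :
    (A.ccSmul φ ξ).1 u = (φ u : ℂ) • ξ.1 u := rfl

theorem ccSmul_zero (φ : C(G, ℝ)) : A.ccSmul φ (0 : A.Cc r) = 0 :=
  Subtype.ext <| funext fun _ => smul_zero _

theorem ccSmul_add (φ : C(G, ℝ)) (ξ η : A.Cc r) :
    A.ccSmul φ (ξ + η) = A.ccSmul φ ξ + A.ccSmul φ η :=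
  Subtype.ext <| funext fun _ => smul_add _ _ _

theorem cc_sum_apply {ι : Type*} (s : Finset ι) (ξ : ι → A.Cc r) (u : G) :
    (∑ i ∈ s, ξ i).1 u = ∑ i ∈ s, (ξ i).1 u := by
  rw [← Finset.sum_apply]
  exact congrFun (Submodule.coe_sum _ _ _) u

section Translation

variable [LocallyCompactSpace G]

theorem modular_pos (t : G) : 0 < modular t :=
  inv_pos.2 (NNReal.coe_pos.2 (MeasureTheory.Measure.modularCharacterFun_pos t))

/-- `ρ_t` as a linear map. -/
def rhoₗ (t : G) : A.Cc 1 →ₗ[ℂ] A.Cc t where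
  toFun := A.rho t
  map_add' ξ η := Subtype.ext <| funext fun u => by
    have h : ∀ {s v : G} (h : s = v) (a b : A.Fiber s),
        castFiber h (a + b) = castFiber h a + castFiber h b := by rintro s _ rfl a b; rfl
    exact (congrArg _ (h (mul_one (u * t)) _ _)).trans (smul_add _ _ _)
  map_smul' c ξ := Subtype.ext <| funext fun u => by
    have h : ∀ {s v : G} (h : s = v) (a : A.Fiber s),
        castFiber h (c • a) = c • castFiber h a := by rintro s _ rfl a; rfl
    exact (congrArg _ (h (mul_one (u * t)) _)).trans (smul_comm _ _ _)

theorem pairing_rho (t : G) (ξ η : A.Cc 1) (u : G) :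
    A.pairing (A.rho t ξ) (A.rho t η) u = modular t • A.pairing ξ η (u * t) := by
  have h : ∀ (c : ℝ) (a b : A.Fiber (u * t * 1)),
      A.mul (inv_mul_cancel (u * t)) (A.star rfl ((c : ℂ) • castFiber (mul_one (u * t)) a))
        ((c : ℂ) • castFiber (mul_one (u * t)) b) =
      (c * c) • A.mul (inv_mul_cancel (u * t * 1)) (A.star rfl a) b := by
    intro c a b
    rw [A.star_smul, A.smul_mul, A.mul_smul, Complex.conj_ofReal, smul_smul, A.star_castFiber_mul,
      ← Complex.ofReal_mul, Complex.coe_smul]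
  refine (h _ _ _).trans ?_
  rw [Real.mul_self_sqrt (modular_pos t).le]
  rfl

/-- The preimage of `η` is `u ↦ Δ(t)^{-1/2} η(u t⁻¹)`; the rest identifies the fibres over equal
base points. -/
theorem rho_surjective (t : G) : Function.Surjective (A.rho t) := by
  intro η
  have hc : √(modular t) ≠ 0 := (Real.sqrt_pos.2 (modular_pos t)).ne'
  have hb : ∀ u : G, u * t⁻¹ * t = u * 1 := fun u => by group
  have h0 : ∀ {s v : G} (h : s = v), castFiber h (0 : A.Fiber s) = 0 := by
    rintro s _ rfl; rfl
  refine ⟨⟨fun u => (((√(modular t))⁻¹ : ℝ) : ℂ) • castFiber (hb u) (η.1 (u * t⁻¹)), ?_, ?_⟩, ?_⟩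
  · refine (A.continuous_smul _).comp
      (f := fun u => (⟨u * 1, castFiber (hb u) (η.1 (u * t⁻¹))⟩ : A.Total)) ?_
    simp only [castFiber_mk]
    exact η.2.1.comp (continuous_mul_const t⁻¹)
  · obtain ⟨K, hK, hK'⟩ := η.2.2
    refine ⟨(· * t) '' K, hK.image (continuous_mul_const t), fun u hu => ?_⟩
    have : u * t⁻¹ ∉ K := fun h => hu ⟨u * t⁻¹, h, inv_mul_cancel_right u t⟩
    simp only [hK' _ this, h0, smul_zero]
  · refine Subtype.ext (funext fun u => ?_)
    change ((√(modular t) : ℝ) : ℂ) • castFiber (mul_one (u * t))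
      ((((√(modular t))⁻¹ : ℝ) : ℂ) • castFiber (hb (u * t)) (η.1 (u * t * t⁻¹))) = η.1 u
    have h : ∀ {s v w : G} (h₁ : s = v) (h₂ : v = w) (h₃ : s = w) (c : ℂ) (a : A.Fiber s),
        castFiber h₂ (c • castFiber h₁ a) = c • castFiber h₃ a := by
      rintro s _ _ rfl rfl _ c a; rfl
    have h' : ∀ {v : G} (hv : v = u) (h : v * t = u * t), castFiber h (η.1 v) = η.1 u := by
      rintro _ rfl _; rfl
    rw [h (hb (u * t)) (mul_one (u * t)) (by group), h' (mul_inv_cancel_right u t), smul_smul,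
      ← Complex.ofReal_mul, mul_inv_cancel₀ hc, Complex.ofReal_one, one_smul]

end Translation

variable [T2Space G] (μ : HaarMeasure G)

theorem inner_toL2 (ξ η : A.Cc r) :
    HilbertModule.inner (A.toL2 μ ξ) (A.toL2 μ η) = μ.integral (A.pairing ξ η) :=
  (A.preL2 μ r).inner_toCompl ξ η

theorem norm_toL2_sq_le (ζ : A.Cc r) {K : Set G} (hK : IsCompact K) {ε : ℝ}
    (h : ∀ u ∈ K, ‖ζ.1 u‖ ≤ ε) (h0 : ∀ u ∉ K, ζ.1 u = 0) :
    ‖A.toL2 μ ζ‖ ^ 2 ≤ ε ^ 2 * @MeasureTheory.Measure.real G (borel G) μ.measure K := by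
  rw [(A.preL2 μ r).norm_sq_toCompl]
  refine μ.norm_integral_le hK (fun u => ?_) fun u hu => ?_
  · rw [norm_pairing_self]
    by_cases hu : u ∈ K
    · exact pow_le_pow_left₀ (norm_nonneg _) (h u hu) 2
    · rw [h0 u hu, norm_zero, zero_pow two_ne_zero]
      exact sq_nonneg ε
  · rw [pairing, h0 u hu, mul_zero']

/-- Uniform limits of sections with supports in a fixed compact set are limits in `L²`. -/
theorem toL2_mem_of_approx {M : Set (A.L2 μ r)} (hM : IsClosed M) (ζ : A.Cc r) {K : Set G}
    (hK : IsCompact K) (hζ : ∀ u ∉ K, ζ.1 u = 0)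
    (h : ∀ ε > 0, ∃ z : A.Cc r, A.toL2 μ z ∈ M ∧ (∀ u ∈ K, ‖ζ.1 u - z.1 u‖ ≤ ε) ∧
      ∀ u ∉ K, z.1 u = 0) : A.toL2 μ ζ ∈ M := by
  rw [← hM.closure_eq, Metric.mem_closure_iff]
  intro δ hδ
  set c := @MeasureTheory.Measure.real G (borel G) μ.measure K
  have hc : 0 ≤ c := MeasureTheory.measureReal_nonneg
  -- `K` may have measure zero, so `δ` is divided by `c + 1`, and `c < (c + 1)²` gives the
  -- inequality.
  obtain ⟨ε, hε, hεδ⟩ : ∃ ε > 0, ε ^ 2 * c < δ ^ 2 := by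
    refine ⟨δ / (c + 1), by positivity, ?_⟩
    rw [div_pow, div_mul_eq_mul_div, div_lt_iff₀ (by positivity)]
    refine mul_lt_mul_of_pos_left ?_ (by positivity)
    nlinarith
  obtain ⟨z, hz, hz1, hz0⟩ := h ε hε
  refine ⟨_, hz, ?_⟩
  rw [dist_eq_norm, ← map_sub]
  refine lt_of_pow_lt_pow_left₀ 2 hδ.le ((A.norm_toL2_sq_le μ (ζ - z) hK hz1 ?_).trans_lt hεδ)
  intro u hu
  change ζ.1 u - z.1 u = 0
  rw [hζ u hu, hz0 u hu, sub_zero]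

theorem inner_ccAct (ξ η : A.Cc r) (a : A.Fiber 1) :
    (A.preL2 μ r).inner ξ (A.ccAct η a) = (A.preL2 μ r).inner ξ η * a := by
  refine Eq.trans ?_ (μ.integral_clm ((ContinuousLinearMap.mul ℝ (A.Fiber 1)).flip a)
    (A.continuous_pairing ξ η) (A.hasCompactSupport_pairing ξ η))
  exact congrArg μ.integral (funext fun u => A.pairing_ccAct ξ η a u)

/-- By Cauchy–Schwarz `⟨ζ, φ ζ⟩ = 0` for every continuous real `φ`. Taking `φ = ℓ(ζ* ζ)` for a real
functional `ℓ` makes `ℓ(ζ* ζ)²` a nonnegative continuous function of integral zero, so every `ℓ(ζ*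
ζ)` vanishes. -/
theorem eq_zero_of_inner_self (ζ : A.Cc r) (h : (A.preL2 μ r).inner ζ ζ = 0) (u : G) :
    ζ.1 u = 0 := by
  have hφ : ∀ φ : C(G, ℝ), μ.integral (fun u => φ u • A.pairing ζ ζ u) = 0 := by
    intro φ
    have h1 := (A.preL2 μ r).norm_inner_sq_le ζ (A.ccSmul φ ζ)
    rw [h, norm_zero, zero_mul] at h1
    have h2 := norm_eq_zero.1 (pow_eq_zero_iff two_ne_zero |>.1 (h1.antisymm (sq_nonneg _)))
    refine Eq.trans (congrArg μ.integral (funext fun u => ?_)) h2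
    exact (Complex.coe_smul _ _).symm.trans (A.mul_smul _ _ _ _).symm
  have hp : A.pairing ζ ζ u = 0 := by
    refine HaarMeasure.eq_of_forall_dual fun ℓ => ?_
    rw [map_zero]
    by_contra hne
    have hc : Continuous fun u => ℓ (A.pairing ζ ζ u) := ℓ.continuous.comp (A.continuous_pairing ζ ζ)
    have hcc : HasCompactSupport fun u => ℓ (A.pairing ζ ζ u) :=
      (A.hasCompactSupport_pairing ζ ζ).comp_left (map_zero ℓ)
    have h1 := μ.integral_pos (φ := fun u => ℓ (A.pairing ζ ζ u) * ℓ (A.pairing ζ ζ u))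
      (hc.mul hc) hcc.mul_right (fun u => mul_self_nonneg _) (mul_ne_zero hne hne)
    have h2 := μ.integral_clm ℓ (f := fun u => ℓ (A.pairing ζ ζ u) • A.pairing ζ ζ u)
      (hc.smul (A.continuous_pairing ζ ζ)) hcc.smul_right
    replace h2 := h2.trans ((congrArg ℓ (hφ ⟨_, hc⟩)).trans (map_zero ℓ))
    simp only [map_smul, smul_eq_mul] at h2
    exact h1.ne' h2
  rw [← norm_eq_zero, ← pow_eq_zero_iff two_ne_zero, ← A.norm_pairing_self, hp, norm_zero]

/-- If `a` annihilates `L²_r`, then `ξ(u) a = 0` for all sections and points. At `u = r⁻¹` the fibre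
is `A_e`, where the values `ξ(u)` are dense, and `a* a = 0` follows. -/
theorem isFaithful_L2 [LocallyCompactSpace G] (r : G) :
    HilbertModule.IsFaithful (A.Fiber 1) (A.L2 μ r) := by
  intro a ha
  have h1 : ∀ (ξ : A.Cc r) (u : G), A.mul (mul_one _) (ξ.1 u) a = 0 := by
    intro ξ u
    refine A.eq_zero_of_inner_self μ (A.ccAct ξ a) ?_ u
    rw [inner_ccAct, ← (A.preL2 μ r).inner_toCompl, ← HilbertModule.inner_act, ha,
      HilbertModule.inner_zero_right]
  have h2 : ∀ b : A.Fiber (r⁻¹ * r), A.mul (mul_one _) b a = 0 := by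
    intro b
    refine (A.denseRange_cc_apply r r⁻¹).induction_on
      (p := fun b => A.mulRightL (mul_one (r⁻¹ * r)) a b = 0) b
      (isClosed_eq (ContinuousLinearMap.continuous _) continuous_const) fun ξ => h1 ξ r⁻¹
  have h3 := h2 (castFiber (inv_mul_cancel r).symm (Star.star a))
  rw [mul_castFiber_left] at h3
  have h4 : Star.star a * a = 0 := A.castFiber_eq_zero _ h3
  exact (CStarRing.star_mul_self_eq_zero_iff a).1 h4

/-- The factor `Δ(t)` from the two square roots in `pairing_rho` cancels the factor `Δ(t)⁻¹` of
right translation. -/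
theorem exists_extendsRho [LocallyCompactSpace G] (t : G) :
    ∃ U : HilbertModule.Iso (A.L2 μ 1) (A.L2 μ t), A.ExtendsRho μ U := by
  refine HilbertModule.exists_iso_of_denseRange (A.toL2 μ) ((A.toL2 μ).comp (A.rhoₗ t))
    (A.preL2 μ 1).denseRange_toCompl ?_ fun ξ η => ?_
  · change Dense (Set.range (A.toL2 μ ∘ A.rho t))
    rw [(A.rho_surjective t).range_comp]
    exact (A.preL2 μ t).denseRange_toCompl
  · refine (A.inner_toL2 μ ξ η).trans (Eq.trans ?_ (A.inner_toL2 μ (A.rho t ξ) (A.rho t η)).symm)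
    rw [funext fun u => A.pairing_rho t ξ η u]
    refine Eq.trans ?_ (μ.integral_mul_right (f := fun u => modular t • A.pairing ξ η u)
      ((A.continuous_pairing ξ η).const_smul _)
      (A.hasCompactSupport_pairing ξ η).smul_left t).symm
    refine Eq.trans ?_ (congrArg ((modular t)⁻¹ • ·)
      (μ.integral_clm (modular t • ContinuousLinearMap.id ℝ (A.Fiber 1))
        (A.continuous_pairing ξ η) (A.hasCompactSupport_pairing ξ η)).symm)
    exact (inv_smul_smul₀ (modular_pos t).ne' _).symm

end FellBundle


/-! ### The sections `ξ ⊘ η` and their density -/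

namespace FellTensor

variable {G H : Type*} [Group G] [TopologicalSpace G] [Group H] [TopologicalSpace H]
  {α : TensorKind} {A : FellBundle G} {B : FellBundle H} {C : FellBundle (G × H)}
  (T : FellTensor α A B C)

/-- The C⋆-identity moves the estimate to `a* a ⊗ b* b` in the unit fibre, where the general bound
for `*`-homomorphisms on `A_e ⊙ B_e` applies. -/
theorem norm_tmul_le {t : G} {s : H} {w : G × H} (hw : (t, s) = w) (a : A.Fiber t)
    (b : B.Fiber s) : ‖T.tmul hw a b‖ ≤ ‖a‖ * ‖b‖ := by
  subst hw
  refine (pow_le_pow_iff_left₀ (norm_nonneg _) (by positivity) two_ne_zero).1 ?_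
  rw [← C.norm_star_mul_self rfl (inv_mul_cancel _), T.star_tmul rfl rfl rfl rfl rfl,
    T.tmul_mul_tmul (w'' := 1) (inv_mul_cancel t) (inv_mul_cancel s), mul_pow,
    ← A.norm_star_mul_self rfl (inv_mul_cancel t), ← B.norm_star_mul_self rfl (inv_mul_cancel s)]
  exact norm_map_tmul_le T.unitHom _ _

theorem smul_tmul_smul {t : G} {s : H} {w : G × H} (hw : (t, s) = w) (c d : ℂ) (a : A.Fiber t)
    (b : B.Fiber s) : T.tmul hw (c • a) (d • b) = (c * d) • T.tmul hw a b := by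
  rw [LinearMap.map_smul₂, map_smul, smul_smul]

/-- The bounded bilinear map `(a, b) ↦ a ⊗ b`. -/
def tmulL {t : G} {s : H} {w : G × H} (hw : (t, s) = w) :
    A.Fiber t →L[ℂ] B.Fiber s →L[ℂ] C.Fiber w :=
  LinearMap.mkContinuous₂ (T.tmul hw) 1 fun a b => by
    rw [one_mul]; exact T.norm_tmul_le hw a b

variable [IsTopologicalGroup G] [IsTopologicalGroup H] {r : G} {s : H}

/-- `(ξ, η) ↦ ξ ⊘ η` as a bilinear map. -/
def oslashₗ (r : G) (s : H) : A.Cc r →ₗ[ℂ] B.Cc s →ₗ[ℂ] C.Cc (r, s) :=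
  LinearMap.mk₂ ℂ T.oslash
    (fun _ _ _ => Subtype.ext <| funext fun _ => (T.tmul rfl).map_add₂ _ _ _)
    (fun _ _ _ => Subtype.ext <| funext fun _ => (T.tmul rfl).map_smul₂ _ _ _)
    (fun _ _ _ => Subtype.ext <| funext fun _ => map_add (T.tmul rfl _) _ _)
    (fun _ _ _ => Subtype.ext <| funext fun _ => map_smul (T.tmul rfl _) _ _)

theorem oslash_mem_range (ξ : A.Cc r) (η : B.Cc s) :
    T.oslash ξ η ∈ LinearMap.range (TensorProduct.lift (T.oslashₗ r s)) :=
  ⟨ξ ⊗ₜ[ℂ] η, rfl⟩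

theorem pairing_oslash (ξ ξ' : A.Cc r) (η η' : B.Cc s) (x : G × H) :
    C.pairing (T.oslash ξ η) (T.oslash ξ' η') x =
      T.tmul rfl (A.pairing ξ ξ' x.1) (B.pairing η η' x.2) := by
  refine (congrArg (fun c => C.mul (inv_mul_cancel (x * (r, s))) c _)
    (T.star_tmul rfl rfl rfl rfl rfl (ξ.1 x.1) (η.1 x.2))).trans ?_
  exact T.tmul_mul_tmul _ _ _ _ _ _ _ _ _ _

theorem ccSmul_oslash (φ : C(G, ℝ)) (ψ : C(H, ℝ)) (ξ : A.Cc r) (η : B.Cc s) (x : G × H) :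
    (T.oslash (A.ccSmul φ ξ) (B.ccSmul ψ η)).1 x =
      ((φ x.1 * ψ x.2 : ℝ) : ℂ) • (T.oslash ξ η).1 x := by
  change T.tmul rfl ((φ x.1 : ℂ) • ξ.1 x.1) ((ψ x.2 : ℂ) • η.1 x.2) =
    ((φ x.1 * ψ x.2 : ℝ) : ℂ) • T.tmul rfl (ξ.1 x.1) (η.1 x.2)
  rw [T.smul_tmul_smul, Complex.ofReal_mul]

variable [T2Space G] [T2Space H] {μ : HaarMeasure G} {ν : HaarMeasure H} {κ : HaarMeasure (G × H)}

/-- The integrand is `ξ* ξ' ⊗ η* η'`, a bounded bilinear map of a function on `G` and a function on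
`H`, so Fubini applies. -/
theorem inner_toL2_oslash [LocallyCompactSpace G] (hκ : μ.IsProd ν κ) (ξ ξ' : A.Cc r)
    (η η' : B.Cc s) :
    HilbertModule.inner (C.toL2 κ (T.oslash ξ η)) (C.toL2 κ (T.oslash ξ' η')) =
      T.unitHom ((HilbertModule.inner (A.toL2 μ ξ) (A.toL2 μ ξ') : A.Fiber 1) ⊗ₜ[ℂ]
        (HilbertModule.inner (B.toL2 ν η) (B.toL2 ν η') : B.Fiber 1)) := by
  rw [C.inner_toL2, A.inner_toL2, B.inner_toL2]
  refine Eq.trans ?_ (hκ.integral_bilin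
    ((ContinuousLinearMap.restrictScalarsL ℂ _ _ ℝ ℝ).comp
      ((T.tmulL (rfl : ((1 : G), (1 : H)) = 1)).restrictScalars ℝ))
    (A.continuous_pairing ξ ξ') (A.hasCompactSupport_pairing ξ ξ')
    (B.continuous_pairing η η') (B.hasCompactSupport_pairing η η'))
  exact congrArg κ.integral (funext fun x => T.pairing_oslash ξ ξ' η η' x)

variable (r s)

/-- The closed span of the sections `ξ ⊘ η` in `L²`. -/
def oslashClosure (κ : HaarMeasure (G × H)) : Submodule ℂ (C.L2 κ (r, s)) :=
  ((LinearMap.range (TensorProduct.lift (T.oslashₗ r s))).map (C.toL2 κ)).topologicalClosure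

variable {r s}

theorem toL2_mem_oslashClosure {z : C.Cc (r, s)}
    (hz : z ∈ LinearMap.range (TensorProduct.lift (T.oslashₗ r s))) :
    C.toL2 κ z ∈ T.oslashClosure r s κ :=
  Submodule.le_topologicalClosure _ (Submodule.mem_map_of_mem hz)

theorem isClosed_oslashClosure :
    IsClosed (T.oslashClosure r s κ : Set (C.L2 κ (r, s))) :=
  Submodule.isClosed_topologicalClosure _

/-- Read as the map `g ↦ φ(g, ·)` into `C(L)`, `φ` is uniformly close on `K × L` to finite sums `∑
f_i(g) φ(i, h)`. Such a sum times `ξ ⊘ η` is the sum of the sections `f_i ξ ⊘ φ(i, ·) η`. -/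
theorem ccSmul_oslash_mem [LocallyCompactSpace G] (φ : C(G × H, ℝ)) (ξ : A.Cc r) (η : B.Cc s) :
    C.toL2 κ (C.ccSmul φ (T.oslash ξ η)) ∈ T.oslashClosure r s κ := by
  obtain ⟨K, hK, hξK⟩ := ξ.2.2
  obtain ⟨L, hL, hηL⟩ := η.2.2
  obtain ⟨a, ha, hξa⟩ := A.exists_norm_cc_le ξ
  obtain ⟨b, hb, hηb⟩ := B.exists_norm_cc_le η
  have h0 : ∀ x ∉ K ×ˢ L, (T.oslash ξ η).1 x = 0 := by
    intro x hx
    change T.tmul rfl (ξ.1 x.1) (η.1 x.2) = 0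
    rw [Set.mem_prod, not_and_or] at hx
    rcases hx with hx | hx
    · rw [hξK _ hx, map_zero, LinearMap.zero_apply]
    · rw [hηL _ hx, map_zero]
  refine C.toL2_mem_of_approx κ T.isClosed_oslashClosure _ (hK.prod hL) (fun x hx => ?_)
    fun ε hε => ?_
  · rw [C.ccSmul_apply, h0 x hx, smul_zero]
  have : CompactSpace L := isCompact_iff_compactSpace.1 hL
  -- `‖ξ ⊘ η‖` is bounded by `a * b`, which may be zero.
  set δ := ε / (a * b + 1)
  have hδ : 0 < δ := by positivity
  let Z : G → C(L, ℝ) := fun g => (φ.curry g).restrict L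
  have hZ : Continuous Z := (ContinuousMap.continuous_restrict L).comp φ.curry.continuous
  -- The supports of the weights need no control here, because `ξ ⊘ η` already vanishes off `K × L`.
  obtain ⟨K', -, hKK'⟩ := exists_compact_superset hK
  obtain ⟨I, f, -, -, -, hf⟩ := hK.exists_partition_approx hKK' Z (fun x _ => Z x) hδ.le
    fun x _ => (tendsto_iff_norm_sub_tendsto_zero.1 (hZ.tendsto x)).eventually (gt_mem_nhds hδ)
  have hsum : ∀ x, (∑ i ∈ I, T.oslash (A.ccSmul (f i) ξ) (B.ccSmul (φ.curry i) η)).1 x =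
      ((∑ i ∈ I, f i x.1 * φ (i, x.2) : ℝ) : ℂ) • (T.oslash ξ η).1 x := by
    intro x
    rw [C.cc_sum_apply, Complex.ofReal_sum, Finset.sum_smul]
    exact Finset.sum_congr rfl fun i _ => T.ccSmul_oslash _ _ _ _ _
  refine ⟨∑ i ∈ I, T.oslash (A.ccSmul (f i) ξ) (B.ccSmul (φ.curry i) η),
    T.toL2_mem_oslashClosure (Submodule.sum_mem _ fun i _ => T.oslash_mem_range _ _),
    fun x hx => ?_, fun x hx => ?_⟩
  · rw [hsum, C.ccSmul_apply, ← sub_smul, ← Complex.ofReal_sub, norm_smul, Complex.norm_real]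
    have h1 := (ContinuousMap.norm_coe_le_norm (Z x.1 - ∑ i ∈ I, f i x.1 • Z i)
      ⟨x.2, hx.2⟩).trans (hf x.1 (Or.inl hx.1))
    have h2 : (Z x.1 - ∑ i ∈ I, f i x.1 • Z i) ⟨x.2, hx.2⟩ =
        φ x - ∑ i ∈ I, f i x.1 * φ (i, x.2) := by
      rw [ContinuousMap.sub_apply, ContinuousMap.sum_apply]
      rfl
    rw [h2] at h1
    calc _ ≤ δ * (a * b) := by
          refine mul_le_mul h1 ?_ (norm_nonneg _) hδ.le
          exact (T.norm_tmul_le _ _ _).trans (mul_le_mul (hξa _) (hηb _) (norm_nonneg _) ha)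
      _ ≤ δ * (a * b + 1) := by gcongr; linarith
      _ = ε := div_mul_cancel₀ _ (by positivity)
  · rw [hsum, h0 x hx, smul_zero]

theorem ccSmul_mem [LocallyCompactSpace G] (φ : C(G × H, ℝ)) (z : A.Cc r ⊗[ℂ] B.Cc s) :
    C.toL2 κ (C.ccSmul φ (TensorProduct.lift (T.oslashₗ r s) z)) ∈ T.oslashClosure r s κ := by
  induction z with
  | zero => rw [map_zero, C.ccSmul_zero, map_zero]; exact zero_mem _
  | tmul ξ η => exact T.ccSmul_oslash_mem φ ξ η
  | add z w hz hw => rw [map_add, C.ccSmul_add, map_add]; exact add_mem hz hw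

/-- Elementary tensors `a ⊗ b` span a dense subspace of the fibre, and `a` and `b` are limits of
values of sections of the two factors. -/
theorem denseRange_oslash_apply [LocallyCompactSpace G] [LocallyCompactSpace H] (x : G × H) :
    DenseRange fun z : A.Cc r ⊗[ℂ] B.Cc s => (TensorProduct.lift (T.oslashₗ r s) z).1 x := by
  let N : Submodule ℂ (C.Fiber (x * (r, s))) := LinearMap.range
    ((LinearMap.proj x).comp ((C.Cc (r, s)).subtype.comp (TensorProduct.lift (T.oslashₗ r s))))
  change Dense (N : Set (C.Fiber (x * (r, s))))
  rw [Submodule.dense_iff_topologicalClosure_eq_top, eq_top_iff,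
    ← (Submodule.dense_iff_topologicalClosure_eq_top).1
      (T.dense_span (t := x.1 * r) (s := x.2 * s) (w := x * (r, s)) rfl)]
  refine Submodule.topologicalClosure_minimal _ (Submodule.span_le.2 ?_)
    (Submodule.isClosed_topologicalClosure _)
  rintro _ ⟨a, b, rfl⟩
  refine mem_of_dense_span (T.tmul (t := x.1 * r) (s := x.2 * s) (w := x * (r, s)) rfl)
    (fun w => ((T.tmulL rfl).flip w).continuous) (fun v => (T.tmulL rfl v).continuous)
    ((A.denseRange_cc_apply r x.1).mono Submodule.subset_span)
    ((B.denseRange_cc_apply s x.2).mono Submodule.subset_span) _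
    (Submodule.isClosed_topologicalClosure _) ?_ a b
  rintro _ ⟨ξ, rfl⟩ _ ⟨η, rfl⟩
  exact Submodule.le_topologicalClosure _ ⟨ξ ⊗ₜ[ℂ] η, rfl⟩

/-- The span of the sections `ξ ⊘ η` is dense in `L²`. -/
theorem denseRange_toL2_oslash [LocallyCompactSpace G] [LocallyCompactSpace H] :
    DenseRange ((C.toL2 κ).comp (TensorProduct.lift (T.oslashₗ r s))) := by
  have hmem : ∀ ζ : C.Cc (r, s), C.toL2 κ ζ ∈ T.oslashClosure r s κ := by
    intro ζ
    obtain ⟨K, hK, hζK⟩ := ζ.2.2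
    obtain ⟨K', hK', hKK'⟩ := exists_compact_superset hK
    refine C.toL2_mem_of_approx κ T.isClosed_oslashClosure ζ hK'
      (fun u hu => hζK u fun h => hu (interior_subset (hKK' h))) fun ε hε => ?_
    -- A combination of sections `ξ ⊘ η` that is `ε`-close to `ζ` at `x` stays so near `x` by
    -- continuity of the norm. A partition of unity glues these, and multiplication by its functions
    -- stays in the closed span by `ccSmul_mem`.
    choose z hz using fun x : G × H =>
      Metric.denseRange_iff.1 (T.denseRange_oslash_apply (r := r) (s := s) x) (ζ.1 x) ε hε
    obtain ⟨I, φ, -, -, hφ0, hφ⟩ := hK.exists_partition_approx hKK' ζ.1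
      (fun x => (TensorProduct.lift (T.oslashₗ r s) (z x)).1) hε.le fun x _ => by
        have h := C.continuous_norm_cc (ζ - TensorProduct.lift (T.oslashₗ r s) (z x))
        refine (h.tendsto x).eventually (gt_mem_nhds ?_)
        have := hz x
        rwa [dist_eq_norm] at this
    have hsum : ∀ u, (∑ x ∈ I, C.ccSmul (φ x) (TensorProduct.lift (T.oslashₗ r s) (z x))).1 u =
        ∑ x ∈ I, φ x u • (TensorProduct.lift (T.oslashₗ r s) (z x)).1 u := fun u => by
      rw [C.cc_sum_apply]
      exact Finset.sum_congr rfl fun x _ => Complex.coe_smul _ _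
    refine ⟨∑ x ∈ I, C.ccSmul (φ x) (TensorProduct.lift (T.oslashₗ r s) (z x)), ?_, fun u _ => ?_,
      fun u hu => ?_⟩
    · rw [map_sum]
      exact Submodule.sum_mem _ fun x _ => T.ccSmul_mem (φ x) (z x)
    · rw [hsum]
      exact hφ u ((em (u ∈ K)).imp id (hζK u))
    · rw [hsum]
      exact Finset.sum_eq_zero fun x hx => by rw [hφ0 x hx u hu, zero_smul]
  have hcl : ∀ y, y ∈ T.oslashClosure r s κ := fun y =>
    (C.preL2 κ (r, s)).compl_induction y T.isClosed_oslashClosure hmem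
  intro y
  have := hcl y
  rw [oslashClosure, ← LinearMap.range_comp] at this
  exact this

variable [LocallyCompactSpace G] [LocallyCompactSpace H]

/-- Pointwise the two sides differ only in their scalars, so the product formula for the modular
functions, under the square root, is all that is needed. -/
theorem rho_oslash (hκ : μ.IsProd ν κ) (r : G) (s : H) (ξ : A.Cc 1) (η : B.Cc 1) :
    C.rho (r, s) (T.oslash ξ η : C.Cc (1, 1)) = T.oslash (A.rho r ξ) (B.rho s η) := by
  refine Subtype.ext (funext fun x => ?_)
  have hcast : ∀ {t t' : G} {u u' : H} (ht : t = t') (hu : u = u') (hw : (t, u) = (t', u'))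
      (a : A.Fiber t) (b : B.Fiber u),
      castFiber hw (T.tmul rfl a b) = T.tmul rfl (castFiber ht a) (castFiber hu b) := by
    rintro t _ u _ rfl rfl _ a b; rfl
  change ((√(FellBundle.modular (r, s)) : ℝ) : ℂ) • castFiber (mul_one (x * (r, s)))
      (T.tmul rfl (ξ.1 (x.1 * r)) (η.1 (x.2 * s))) =
    T.tmul rfl (((√(FellBundle.modular r) : ℝ) : ℂ) • castFiber (mul_one (x.1 * r)) (ξ.1 (x.1 * r)))
      (((√(FellBundle.modular s) : ℝ) : ℂ) • castFiber (mul_one (x.2 * s)) (η.1 (x.2 * s)))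
  rw [T.smul_tmul_smul, ← Complex.ofReal_mul,
    ← Real.sqrt_mul (FellBundle.modular_pos r).le, ← hκ.modular_prod]
  exact congrArg _ (hcast (mul_one (x.1 * r)) (mul_one (x.2 * s)) _ _ _)

end FellTensor


/-! ### Isomorphisms out of an exterior tensor product -/

section ExteriorTensor

open HilbertModule

variable {A B D E F Z X Y : Type*} [NonUnitalCStarAlgebra A] [NonUnitalCStarAlgebra B]
  [NonUnitalCStarAlgebra D] [NormedAddCommGroup E] [NormedSpace ℂ E] [NormedAddCommGroup F]
  [NormedSpace ℂ F] [HilbertModule A E] [HilbertModule B F] [NormedAddCommGroup Z] [NormedSpace ℂ Z]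
  [AddCommGroup X] [Module ℂ X] [AddCommGroup Y] [Module ℂ Y]
  (ι : A ⊗[ℂ] B →⋆ₙₐ[ℂ] D) (hι : DenseRange ι) {f : X →ₗ[ℂ] E} {g : Y →ₗ[ℂ] F}

theorem denseRange_toCompl_map (hf : DenseRange f) (hg : DenseRange g) :
    DenseRange ((preTensor E F ι hι).toCompl.comp (TensorProduct.map f g)) := by
  let N := (LinearMap.range
    ((preTensor E F ι hι).toCompl.comp (TensorProduct.map f g))).topologicalClosure
  have hN : IsClosed (N : Set (preTensor E F ι hι).Compl) :=
    Submodule.isClosed_topologicalClosure _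
  have hc := continuous_toCompl_tmul (E := E) (F := F) ι hι
  have h1 : ∀ (x : E) (y : F), (preTensor E F ι hι).toCompl (x ⊗ₜ[ℂ] y) ∈ N := by
    refine mem_of_dense_span ((TensorProduct.mk ℂ E F).compr₂ (preTensor E F ι hι).toCompl)
      (fun w => hc.comp (continuous_id.prodMk continuous_const))
      (fun v => hc.comp (continuous_const.prodMk continuous_id))
      (hf.mono Submodule.subset_span) (hg.mono Submodule.subset_span) N hN ?_
    rintro _ ⟨x, rfl⟩ _ ⟨y, rfl⟩
    exact Submodule.le_topologicalClosure _ ⟨x ⊗ₜ[ℂ] y, rfl⟩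
  have h2 : ∀ z : E ⊗[ℂ] F, (preTensor E F ι hι).toCompl z ∈ N := by
    intro z
    induction z with
    | zero => rw [map_zero]; exact zero_mem _
    | tmul x y => exact h1 x y
    | add z w hz hw => rw [map_add]; exact add_mem hz hw
  exact fun z => (preTensor E F ι hι).compl_induction z hN h2

/-- Continuous linear maps on an exterior tensor product are determined by their values on
elementary tensors. -/
theorem tensorCompl_ext (hf : DenseRange f) (hg : DenseRange g)
    {u v : (preTensor E F ι hι).Compl →ₗ[ℂ] Z} (hu : Continuous u) (hv : Continuous v)
    (h : ∀ x y, u ((preTensor E F ι hι).toCompl (f x ⊗ₜ[ℂ] g y)) =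
      v ((preTensor E F ι hι).toCompl (f x ⊗ₜ[ℂ] g y))) (z : (preTensor E F ι hι).Compl) :
    u z = v z := by
  have h1 : u.comp ((preTensor E F ι hι).toCompl.comp (TensorProduct.map f g)) =
      v.comp ((preTensor E F ι hι).toCompl.comp (TensorProduct.map f g)) :=
    TensorProduct.ext' fun x y => h x y
  exact congrFun ((denseRange_toCompl_map ι hι hf hg).equalizer hu hv
    (funext fun w => LinearMap.congr_fun h1 w)) z

variable [HilbertModule D Z] [CompleteSpace Z]

/-- By sesquilinearity inner products have to be compared on elementary tensors only. Both `j` and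
`ρ_r ⊗ ρ_s` arise from this criterion. -/
theorem exists_tensorCompl_iso (hf : DenseRange f) (hg : DenseRange g) (m : X ⊗[ℂ] Y →ₗ[ℂ] Z)
    (hm : DenseRange m)
    (h : ∀ x x' y y', (inner (m (x ⊗ₜ[ℂ] y)) (m (x' ⊗ₜ[ℂ] y')) : D) =
      ι ((inner (f x) (f x') : A) ⊗ₜ[ℂ] (inner (g y) (g y') : B))) :
    ∃ j : Iso (preTensor E F ι hι).Compl Z, ∀ x y,
      j.toLinearEquiv ((preTensor E F ι hι).toCompl (f x ⊗ₜ[ℂ] g y)) = m (x ⊗ₜ[ℂ] y) := by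
  obtain ⟨j, hj⟩ := exists_iso_of_denseRange
    ((preTensor E F ι hι).toCompl.comp (TensorProduct.map f g)) m
    (denseRange_toCompl_map ι hι hf hg) hm fun z w => by
      refine ((preTensor E F ι hι).inner_toCompl _ _).trans ?_
      change ι (tensorInner (TensorProduct.map f g z) (TensorProduct.map f g w)) = _
      induction z with
      | zero =>
        rw [map_zero, map_zero, map_zero, LinearMap.zero_apply, map_zero, ← star_inner,
          HilbertModule.inner_zero_right, star_zero]
      | add z z' hz hz' =>
        rw [map_add, map_add, map_add, LinearMap.add_apply, map_add, hz, hz', add_inner]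
      | tmul x y =>
        induction w with
        | zero => rw [map_zero, map_zero, map_zero, map_zero, HilbertModule.inner_zero_right]
        | add w w' hw hw' => rw [map_add, map_add, map_add, map_add, hw, hw', inner_add]
        | tmul x' y' => exact (h x x' y y').symm
  exact ⟨j, fun x y => hj (x ⊗ₜ[ℂ] y)⟩

theorem HilbertModule.Compacts.dense_span_thetaK_of_denseRange [CompleteSpace E]
    (hf : DenseRange f) :
    Dense (Submodule.span ℂ {k : Compacts E | ∃ x y, k = thetaK (f x) (f y)} :
      Set (Compacts E)) := by
  rw [Submodule.dense_iff_topologicalClosure_eq_top, eq_top_iff,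
    ← (Submodule.dense_iff_topologicalClosure_eq_top).1 (Compacts.dense_span_thetaK E)]
  refine Submodule.topologicalClosure_minimal _ (Submodule.span_le.2 ?_)
    (Submodule.isClosed_topologicalClosure _)
  rintro _ ⟨x, y, rfl⟩
  refine (hf.prodMap hf).induction_on (p := fun p : E × E => thetaK p.1 p.2 ∈
    (Submodule.span ℂ {k : Compacts E | ∃ x y, k = thetaK (f x) (f y)}).topologicalClosure) (x, y)
    ((Submodule.isClosed_topologicalClosure _).preimage HilbertModule.continuous_thetaK) fun p => ?_
  exact Submodule.le_topologicalClosure _ (Submodule.subset_span ⟨p.1, p.2, rfl⟩)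

theorem IsCStarNorm.equiv_ext {A B D : Type*} [NonUnitalCStarAlgebra A] [NonUnitalCStarAlgebra B]
    [NonUnitalCStarAlgebra D] {p : A ⊗[ℂ] B → ℝ} (hp : IsCStarNorm p) {S : Set A} {S' : Set B}
    (hS : Dense (Submodule.span ℂ S : Set A)) (hS' : Dense (Submodule.span ℂ S' : Set B))
    {Φ Ψ : hp.Compl ≃⋆ₐ[ℂ] D}
    (h : ∀ a ∈ S, ∀ b ∈ S', Φ (hp.toCompl (a ⊗ₜ[ℂ] b)) = Ψ (hp.toCompl (a ⊗ₜ[ℂ] b))) :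
    Φ = Ψ := by
  let u : hp.Compl →ₗ[ℂ] D :=
    { toFun := Φ, map_add' := map_add Φ, map_smul' := map_smul Φ }
  let v : hp.Compl →ₗ[ℂ] D :=
    { toFun := Ψ, map_add' := map_add Ψ, map_smul' := map_smul Ψ }
  have hu : Continuous u := (NonUnitalStarAlgHom.isometry Φ (EquivLike.injective Φ)).continuous
  have hv : Continuous v := (NonUnitalStarAlgHom.isometry Ψ (EquivLike.injective Ψ)).continuous
  have h1 : ∀ c, hp.toComplHom c ∈ LinearMap.eqLocus u v :=
    map_mem_of_dense_span hp.toComplHom hS hS' (LinearMap.eqLocus u v) (isClosed_eq hu hv) h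
  have h2 : (u : hp.Compl → D) = v := hp.denseRange_toComplHom.equalizer hu hv (funext h1)
  exact StarAlgEquiv.ext fun d => congrFun h2 d

theorem tensorCompactsHom_thetaK [CompleteSpace E] [CompleteSpace F]
    (j : Iso (preTensor E F ι hι).Compl Z) (x x' : E) (y y' : F) :
    tensorCompactsHom ι hι j (thetaK x x' ⊗ₜ[ℂ] thetaK y y') =
      thetaK (j.toLinearEquiv ((preTensor E F ι hι).toCompl (x ⊗ₜ[ℂ] y)))
        (j.toLinearEquiv ((preTensor E F ι hι).toCompl (x' ⊗ₜ[ℂ] y'))) :=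
  Subtype.ext (tensorCompactsRep_thetaK ι hι j x x' y y')

/-- The norm `p` is the operator norm of `𝒦(E) ⊙ 𝒦(F)` on the exterior tensor product, which
`tensorRep_isNorm` identifies as the norm `α`. The action conjugated by `j` is isometric for it with
dense range in `𝒦(Z)`. Uniqueness holds because the `θ` of vectors from dense subspaces already span
densely. -/
theorem exists_compacts_equiv [CompleteSpace E] [CompleteSpace F] (α : TensorKind)
    (hα : α.IsNorm fun c => ‖ι c‖) (hE : IsFaithful A E) (hF : IsFaithful B F)
    (hf : DenseRange f) (hg : DenseRange g) (j : Iso (preTensor E F ι hι).Compl Z)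
    (m : X → Y → Z)
    (hm : ∀ x y, j.toLinearEquiv ((preTensor E F ι hι).toCompl (f x ⊗ₜ[ℂ] g y)) = m x y) :
    ∃ (p : Compacts E ⊗[ℂ] Compacts F → ℝ) (hp : α.IsNorm p)
      (Φ : hp.isCStarNorm.Compl ≃⋆ₐ[ℂ] Compacts Z),
      (∀ (k : Compacts E) (l : Compacts F) (x : E) (y : F),
        (Φ (hp.isCStarNorm.toCompl (k ⊗ₜ[ℂ] l))).app
            (j.toLinearEquiv ((preTensor E F ι hι).toCompl (x ⊗ₜ[ℂ] y))) =
          j.toLinearEquiv ((preTensor E F ι hι).toCompl (k.app x ⊗ₜ[ℂ] l.app y))) ∧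
      (∀ (x x' : X) (y y' : Y),
        Φ (hp.isCStarNorm.toCompl (thetaK (f x) (f x') ⊗ₜ[ℂ] thetaK (g y) (g y'))) =
          thetaK (m x y) (m x' y')) ∧
      ∀ Φ' : hp.isCStarNorm.Compl ≃⋆ₐ[ℂ] Compacts Z,
        (∀ (x x' : X) (y y' : Y),
          Φ' (hp.isCStarNorm.toCompl (thetaK (f x) (f x') ⊗ₜ[ℂ] thetaK (g y) (g y'))) =
            thetaK (m x y) (m x' y')) →
        Φ' = Φ := by
  have hp := tensorRep_isNorm ι hι α hα hE hF
  obtain ⟨Φ, hΦ⟩ := hp.isCStarNorm.exists_equiv (tensorCompactsHom ι hι j)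
    (denseRange_tensorCompactsHom ι hι j) (fun c => norm_tensorCompactsRep ι hι j c)
  have hθ : ∀ (x x' : X) (y y' : Y),
      Φ (hp.isCStarNorm.toCompl (thetaK (f x) (f x') ⊗ₜ[ℂ] thetaK (g y) (g y'))) =
        thetaK (m x y) (m x' y') := fun x x' y y' =>
    ((hΦ _).trans (tensorCompactsHom_thetaK ι hι j (f x) (f x') (g y) (g y'))).trans
      (congrArg₂ thetaK (hm x y) (hm x' y'))
  refine ⟨_, hp, Φ, fun k l x y => ?_, hθ, fun Φ' hΦ' => ?_⟩
  · exact (congrArg (fun m : Compacts Z => m.app _) (hΦ _)).trans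
      (tensorCompactsRep_apply ι hι j k l x y)
  · refine hp.isCStarNorm.equiv_ext (Compacts.dense_span_thetaK_of_denseRange hf)
      (Compacts.dense_span_thetaK_of_denseRange hg) ?_
    rintro _ ⟨x, x', rfl⟩ _ ⟨y, y', rfl⟩
    exact (hΦ' x x' y y').trans (hθ _ _ _ _).symm

end ExteriorTensor


/-! ### The three statements for Fell bundles -/

namespace FellTensor

variable {G H : Type*} [Group G] [TopologicalSpace G] [IsTopologicalGroup G] [T2Space G]
  [Group H] [TopologicalSpace H] [IsTopologicalGroup H] [T2Space H]
  {μ : HaarMeasure G} {ν : HaarMeasure H} {κ : HaarMeasure (G × H)} {α : TensorKind}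
  {A : FellBundle G} {B : FellBundle H} {C : FellBundle (G × H)} (T : FellTensor α A B C)

theorem exists_extendsOslash [LocallyCompactSpace G] [LocallyCompactSpace H]
    (hκ : μ.IsProd ν κ) (r : G) (s : H) :
    ∃ j : HilbertModule.Iso (T.L2Tensor μ ν r s) (C.L2 κ (r, s)), T.ExtendsOslash μ ν κ j :=
  exists_tensorCompl_iso T.unitHom T.denseRange_unitHom (A.preL2 μ r).denseRange_toCompl
    (B.preL2 ν s).denseRange_toCompl ((C.toL2 κ).comp (TensorProduct.lift (T.oslashₗ r s)))
    T.denseRange_toL2_oslash fun ξ ξ' η η' => T.inner_toL2_oslash hκ ξ ξ' η η'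

theorem ExtendsOslash.unique {r : G} {s : H}
    {j j' : HilbertModule.Iso (T.L2Tensor μ ν r s) (C.L2 κ (r, s))}
    (hj : T.ExtendsOslash μ ν κ j) (hj' : T.ExtendsOslash μ ν κ j') : j' = j :=
  HilbertModule.Iso.ext <| tensorCompl_ext T.unitHom T.denseRange_unitHom
    (u := j'.toLinearEquiv.toLinearMap) (v := j.toLinearEquiv.toLinearMap)
    (A.preL2 μ r).denseRange_toCompl (B.preL2 ν s).denseRange_toCompl j'.continuous j.continuous
    fun ξ η => (hj' ξ η).trans (hj ξ η).symm

/-- The exterior tensor product of isomorphisms of Hilbert modules. -/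
theorem exists_tensor_iso {r r' : G} {s s' : H} (U : HilbertModule.Iso (A.L2 μ r) (A.L2 μ r'))
    (V : HilbertModule.Iso (B.L2 ν s) (B.L2 ν s')) :
    ∃ W : HilbertModule.Iso (T.L2Tensor μ ν r s) (T.L2Tensor μ ν r' s'), ∀ x y,
      W.toLinearEquiv (T.tensor μ ν x y) =
        T.tensor μ ν (U.toLinearEquiv x) (V.toLinearEquiv y) :=
  exists_tensorCompl_iso T.unitHom T.denseRange_unitHom (f := LinearMap.id) (g := LinearMap.id)
    denseRange_id denseRange_id
    ((T.preL2Tensor μ ν r' s').toCompl.comp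
      (TensorProduct.map U.toLinearEquiv.toLinearMap V.toLinearEquiv.toLinearMap))
    (denseRange_toCompl_map T.unitHom T.denseRange_unitHom U.toLinearEquiv.surjective.denseRange
      V.toLinearEquiv.surjective.denseRange) fun x x' y y' => by
      refine ((T.preL2Tensor μ ν r' s').inner_toCompl _ _).trans ?_
      exact congrArg₂ (fun a b => T.unitHom (a ⊗ₜ[ℂ] b)) (U.inner_map x x') (V.inner_map y y')

theorem exists_iso_comm [LocallyCompactSpace G] [LocallyCompactSpace H] (hκ : μ.IsProd ν κ)
    {r : G} {s : H} {j : HilbertModule.Iso (T.L2Tensor μ ν r s) (C.L2 κ (r, s))}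
    (hj : T.ExtendsOslash μ ν κ j) :
    ∃ (j₂ : HilbertModule.Iso (T.L2Tensor μ ν 1 1) (C.L2 κ 1))
      (ρA : HilbertModule.Iso (A.L2 μ 1) (A.L2 μ r))
      (ρB : HilbertModule.Iso (B.L2 ν 1) (B.L2 ν s))
      (ρAB : HilbertModule.Iso (T.L2Tensor μ ν 1 1) (T.L2Tensor μ ν r s))
      (ρC : HilbertModule.Iso (C.L2 κ 1) (C.L2 κ (r, s))),
      T.ExtendsOslash μ ν κ j₂ ∧ A.ExtendsRho μ ρA ∧ B.ExtendsRho ν ρB ∧ C.ExtendsRho κ ρC ∧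
      (∀ x y, ρAB.toLinearEquiv (T.tensor μ ν x y) =
        T.tensor μ ν (ρA.toLinearEquiv x) (ρB.toLinearEquiv y)) ∧
      ∀ z, j.toLinearEquiv (ρAB.toLinearEquiv z) = ρC.toLinearEquiv (j₂.toLinearEquiv z) := by
  obtain ⟨j₂, hj₂⟩ := T.exists_extendsOslash hκ 1 1
  obtain ⟨ρA, hρA⟩ := A.exists_extendsRho μ r
  obtain ⟨ρB, hρB⟩ := B.exists_extendsRho ν s
  obtain ⟨ρC, hρC⟩ := C.exists_extendsRho κ (r, s)
  obtain ⟨ρAB, hρAB⟩ := T.exists_tensor_iso ρA ρB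
  refine ⟨j₂, ρA, ρB, ρAB, ρC, hj₂, hρA, hρB, hρC, hρAB, ?_⟩
  -- Both composites are continuous and linear, so it suffices to compare them on `ξ ⊗ η`, where the
  -- square is `rho_oslash`.
  refine tensorCompl_ext T.unitHom T.denseRange_unitHom
    (u := j.toLinearEquiv.toLinearMap.comp ρAB.toLinearEquiv.toLinearMap)
    (v := ρC.toLinearEquiv.toLinearMap.comp j₂.toLinearEquiv.toLinearMap)
    (A.preL2 μ 1).denseRange_toCompl (B.preL2 ν 1).denseRange_toCompl
    (j.continuous.comp ρAB.continuous) (ρC.continuous.comp j₂.continuous) fun ξ η => ?_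
  exact (congrArg j.toLinearEquiv ((hρAB (A.toL2 μ ξ) (B.toL2 ν η)).trans
    (congrArg₂ (T.tensor μ ν) (hρA ξ) (hρB η)))).trans ((hj _ _).trans
      ((congrArg (C.toL2 κ) (T.rho_oslash hκ r s ξ η)).symm.trans
        ((congrArg ρC.toLinearEquiv (hj₂ ξ η)).trans (hρC _)).symm))

theorem exists_compacts_iso [LocallyCompactSpace G] [LocallyCompactSpace H] {r : G} {s : H}
    {j : HilbertModule.Iso (T.L2Tensor μ ν r s) (C.L2 κ (r, s))}
    (hj : T.ExtendsOslash μ ν κ j) :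
    ∃ (p : A.I μ r ⊗[ℂ] B.I ν s → ℝ) (hp : α.IsNorm p)
      (Φ : hp.isCStarNorm.Compl ≃⋆ₐ[ℂ] C.I κ (r, s)),
      (∀ (k : A.I μ r) (l : B.I ν s) (x : A.L2 μ r) (y : B.L2 ν s),
        (Φ (hp.isCStarNorm.toCompl (k ⊗ₜ[ℂ] l))).app (j.toLinearEquiv (T.tensor μ ν x y)) =
          j.toLinearEquiv (T.tensor μ ν (k.app x) (l.app y))) ∧
      (∀ (ξ₁ ξ₂ : A.Cc r) (η₁ η₂ : B.Cc s),
        Φ (hp.isCStarNorm.toCompl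
          (HilbertModule.thetaK (A.toL2 μ ξ₁) (A.toL2 μ ξ₂) ⊗ₜ[ℂ]
            HilbertModule.thetaK (B.toL2 ν η₁) (B.toL2 ν η₂))) =
          HilbertModule.thetaK (C.toL2 κ (T.oslash ξ₁ η₁)) (C.toL2 κ (T.oslash ξ₂ η₂))) ∧
      ∀ Φ' : hp.isCStarNorm.Compl ≃⋆ₐ[ℂ] C.I κ (r, s),
        (∀ (ξ₁ ξ₂ : A.Cc r) (η₁ η₂ : B.Cc s),
          Φ' (hp.isCStarNorm.toCompl
            (HilbertModule.thetaK (A.toL2 μ ξ₁) (A.toL2 μ ξ₂) ⊗ₜ[ℂ]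
              HilbertModule.thetaK (B.toL2 ν η₁) (B.toL2 ν η₂))) =
            HilbertModule.thetaK (C.toL2 κ (T.oslash ξ₁ η₁)) (C.toL2 κ (T.oslash ξ₂ η₂))) →
        Φ' = Φ :=
  exists_compacts_equiv T.unitHom T.denseRange_unitHom α T.isNorm (A.isFaithful_L2 μ r)
    (B.isFaithful_L2 ν s) (A.preL2 μ r).denseRange_toCompl (B.preL2 ν s).denseRange_toCompl j
    (fun ξ η => C.toL2 κ (T.oslash ξ η)) hj

end FellTensor

end

theorem proposition3p3 {G H : Type*}
    [Group G] [TopologicalSpace G] [IsTopologicalGroup G] [LocallyCompactSpace G] [T2Space G]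
    [Group H] [TopologicalSpace H] [IsTopologicalGroup H] [LocallyCompactSpace H] [T2Space H]
    (μ : HaarMeasure G) (ν : HaarMeasure H) (κ : HaarMeasure (G × H)) (hκ : μ.IsProd ν κ)
    (α : TensorKind) (A : FellBundle G) (B : FellBundle H) (C : FellBundle (G × H))
    (T : FellTensor α A B C) (r : G) (s : H) :
    -- there is a unique isomorphism `j` of Hilbert modules extending `ξ ⊙ η ↦ ξ ⊘ η`
    ∃ j : HilbertModule.Iso (T.L2Tensor μ ν r s) (C.L2 κ (r, s)),
      T.ExtendsOslash μ ν κ j ∧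
      (∀ j' : HilbertModule.Iso (T.L2Tensor μ ν r s) (C.L2 κ (r, s)),
        T.ExtendsOslash μ ν κ j' → j' = j) ∧
      -- it satisfies `j ∘ (ρ_r ⊗ ρ_s) = ρ_{(r,s)} ∘ j₂`
      (∃ (j₂ : HilbertModule.Iso (T.L2Tensor μ ν 1 1) (C.L2 κ 1))
        (ρA : HilbertModule.Iso (A.L2 μ 1) (A.L2 μ r))
        (ρB : HilbertModule.Iso (B.L2 ν 1) (B.L2 ν s))
        (ρAB : HilbertModule.Iso (T.L2Tensor μ ν 1 1) (T.L2Tensor μ ν r s))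
        (ρC : HilbertModule.Iso (C.L2 κ 1) (C.L2 κ (r, s))),
        T.ExtendsOslash μ ν κ j₂ ∧ A.ExtendsRho μ ρA ∧ B.ExtendsRho ν ρB ∧ C.ExtendsRho κ ρC ∧
        (∀ x y, ρAB.toLinearEquiv (T.tensor μ ν x y) =
          T.tensor μ ν (ρA.toLinearEquiv x) (ρB.toLinearEquiv y)) ∧
        ∀ z, j.toLinearEquiv (ρAB.toLinearEquiv z) = ρC.toLinearEquiv (j₂.toLinearEquiv z)) ∧
      -- it induces an isomorphism `I_r(𝒜) ⊗_α I_s(ℬ) ≅ I_{(r,s)}(𝒜 ⊗_α ℬ)`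
      ∃ (p : A.I μ r ⊗[ℂ] B.I ν s → ℝ) (hp : α.IsNorm p)
        (Φ : hp.isCStarNorm.Compl ≃⋆ₐ[ℂ] C.I κ (r, s)),
        (∀ (k : A.I μ r) (l : B.I ν s) (x : A.L2 μ r) (y : B.L2 ν s),
          (Φ (hp.isCStarNorm.toCompl (k ⊗ₜ[ℂ] l))).app (j.toLinearEquiv (T.tensor μ ν x y)) =
            j.toLinearEquiv (T.tensor μ ν (k.app x) (l.app y))) ∧
        (∀ (ξ₁ ξ₂ : A.Cc r) (η₁ η₂ : B.Cc s),
          Φ (hp.isCStarNorm.toCompl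
            (HilbertModule.thetaK (A.toL2 μ ξ₁) (A.toL2 μ ξ₂) ⊗ₜ[ℂ]
              HilbertModule.thetaK (B.toL2 ν η₁) (B.toL2 ν η₂))) =
            HilbertModule.thetaK (C.toL2 κ (T.oslash ξ₁ η₁)) (C.toL2 κ (T.oslash ξ₂ η₂))) ∧
        ∀ Φ' : hp.isCStarNorm.Compl ≃⋆ₐ[ℂ] C.I κ (r, s),
          (∀ (ξ₁ ξ₂ : A.Cc r) (η₁ η₂ : B.Cc s),
            Φ' (hp.isCStarNorm.toCompl
              (HilbertModule.thetaK (A.toL2 μ ξ₁) (A.toL2 μ ξ₂) ⊗ₜ[ℂ]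
                HilbertModule.thetaK (B.toL2 ν η₁) (B.toL2 ν η₂))) =
              HilbertModule.thetaK (C.toL2 κ (T.oslash ξ₁ η₁)) (C.toL2 κ (T.oslash ξ₂ η₂))) →
          Φ' = Φ := by
  exact (T.exists_extendsOslash hκ r s).elim fun j hj =>
    ⟨j, hj, fun _ hj' => hj.unique T hj', T.exists_iso_comm hκ hj, T.exists_compacts_iso hj⟩
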